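/- Let $(M^n,g)$ be a smooth $n$-dimensional Riemannian manifold (without boundary), $u\in C^\infty(M)$, $V=e^{u}$, $\lambda,\mu\in\mathbb R$ and $\tau=(n+1)\lambda+\mu$. Let $\nabla$, $\Delta$, $dv_g$ be the Riemannian gradient, Laplacian and volume measure, and for smooth $\phi$ let $$\nabla^{D}\phi=V^{\mu-\lambda}\nabla\phi,\qquad \Delta^{D}\phi=V^{\mu-\lambda}\bigl[\Delta\phi+(2\mu+n\lambda)\langle\nabla u,\nabla\phi\rangle\bigr]$$ be the affine gradient and the affine Laplacian of the connection $D_XY=\nabla_XY+\lambda\,du(X)Y+\lambda\,du(Y)X+\mu\,g(X,Y)\nabla u$. Let $\rho:M\to[0,\infty)$ be continuous, and suppose that $|\nabla^D\rho|=1$ on the open set $\Omega=M\setminus\rho^{-1}\{0\}$ in the sense of distributions, i.e. $\rho$ has a weak gradient $\nabla\rho$ on $\Omega$ with $|V^{\mu-\lambda}\nabla\rho|=1$ almost everywhere on $\Omega$. For a constant $C\in\mathbb R$, the inequality $\Delta^D\rho\le \frac C\rho V^{\lambda-\mu}$ in the sense of distributions means that $$\int_M \rho\,\Delta^D\psi\,V^\tau\,dv_g\le\int_M\frac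 C\rho V^{\lambda-\mu}\psi\,V^\tau\,dv_g\qquad\text{for all }0\le\psi\in C_0^\infty(\Omega),$$ and $\Delta^D\rho\ge \frac C\rho V^{\lambda-\mu}$ is defined likewise with $\ge$. Then the following hold for every $\phi\in C_0^\infty(\Omega)$. (i) If $\Delta^D\rho\le \frac C\rho V^{\lambda-\mu}$ in the sense of distributions with a constant $C<1$, and $2<\alpha<3-C$, then $$\int_M\rho^{\alpha}(\Delta^D\phi)^2V^{\tau+\mu-\lambda}\,dv_g\ \ge\ 2(\alpha-2)(3-\alpha-C)\int_M\rho^{\alpha-2}|\nabla^D\phi|^2V^{\tau+\lambda-\mu}\,dv_g .$$ (ii) If $\Delta^D\rho\ge \frac C\rho V^{\lambda-\mu}$ in the sense of distributions with a constant $C>1$, and $\frac{7-C}{3}<\alpha<2$, then $$\int_M\rho^{\alpha}(\Delta^D\phi)^2V^{\tau+\mu-\lambda}\,dv_g\ \ge\ \frac{(C-\alpha+1)^2}{4}\int_M\rho^{\alpha-2}|\nabla^D\phi|^2V^{\tau+\lambda-\mu}\,dv_g .$$ -/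

import Mathlib

open MeasureTheory Set
open scoped Manifold ContDiff Bundle

noncomputable section

/-- A smooth Riemannian metric on the `n`-dimensional manifold `M` (without boundary). -/
abbrev SmoothMetric (n : ℕ) (M : Type*) [TopologicalSpace M]
    [ChartedSpace (EuclideanSpace ℝ (Fin n)) M] [IsManifold (𝓡 n) ∞ M] :=
  Bundle.ContMDiffRiemannianMetric (𝓡 n) ∞ (EuclideanSpace ℝ (Fin n))
    (fun x : M => TangentSpace (𝓡 n) x)

/-- A smooth vector field on `M`. -/
def IsSmoothVectorField {n : ℕ} {M : Type*} [TopologicalSpace M]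
    [ChartedSpace (EuclideanSpace ℝ (Fin n)) M] [IsManifold (𝓡 n) ∞ M]
    (X : (x : M) → TangentSpace (𝓡 n) x) : Prop :=
  ContMDiff (𝓡 n) (𝓡 n).tangent ∞
    (fun x => (⟨x, X x⟩ : TangentBundle (𝓡 n) M))

/-- The support of a vector field: the closure of the set where it does not vanish. -/
def fieldSupport {n : ℕ} {M : Type*} [TopologicalSpace M]
    [ChartedSpace (EuclideanSpace ℝ (Fin n)) M]
    (X : (x : M) → TangentSpace (𝓡 n) x) : Set M :=
  closure {x | X x ≠ 0}

/-- The space `C₀^∞(Ω)` of smooth functions on `M` with compact support contained in `Ω`. -/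
def IsTestFunction (n : ℕ) {M : Type*} [TopologicalSpace M]
    [ChartedSpace (EuclideanSpace ℝ (Fin n)) M] (Ω : Set M) (φ : M → ℝ) : Prop :=
  ContMDiff (𝓡 n) 𝓘(ℝ, ℝ) ∞ φ ∧ HasCompactSupport φ ∧ tsupport φ ⊆ Ω

/-- The tangent space of `ℝⁿ` at `z`, identified with `ℝⁿ`: a vector of `ℝⁿ` as a tangent
vector at `z`. -/
def toTangent {n : ℕ} (z v : EuclideanSpace ℝ (Fin n)) : TangentSpace (𝓡 n) z := v

/-- The tangent space of `ℝⁿ` at `z`, identified with `ℝⁿ`: a tangent vector at `z` as a vector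
of `ℝⁿ`. -/
def ofTangent {n : ℕ} (z : EuclideanSpace ℝ (Fin n)) (v : TangentSpace (𝓡 n) z) :
    EuclideanSpace ℝ (Fin n) := v

section Riemannian

variable {n : ℕ} {M : Type*} [TopologicalSpace M]
  [ChartedSpace (EuclideanSpace ℝ (Fin n)) M] [IsManifold (𝓡 n) ∞ M]

/-- The scalar product `⟨v, w⟩` on `T_xM`, as a bilinear form. -/
def metricForm (g : SmoothMetric n M) (x : M) :
    LinearMap.BilinForm ℝ (TangentSpace (𝓡 n) x) :=
  LinearMap.mk₂ ℝ (fun v w => g.inner x v w) (by simp) (by simp) (by simp) (by simp)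

theorem metricForm_nondegenerate (g : SmoothMetric n M) (x : M) :
    (metricForm g x).Nondegenerate := by
  refine ⟨fun v hv => ?_, fun v hv => ?_⟩ <;>
  · by_contra h
    exact (g.pos x v h).ne' (hv v)

/-- The norm `|v| = √⟨v, v⟩` on `T_xM`. -/
def metricNorm (g : SmoothMetric n M) (x : M) (v : TangentSpace (𝓡 n) x) : ℝ :=
  √(g.inner x v v)

/-- The coordinate vector field `∂_i` of the chart at `x₀`, at the point with coordinates `z`. -/
def coordVector (x₀ : M) (i : Fin n) (z : EuclideanSpace ℝ (Fin n)) :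
    TangentSpace (𝓡 n) ((chartAt (EuclideanSpace ℝ (Fin n)) x₀).symm z) :=
  mfderiv (𝓡 n) (𝓡 n) (chartAt (EuclideanSpace ℝ (Fin n)) x₀).symm z
    (toTangent z (EuclideanSpace.single i (1 : ℝ)))

/-- The matrix `g_{ij}(z) = ⟨∂_i, ∂_j⟩` of the metric in the coordinates given by the chart at
`x₀`, where `z` ranges over the target of the chart. -/
def gram (g : SmoothMetric n M) (x₀ : M) (z : EuclideanSpace ℝ (Fin n)) :
    Matrix (Fin n) (Fin n) ℝ :=
  fun i j => g.inner ((chartAt (EuclideanSpace ℝ (Fin n)) x₀).symm z)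
    (coordVector x₀ i z) (coordVector x₀ j z)

/-- The density `√(det g_{ij})` of the volume element in the chart at `x₀`. -/
def volDensity (g : SmoothMetric n M) (x₀ : M) (z : EuclideanSpace ℝ (Fin n)) : ℝ :=
  √((gram g x₀ z).det)

/-- The volume element `√(det g_{ij}) dz¹ ⋯ dzⁿ` of the domain of the chart at `x₀`, as a measure
on `M` that vanishes outside this domain. -/
def chartVolume [MeasurableSpace M] (g : SmoothMetric n M) (x₀ : M) : Measure M :=
  ((volume.restrict (chartAt (EuclideanSpace ℝ (Fin n)) x₀).target).withDensity
    (fun z => ENNReal.ofReal (volDensity g x₀ z))).map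
    (chartAt (EuclideanSpace ℝ (Fin n)) x₀).symm

/-- The Riemannian volume measure `dv_g`. The measures `chartVolume g x₀` agree on the overlaps
of the domains of the charts, so that their supremum is the measure on `M` obtained by gluing
them. -/
def riemannianVolume [MeasurableSpace M] (g : SmoothMetric n M) : Measure M :=
  ⨆ x₀ : M, chartVolume g x₀

/-- The gradient `∇φ`: the vector field with `⟨∇φ, v⟩ = dφ(v)` for all tangent vectors `v`. -/
def grad (g : SmoothMetric n M) (φ : M → ℝ) (x : M) : TangentSpace (𝓡 n) x :=
  haveI : FiniteDimensional ℝ (TangentSpace (𝓡 n) x) :=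
    inferInstanceAs (FiniteDimensional ℝ (EuclideanSpace ℝ (Fin n)))
  ((metricForm g x).toDual (metricForm_nondegenerate g x)).symm
    (mfderiv (𝓡 n) 𝓘(ℝ, ℝ) φ x : TangentSpace (𝓡 n) x →L[ℝ] ℝ).toLinearMap

/-- The `i`-th component `X^i(z)` of the vector field `X` in the coordinates of the chart
at `x₀`. -/
def fieldCoord (X : (x : M) → TangentSpace (𝓡 n) x) (x₀ : M) (i : Fin n)
    (z : EuclideanSpace ℝ (Fin n)) : ℝ :=
  ofTangent _ (mfderiv (𝓡 n) (𝓡 n) (chartAt (EuclideanSpace ℝ (Fin n)) x₀)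
    ((chartAt (EuclideanSpace ℝ (Fin n)) x₀).symm z)
    (X ((chartAt (EuclideanSpace ℝ (Fin n)) x₀).symm z))) i

/-- The divergence `div X = (det g)^{-1/2} ∑_i ∂_i ((det g)^{1/2} X^i)`, where the value at `x` is
computed in the coordinates of the chart at `x`. -/
def divergence (g : SmoothMetric n M) (X : (x : M) → TangentSpace (𝓡 n) x) (x : M) : ℝ :=
  (volDensity g x (chartAt (EuclideanSpace ℝ (Fin n)) x x))⁻¹ *
    ∑ i : Fin n,
      fderiv ℝ (fun z => volDensity g x z * fieldCoord X x i z)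
        (chartAt (EuclideanSpace ℝ (Fin n)) x x) (EuclideanSpace.single i (1 : ℝ))

/-- The Laplacian `Δφ = div ∇φ`. -/
def laplacian (g : SmoothMetric n M) (φ : M → ℝ) (x : M) : ℝ :=
  divergence g (grad g φ) x

/-- `G` is the weak gradient of `f` on the open set `Ω`: it is a locally integrable vector field
on `Ω` with `∫ f div X = -∫ ⟨G, X⟩` for all smooth vector fields `X` with compact support in `Ω`.
The local integrability (and measurability) of `G` is expressed by the integrability of `⟨G, X⟩`
for all these `X`. -/
def HasWeakGradientOn [MeasurableSpace M] (g : SmoothMetric n M) (Ω : Set M) (f : M → ℝ)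
    (G : (x : M) → TangentSpace (𝓡 n) x) : Prop :=
  LocallyIntegrableOn f Ω (riemannianVolume g) ∧
  ∀ X : (x : M) → TangentSpace (𝓡 n) x, IsSmoothVectorField X →
    IsCompact (fieldSupport X) → fieldSupport X ⊆ Ω →
      Integrable (fun x => g.inner x (G x) (X x)) (riemannianVolume g) ∧
      ∫ x, f x * divergence g X x ∂(riemannianVolume g) =
        -∫ x, g.inner x (G x) (X x) ∂(riemannianVolume g)

/-- The function `V = e^u`. -/
def expWeight (u : M → ℝ) (x : M) : ℝ := Real.exp (u x)

/-- The exponent `τ = (n+1)λ + μ`. -/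
def tauExp (n : ℕ) (lam mu : ℝ) : ℝ := ((n : ℝ) + 1) * lam + mu

/-- The affine gradient `∇^D φ = V^{μ-λ} ∇φ`. -/
def affineGrad (g : SmoothMetric n M) (u : M → ℝ) (lam mu : ℝ) (φ : M → ℝ) (x : M) :
    TangentSpace (𝓡 n) x :=
  (expWeight u x ^ (mu - lam)) • grad g φ x

/-- The affine Laplacian `Δ^D φ = V^{μ-λ} (Δφ + (2μ+nλ) ⟨∇u, ∇φ⟩)`. -/
def affineLaplacian (g : SmoothMetric n M) (u : M → ℝ) (lam mu : ℝ) (φ : M → ℝ) (x : M) : ℝ :=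
  expWeight u x ^ (mu - lam) *
    (laplacian g φ x + (2 * mu + (n : ℝ) * lam) * g.inner x (grad g u x) (grad g φ x))

/-- `|∇^D f| = 1` on the open set `Ω` in the sense of distributions: `f` has a weak gradient `G`
on `Ω`, and `|V^{μ-λ} G| = 1` almost everywhere on `Ω`. -/
def WeakAffineGradNormEqOne [MeasurableSpace M] (g : SmoothMetric n M) (u : M → ℝ)
    (lam mu : ℝ) (Ω : Set M) (f : M → ℝ) : Prop :=
  ∃ G : (x : M) → TangentSpace (𝓡 n) x, HasWeakGradientOn g Ω f G ∧
    ∀ᵐ x ∂(riemannianVolume g), x ∈ Ω →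
      metricNorm g x ((expWeight u x ^ (mu - lam)) • G x) = 1

/-- `Δ^D f ≤ F` on the open set `Ω` in the sense of distributions. The operator `Δ^D` is symmetric
with respect to the measure `V^τ dv_g`, so this is tested against nonnegative test functions with
respect to this measure. -/
def WeakAffineLaplacianLE [MeasurableSpace M] (g : SmoothMetric n M) (u : M → ℝ)
    (lam mu : ℝ) (Ω : Set M) (f F : M → ℝ) : Prop :=
  ∀ ψ : M → ℝ, IsTestFunction n Ω ψ → (∀ x, 0 ≤ ψ x) →
    ∫ x, f x * affineLaplacian g u lam mu ψ x * expWeight u x ^ tauExp n lam mu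
        ∂(riemannianVolume g) ≤
      ∫ x, F x * ψ x * expWeight u x ^ tauExp n lam mu ∂(riemannianVolume g)

/-- `Δ^D f ≥ F` on the open set `Ω` in the sense of distributions. -/
def WeakAffineLaplacianGE [MeasurableSpace M] (g : SmoothMetric n M) (u : M → ℝ)
    (lam mu : ℝ) (Ω : Set M) (f F : M → ℝ) : Prop :=
  ∀ ψ : M → ℝ, IsTestFunction n Ω ψ → (∀ x, 0 ≤ ψ x) →
    ∫ x, F x * ψ x * expWeight u x ^ tauExp n lam mu ∂(riemannianVolume g) ≤
      ∫ x, f x * affineLaplacian g u lam mu ψ x * expWeight u x ^ tauExp n lam mu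
        ∂(riemannianVolume g)

end Riemannian

end

noncomputable section

/-! With `w = V^{2μ+nλ}` and `b = V^{λ-μ}`, the affine Laplacian satisfies `V^τ Δ^D φ = div (w ∇φ)`,
and `|∇^D ρ| = 1` becomes `|∇ρ| = b`. Both claims are thereby Rellich inequalities for a weighted
Riemannian Laplacian. Put `β = α - 2` and `A = ∫ ρ^β w |∇φ|²`, `B = ∫ ρ^{β-2} b² w φ²`, `R = ∫
ρ^{β+2} (div (w ∇φ))² / (b² w)`, `T = ∫ ρ^{β-1} w ⟨∇ρ, ∇φ²⟩`.

Integrating `div (w ∇φ²) = 2 φ div (w ∇φ) + 2 w |∇φ|²` against `ρ^β` and using Young's inequality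
with a parameter `s > 0` gives `A ≤ -β T / 2 + R / (4 s) + s B` (`integral_normSq_grad_le`, with the
chain rule for `ρ^β`). The bound on `Δ^D ρ`, tested with `ρ^{β-1} φ²`, compares `-T` with `(C + β -
1) B` (`HasWeakGradientOn.comparison`).

In case (i), `β > 0` and `C + β - 1 < 0`, so the `T` term is at most a negative multiple of `B`.
Choosing `s` so that the two multiples of `B` cancel leaves `A ≤ R / (4 s)`.

In case (ii), `β < 0`. With `h = (C + β - 1) / 2 > 0`, the comparison `T ≤ -2 h B` also yields a
Hardy inequality `h² B ≤ A`. A multiple of `B` now remains on the right; it is absorbed into `A` by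
Hardy's inequality, which needs `h + β ≥ 0`, and this follows from the lower bound on `α`. The best
`s` then gives `(h - β)² A ≤ R`.

The analytic difficulty is that `ρ` is merely continuous with a weak gradient, so neither the chain
rule for `ρ^s` nor the test function `ρ^{β-1} φ²` is available directly. On a compact subset of a
chart domain, `ρ` is replaced by mollifications that are bounded, bounded away from zero, with
bounded derivatives converging almost everywhere (`HasWeakGradientOn.exists_approximation`);
dominated convergence passes to the limit. A partition of unity
(`IsTestFunction.induction_on_charts`) removes the restriction to a chart.

Before this, divergence and volume, which are defined chart by chart, must be shown to be computable
in any single chart: `divergence_eq_trace` rests on the Piola identity,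
`riemannianVolume_restrict_source` on the change of variables formula. -/

/-- The coordinate space `ℝⁿ`. -/
abbrev Coord (n : ℕ) := EuclideanSpace ℝ (Fin n)

/-! ### Tangent vectors, vector fields and differentials in the coordinates of a chart -/

section ChartCalculus

variable {n : ℕ} {M : Type*} [TopologicalSpace M]
  [ChartedSpace (EuclideanSpace ℝ (Fin n)) M] [IsManifold (𝓡 n) ∞ M]

/-- The components of a tangent vector in the coordinates of the chart at `x₀`. -/
def toCoord (x₀ x : M) : TangentSpace (𝓡 n) x →L[ℝ] Coord n :=
  (trivializationAt (Coord n) (TangentSpace (𝓡 n)) x₀).continuousLinearMapAt ℝ x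

/-- The tangent vector with given components in the coordinates of the chart at `x₀`. -/
def frame (x₀ x : M) : Coord n →L[ℝ] TangentSpace (𝓡 n) x :=
  (trivializationAt (Coord n) (TangentSpace (𝓡 n)) x₀).symmL ℝ x

theorem frame_toCoord {x₀ x : M} (hx : x ∈ (chartAt (Coord n) x₀).source)
    (v : TangentSpace (𝓡 n) x) : frame x₀ x (toCoord x₀ x v) = v :=
  Bundle.Trivialization.symmL_continuousLinearMapAt _ (by simpa using hx) v

theorem toCoord_frame {x₀ x : M} (hx : x ∈ (chartAt (Coord n) x₀).source)
    (v : Coord n) : toCoord x₀ x (frame x₀ x v) = v :=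
  Bundle.Trivialization.continuousLinearMapAt_symmL _ (by simpa using hx) v

theorem toCoord_eq_mfderiv {x₀ x : M} (hx : x ∈ (chartAt (Coord n) x₀).source)
    (v : TangentSpace (𝓡 n) x) :
    toCoord x₀ x v = ofTangent _ (mfderiv (𝓡 n) (𝓡 n) (chartAt (Coord n) x₀) x v) := by
  unfold toCoord
  rw [TangentBundle.continuousLinearMapAt_trivializationAt hx]
  rfl

theorem frame_eq_mfderiv {x₀ x : M} (hx : x ∈ (chartAt (Coord n) x₀).source) (v : Coord n) :
    frame x₀ x v = (mfderiv (𝓡 n) (𝓡 n) (chartAt (Coord n) x₀).symm (chartAt (Coord n) x₀ x)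
      (toTangent _ v) : Coord n) := by
  unfold frame
  rw [TangentBundle.symmL_trivializationAt hx]
  simp only [modelWithCornersSelf_coe, range_id, mfderivWithin_univ]
  rfl

theorem coordVector_eq_frame {x₀ : M} {z : Coord n} (hz : z ∈ (chartAt (Coord n) x₀).target)
    (i : Fin n) :
    coordVector x₀ i z =
      frame x₀ ((chartAt (Coord n) x₀).symm z) (EuclideanSpace.single i (1 : ℝ)) := by
  have hx := (chartAt (Coord n) x₀).map_target hz
  have h := frame_eq_mfderiv hx (EuclideanSpace.single i (1 : ℝ))
  rw [h, (chartAt (Coord n) x₀).right_inv hz]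
  rfl

theorem gram_apply (g : SmoothMetric n M) {x₀ : M} {z : Coord n}
    (hz : z ∈ (chartAt (Coord n) x₀).target) (i j : Fin n) :
    gram g x₀ z i j = g.inner ((chartAt (Coord n) x₀).symm z)
      (frame x₀ _ (EuclideanSpace.single i (1 : ℝ)))
      (frame x₀ _ (EuclideanSpace.single j (1 : ℝ))) := by
  rw [gram, coordVector_eq_frame hz, coordVector_eq_frame hz]

theorem gram_chart_apply (g : SmoothMetric n M) {x₀ x : M}
    (hx : x ∈ (chartAt (Coord n) x₀).source) (i j : Fin n) :
    gram g x₀ (chartAt (Coord n) x₀ x) i j = g.inner x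
      (frame x₀ x (EuclideanSpace.single i (1 : ℝ)))
      (frame x₀ x (EuclideanSpace.single j (1 : ℝ))) := by
  rw [gram_apply g ((chartAt (Coord n) x₀).map_source hx), (chartAt (Coord n) x₀).left_inv hx]

theorem fieldCoord_eq_toCoord (X : (x : M) → TangentSpace (𝓡 n) x) {x₀ : M} {z : Coord n}
    (hz : z ∈ (chartAt (Coord n) x₀).target) (i : Fin n) :
    fieldCoord X x₀ i z = toCoord x₀ ((chartAt (Coord n) x₀).symm z)
      (X ((chartAt (Coord n) x₀).symm z)) i := by
  rw [toCoord_eq_mfderiv ((chartAt (Coord n) x₀).map_target hz)]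
  rfl

/-- Smoothness of a vector field, in the coordinates of a chart. -/
theorem contMDiffOn_field_iff {X : (x : M) → TangentSpace (𝓡 n) x} {x₀ : M} {s : Set M}
    (hs : IsOpen s) (hs' : s ⊆ (chartAt (Coord n) x₀).source) :
    ContMDiffOn (𝓡 n) (𝓡 n).tangent ∞ (fun x => (⟨x, X x⟩ : TangentBundle (𝓡 n) M)) s ↔
      ContMDiffOn (𝓡 n) 𝓘(ℝ, Coord n) ∞ (fun x => toCoord x₀ x (X x)) s := by
  refine ((trivializationAt (Coord n) (TangentSpace (𝓡 n)) x₀).contMDiffOn_section_iff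
    (s := X) (IB := 𝓡 n) (n := ∞) hs (by simpa using hs')).trans ?_
  refine contMDiffOn_congr fun x hx => ?_
  have hb : x ∈ (trivializationAt (Coord n) (TangentSpace (𝓡 n)) x₀).baseSet := by
    simpa using hs' hx
  exact (Bundle.Trivialization.continuousLinearMapAt_apply_of_mem ℝ _ hb (X x)).symm

theorem contMDiffOn_frame (x₀ : M) (v : Coord n) :
    ContMDiffOn (𝓡 n) (𝓡 n).tangent ∞
      (fun x => (⟨x, frame x₀ x v⟩ : TangentBundle (𝓡 n) M)) (chartAt (Coord n) x₀).source := by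
  refine (contMDiffOn_field_iff (X := fun x => frame x₀ x v) (chartAt (Coord n) x₀).open_source subset_rfl).2 ?_
  exact contMDiffOn_const.congr fun x hx => toCoord_frame hx v

theorem contMDiffOn_inner (g : SmoothMetric n M) {X Y : (x : M) → TangentSpace (𝓡 n) x}
    {s : Set M}
    (hX : ContMDiffOn (𝓡 n) (𝓡 n).tangent ∞ (fun x => (⟨x, X x⟩ : TangentBundle (𝓡 n) M)) s)
    (hY : ContMDiffOn (𝓡 n) (𝓡 n).tangent ∞ (fun x => (⟨x, Y x⟩ : TangentBundle (𝓡 n) M)) s) :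
    ContMDiffOn (𝓡 n) 𝓘(ℝ, ℝ) ∞ (fun x => g.inner x (X x) (Y x)) s := by
  have h : ContMDiffOn (𝓡 n) ((𝓡 n).prod 𝓘(ℝ, ℝ)) ∞
      (fun b ↦ Bundle.TotalSpace.mk' ℝ (E := Bundle.Trivial M ℝ) b (g.inner b (X b) (Y b))) s :=
    ContMDiffOn.clm_bundle_apply₂ (F₁ := Coord n) (F₂ := Coord n) (b := fun x => x)
      (E₁ := fun x : M => TangentSpace (𝓡 n) x) (E₂ := fun x : M => TangentSpace (𝓡 n) x)
      g.contMDiff.contMDiffOn hX hY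
  intro x hx
  have := h x hx
  simp only [Bundle.contMDiffWithinAt_totalSpace] at this
  exact this.2

/-- The derivative of a function, in the coordinates of a chart. -/
theorem mfderiv_eq_fderiv_chart {F : Type*} [NormedAddCommGroup F] [NormedSpace ℝ F]
    {f : M → F} {x₀ x : M} (hx : x ∈ (chartAt (Coord n) x₀).source)
    (hf : MDifferentiableAt (𝓡 n) 𝓘(ℝ, F) f x) (v : TangentSpace (𝓡 n) x) :
    (mfderiv (𝓡 n) 𝓘(ℝ, F) f x v : F) =
      fderiv ℝ (f ∘ (chartAt (Coord n) x₀).symm) (chartAt (Coord n) x₀ x) (toCoord x₀ x v) := by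
  have hz := (chartAt (Coord n) x₀).map_source hx
  have hl := (chartAt (Coord n) x₀).left_inv hx
  have h2 := (mdifferentiable_chart (I := 𝓡 n) x₀).mdifferentiableAt_symm hz
  have hf' : MDifferentiableAt (𝓡 n) 𝓘(ℝ, F) f
      ((chartAt (Coord n) x₀).symm (chartAt (Coord n) x₀ x)) := by rwa [hl]
  have h1 := mfderiv_comp (chartAt (Coord n) x₀ x) hf' h2
  rw [mfderiv_eq_fderiv] at h1
  have h3 : (fderiv ℝ (f ∘ (chartAt (Coord n) x₀).symm) (chartAt (Coord n) x₀ x) :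
      Coord n → F) (toCoord x₀ x v) = 
      (mfderiv (𝓡 n) 𝓘(ℝ, F) f ((chartAt (Coord n) x₀).symm (chartAt (Coord n) x₀ x)) :
        Coord n → F) (mfderiv (𝓡 n) (𝓡 n) (chartAt (Coord n) x₀).symm
          (chartAt (Coord n) x₀ x) (toTangent _ (toCoord x₀ x v)) : Coord n) := by
    rw [h1]; rfl
  rw [h3, ← frame_eq_mfderiv hx, frame_toCoord hx, hl]

end ChartCalculus

/-! ### The matrix of the metric, its determinant, and changes of coordinates -/

section GramMatrix

theorem contDiffOn_det {E : Type*} [NormedAddCommGroup E] [NormedSpace ℝ E] {n : ℕ}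
    {A : E → Matrix (Fin n) (Fin n) ℝ} {s : Set E} {m : WithTop ℕ∞}
    (hA : ∀ i j, ContDiffOn ℝ m (fun z => A z i j) s) :
    ContDiffOn ℝ m (fun z => (A z).det) s := by
  simp only [Matrix.det_apply']
  exact ContDiffOn.sum fun σ _ => contDiffOn_const.mul (contDiffOn_prod fun i _ => hA _ _)

/-- Cramer's rule: the entries of the inverse are cofactors divided by the determinant. -/
theorem contDiffOn_matrix_inv {E : Type*} [NormedAddCommGroup E] [NormedSpace ℝ E] {n : ℕ}
    {A : E → Matrix (Fin n) (Fin n) ℝ} {s : Set E} {m : WithTop ℕ∞}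
    (hA : ∀ i j, ContDiffOn ℝ m (fun z => A z i j) s) (h0 : ∀ z ∈ s, (A z).det ≠ 0)
    (i j : Fin n) : ContDiffOn ℝ m (fun z => (A z)⁻¹ i j) s := by
  simp only [Matrix.inv_def, Matrix.smul_apply, Ring.inverse_eq_inv', smul_eq_mul,
    Matrix.adjugate_apply]
  refine ((contDiffOn_det hA).inv h0).mul (contDiffOn_det fun k l => ?_)
  simp only [Matrix.updateRow_apply]
  split_ifs
  · exact contDiffOn_const
  · exact hA _ _

variable {n : ℕ} {M : Type*} [TopologicalSpace M]
  [ChartedSpace (EuclideanSpace ℝ (Fin n)) M] [IsManifold (𝓡 n) ∞ M]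

theorem coord_eq_sum_single (v : Coord n) : v = ∑ i, v i • EuclideanSpace.single i (1 : ℝ) := by
  conv_lhs => rw [← (EuclideanSpace.basisFun (Fin n) ℝ).sum_repr v]
  simp

theorem contDiffOn_gram (g : SmoothMetric n M) (x₀ : M) (i j : Fin n) :
    ContDiffOn ℝ ∞ (fun z => gram g x₀ z i j) (chartAt (Coord n) x₀).target := by
  rw [← contMDiffOn_iff_contDiffOn]
  have h := (contMDiffOn_inner g
    (contMDiffOn_frame x₀ (EuclideanSpace.single i (1 : ℝ)))
    (contMDiffOn_frame x₀ (EuclideanSpace.single j (1 : ℝ)))).comp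
    (contMDiffOn_chart_symm (I := 𝓡 n) (n := ∞) (x := x₀))
    (fun z hz => (chartAt (Coord n) x₀).map_target hz)
  exact h.congr fun z hz => gram_apply g hz i j

/-- The metric in the coordinates of a chart. -/
theorem inner_eq_gram (g : SmoothMetric n M) {x₀ x : M} (hx : x ∈ (chartAt (Coord n) x₀).source)
    (v w : TangentSpace (𝓡 n) x) :
    g.inner x v w =
      ∑ i, ∑ j, gram g x₀ (chartAt (Coord n) x₀ x) i j * toCoord x₀ x v i * toCoord x₀ x w j := by
  conv_lhs => rw [← frame_toCoord hx v, ← frame_toCoord hx w,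
    coord_eq_sum_single (toCoord x₀ x v), coord_eq_sum_single (toCoord x₀ x w)]
  simp only [map_sum, map_smul, _root_.sum_apply, _root_.smul_apply,
    smul_eq_mul, gram_chart_apply g hx]
  rw [Finset.sum_comm]
  refine Finset.sum_congr rfl fun i _ => ?_
  simp only [Finset.mul_sum]
  refine Finset.sum_congr rfl fun j _ => ?_
  ring

theorem inner_eq_dotProduct (g : SmoothMetric n M) {x₀ x : M}
    (hx : x ∈ (chartAt (Coord n) x₀).source) (v w : TangentSpace (𝓡 n) x) :
    g.inner x v w = (toCoord x₀ x v).ofLp ⬝ᵥ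
      (gram g x₀ (chartAt (Coord n) x₀ x)).mulVec (toCoord x₀ x w).ofLp := by
  rw [inner_eq_gram g hx]
  simp only [dotProduct, Matrix.mulVec, Finset.mul_sum]
  exact Finset.sum_congr rfl fun i _ => Finset.sum_congr rfl fun j _ => by ring

theorem gram_posDef (g : SmoothMetric n M) {x₀ : M} {z : Coord n}
    (hz : z ∈ (chartAt (Coord n) x₀).target) : (gram g x₀ z).PosDef := by
  have hx := (chartAt (Coord n) x₀).map_target hz
  have hr := (chartAt (Coord n) x₀).right_inv hz
  refine Matrix.PosDef.of_dotProduct_mulVec_pos ?_ fun v hv => ?_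
  · ext i j
    simp [gram_apply g hz, g.symm]
  · have h := inner_eq_dotProduct g hx (frame x₀ _ (WithLp.toLp 2 v))
      (frame x₀ _ (WithLp.toLp 2 v))
    rw [toCoord_frame hx, hr] at h
    simp only [star_trivial]
    rw [← h]
    refine g.pos _ _ fun h0 => hv ?_
    have := toCoord_frame hx (WithLp.toLp 2 v)
    rw [h0, map_zero] at this
    simpa using congrArg WithLp.ofLp this.symm

theorem gram_det_pos (g : SmoothMetric n M) {x₀ : M} {z : Coord n}
    (hz : z ∈ (chartAt (Coord n) x₀).target) : 0 < (gram g x₀ z).det :=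
  (gram_posDef g hz).det_pos

theorem volDensity_pos (g : SmoothMetric n M) {x₀ : M} {z : Coord n}
    (hz : z ∈ (chartAt (Coord n) x₀).target) : 0 < volDensity g x₀ z :=
  Real.sqrt_pos.2 (gram_det_pos g hz)

theorem contDiffOn_volDensity (g : SmoothMetric n M) (x₀ : M) :
    ContDiffOn ℝ ∞ (volDensity g x₀) (chartAt (Coord n) x₀).target :=
  (contDiffOn_det (contDiffOn_gram g x₀)).sqrt fun _ hz => (gram_det_pos g hz).ne'

/-- The change of coordinates from the chart at `x₀` to the chart at `x₁`. -/
def chartChange (x₀ x₁ : M) : OpenPartialHomeomorph (Coord n) (Coord n) :=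
  (chartAt (Coord n) x₀).symm.trans (chartAt (Coord n) x₁)

omit [IsManifold (𝓡 n) ∞ M] in
theorem mem_chartChange_source {x₀ x₁ : M} {z : Coord n} :
    z ∈ (chartChange x₀ x₁).source ↔ z ∈ (chartAt (Coord n) x₀).target ∧
      (chartAt (Coord n) x₀).symm z ∈ (chartAt (Coord n) x₁).source := by
  simp [chartChange]

theorem contDiffOn_chartChange (x₀ x₁ : M) :
    ContDiffOn ℝ ∞ (chartChange x₀ x₁ : Coord n → Coord n) (chartChange x₀ x₁).source := by
  rw [← contMDiffOn_iff_contDiffOn]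
  exact (contMDiffOn_chart (I := 𝓡 n) (n := ∞) (x := x₁)).comp
    ((contMDiffOn_chart_symm (I := 𝓡 n) (n := ∞) (x := x₀)).mono
      fun z hz => (mem_chartChange_source.1 hz).1)
    fun z hz => (mem_chartChange_source.1 hz).2

theorem toCoord_chartChange {x₀ x₁ x : M} (hx : x ∈ (chartAt (Coord n) x₀).source)
    (hx' : x ∈ (chartAt (Coord n) x₁).source) (v : TangentSpace (𝓡 n) x) :
    toCoord x₁ x v =
      fderiv ℝ (chartChange x₀ x₁) (chartAt (Coord n) x₀ x) (toCoord x₀ x v) := by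
  rw [toCoord_eq_mfderiv hx']
  exact mfderiv_eq_fderiv_chart (f := chartAt (Coord n) x₁) hx
    ((mdifferentiable_chart (I := 𝓡 n) x₁).mdifferentiableAt hx') v

/-- The derivative converts the components of a tangent vector in one chart into those in the other.
Both sets of components determine the vector, so the derivative is injective, hence invertible. -/
theorem fderiv_chartChange_det_ne_zero {x₀ x₁ : M} {z : Coord n}
    (hz : z ∈ (chartChange x₀ x₁).source) : (fderiv ℝ (chartChange x₀ x₁) z).det ≠ 0 := by
  obtain ⟨h0, h1⟩ := mem_chartChange_source.1 hz
  have hx := (chartAt (Coord n) x₀).map_target h0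
  have hr := (chartAt (Coord n) x₀).right_inv h0
  have hinj : Function.Injective (fderiv ℝ (chartChange x₀ x₁) z) := by
    rw [injective_iff_map_eq_zero]
    intro v hv
    have h := toCoord_chartChange hx h1 (frame x₀ _ v)
    rw [toCoord_frame hx, hr, hv] at h
    rw [← toCoord_frame hx v, ← frame_toCoord h1 (frame x₀ _ v), h, map_zero, map_zero]
  exact (LinearEquiv.isUnit_det' (LinearEquiv.ofInjectiveEndo _ hinj)).ne_zero

/-- The transformation of the matrix of the metric under a change of coordinates. -/
theorem gram_chartChange (g : SmoothMetric n M) {x₀ x₁ : M} {z : Coord n}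
    (hz : z ∈ (chartChange x₀ x₁).source) :
    gram g x₀ z = (LinearMap.toMatrix (EuclideanSpace.basisFun (Fin n) ℝ).toBasis
        (EuclideanSpace.basisFun (Fin n) ℝ).toBasis
        (fderiv ℝ (chartChange x₀ x₁) z : Coord n →ₗ[ℝ] Coord n)).transpose *
      gram g x₁ (chartChange x₀ x₁ z) *
      LinearMap.toMatrix (EuclideanSpace.basisFun (Fin n) ℝ).toBasis
        (EuclideanSpace.basisFun (Fin n) ℝ).toBasis
        (fderiv ℝ (chartChange x₀ x₁) z : Coord n →ₗ[ℝ] Coord n) := by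
  obtain ⟨h0, h1⟩ := mem_chartChange_source.1 hz
  have hx := (chartAt (Coord n) x₀).map_target h0
  have hr := (chartAt (Coord n) x₀).right_inv h0
  ext i j
  rw [gram_apply g h0, inner_eq_gram g h1, toCoord_chartChange hx h1, toCoord_chartChange hx h1,
    toCoord_frame hx, toCoord_frame hx, hr]
  simp only [Matrix.mul_apply, Matrix.transpose_apply, LinearMap.toMatrix_apply, Finset.sum_mul]
  rw [Finset.sum_comm]
  refine Finset.sum_congr rfl fun k _ => Finset.sum_congr rfl fun l _ => ?_
  simp [chartChange]
  exact Or.inl (by ring)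

/-- Take determinants in `G₀ = Jᵀ G₁ J`; the square root of `(det J)²` is the absolute Jacobian of
the change of variables formula. -/
theorem volDensity_chartChange (g : SmoothMetric n M) {x₀ x₁ : M} {z : Coord n}
    (hz : z ∈ (chartChange x₀ x₁).source) :
    volDensity g x₀ z =
      |(fderiv ℝ (chartChange x₀ x₁) z).det| * volDensity g x₁ (chartChange x₀ x₁ z) := by
  rw [volDensity, gram_chartChange g hz, Matrix.det_mul, Matrix.det_mul, Matrix.det_transpose,
    LinearMap.det_toMatrix, mul_right_comm, Real.sqrt_mul (mul_self_nonneg _),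
    Real.sqrt_mul_self_eq_abs]
  rfl

end GramMatrix

/-! ### Derivative of the determinant and the Piola identity -/

section Piola

open Filter Topology

variable {n : ℕ}

theorem differentiable_continuousLinearMap_det :
    Differentiable ℝ (fun A : Coord n →L[ℝ] Coord n => A.det) := by
  have h : ∀ A : Coord n →L[ℝ] Coord n, A.det =
      (LinearMap.toMatrix (EuclideanSpace.basisFun (Fin n) ℝ).toBasis
        (EuclideanSpace.basisFun (Fin n) ℝ).toBasis (A : Coord n →ₗ[ℝ] Coord n)).det :=
    fun A => (LinearMap.det_toMatrix _ _).symm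
  simp_rw [h]
  refine fun A => ((contDiffOn_det (m := 1) (s := univ) fun i j => ?_).contDiffAt
    univ_mem).differentiableAt one_ne_zero
  simp only [LinearMap.toMatrix_apply]
  refine ContDiff.contDiffOn ?_
  simp only [OrthonormalBasis.coe_toBasis, EuclideanSpace.basisFun_apply,
    OrthonormalBasis.coe_toBasis_repr_apply, EuclideanSpace.basisFun_repr,
    ContinuousLinearMap.coe_coe]
  fun_prop

/-- **Jacobi's formula** for the derivative of the determinant at an invertible map. -/
theorem fderiv_det_apply (A B H : Coord n →L[ℝ] Coord n) (hAB : A ∘L B = .id ℝ _) :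
    fderiv ℝ (fun A : Coord n →L[ℝ] Coord n => A.det) A H =
      A.det * LinearMap.trace ℝ (Coord n) (B ∘L H : Coord n →L[ℝ] Coord n) := by
  have h1 : HasDerivAt (fun r : ℝ => (A + r • H).det)
      (fderiv ℝ (fun A : Coord n →L[ℝ] Coord n => A.det) A H) 0 := by
    have h2 : HasDerivAt (fun r : ℝ => A + r • H) H 0 := by
      simpa using ((hasDerivAt_id (0 : ℝ)).smul_const H).const_add A
    have h3 : HasFDerivAt (fun A : Coord n →L[ℝ] Coord n => A.det)
        (fderiv ℝ (fun A : Coord n →L[ℝ] Coord n => A.det) A) ((fun r : ℝ => A + r • H) 0) := by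
      have h0 : (fun r : ℝ => A + r • H) 0 = A := by
        ext v : 1
        simp
      rw [h0]
      exact (differentiable_continuousLinearMap_det A).hasFDerivAt
    exact h3.comp_hasDerivAt 0 h2
  set b := (EuclideanSpace.basisFun (Fin n) ℝ).toBasis
  set N := LinearMap.toMatrix b b ((B ∘L H : Coord n →L[ℝ] Coord n) : Coord n →ₗ[ℝ] Coord n)
    with hN
  obtain ⟨p, hp⟩ : ∃ p : Polynomial ℝ, ∀ r : ℝ, (1 + r • N).det = 1 + N.trace * r + p.eval r * r ^ 2 :=
    ⟨_, fun r => Matrix.det_one_add_smul r N⟩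
  have h4 : ∀ r : ℝ, (A + r • H).det = A.det * (1 + N.trace * r + p.eval r * r ^ 2) := by
    intro r
    -- Factoring out `A` reduces the derivative to that of `det (1 + r N)` at `r = 0`, which is `tr
    -- N`.
    have h5 : A + r • H = A ∘L (.id ℝ _ + r • (B ∘L H)) := by
      ext v : 1
      have := DFunLike.congr_fun hAB (H v)
      simp only [ContinuousLinearMap.comp_apply, ContinuousLinearMap.id_apply] at this
      simp [this]
    rw [h5, ← hp, ContinuousLinearMap.det, ContinuousLinearMap.det, ContinuousLinearMap.toLinearMap_comp,
      LinearMap.det_comp, ← LinearMap.det_toMatrix b (_ + _ : Coord n →L[ℝ] Coord n).toLinearMap]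
    congr 2
    simp [hN]
  simp_rw [h4] at h1
  have h6 : HasDerivAt (fun r : ℝ => A.det * (1 + N.trace * r + p.eval r * r ^ 2))
      (A.det * N.trace) 0 := by
    have := ((((hasDerivAt_id (0 : ℝ)).const_mul N.trace).const_add 1).add
      ((p.hasDerivAt 0).mul (hasDerivAt_pow 2 (0 : ℝ)))).const_mul A.det
    simpa using this
  rw [h1.unique h6, LinearMap.trace_eq_matrix_trace ℝ b]

theorem trace_smulRight (θ : Coord n →L[ℝ] ℝ) (w : Coord n) :
    LinearMap.trace ℝ (Coord n) (θ.smulRight w : Coord n →L[ℝ] Coord n) = θ w := by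
  exact LinearMap.trace_smulRight θ.toLinearMap w

/-- The divergence of the Piola transform of a vector field. -/
theorem trace_fderiv_piola {Φ F₀ F₁ : Coord n → Coord n} {z : Coord n}
    (hΦ : ContDiffAt ℝ 2 Φ z) (hdet : (fderiv ℝ Φ z).det ≠ 0)
    (hF₀ : DifferentiableAt ℝ F₀ z) (hF₁ : DifferentiableAt ℝ F₁ (Φ z))
    (h : ∀ᶠ y in 𝓝 z, (fderiv ℝ Φ y).det • F₁ (Φ y) = fderiv ℝ Φ y (F₀ y)) :
    LinearMap.trace ℝ (Coord n) (fderiv ℝ F₀ z) =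
      (fderiv ℝ Φ z).det * LinearMap.trace ℝ (Coord n) (fderiv ℝ F₁ (Φ z)) := by
  set A := fderiv ℝ Φ z with hA
  obtain ⟨B, hAB, hBA⟩ : ∃ B : Coord n →L[ℝ] Coord n, A ∘L B = .id ℝ _ ∧ B ∘L A = .id ℝ _ := by
    refine ⟨(A.toContinuousLinearEquivOfDetNeZero hdet).symm, ?_, ?_⟩
    · ext v : 1
      exact (A.toContinuousLinearEquivOfDetNeZero hdet).apply_symm_apply v
    · ext v : 1
      exact (A.toContinuousLinearEquivOfDetNeZero hdet).symm_apply_apply v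
  have hBA' : ∀ v, B (A v) = v := fun v => DFunLike.congr_fun hBA v
  have hdiff : DifferentiableAt ℝ Φ z := hΦ.differentiableAt two_ne_zero
  have hD : DifferentiableAt ℝ (fderiv ℝ Φ) z :=
    (hΦ.fderiv_right (m := 1) (by norm_num)).differentiableAt one_ne_zero
  have hsymm : IsSymmSndFDerivAt ℝ Φ z := hΦ.isSymmSndFDerivAt (by simp)
  set D := fderiv ℝ (fderiv ℝ Φ) z with hDdef
  have hdet' : HasFDerivAt (fun y => (fderiv ℝ Φ y).det)
      ((fderiv ℝ (fun A : Coord n →L[ℝ] Coord n => A.det) A) ∘L D) z :=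
    (differentiable_continuousLinearMap_det A).hasFDerivAt.comp z hD.hasFDerivAt
  have hL := hdet'.smul (hF₁.hasFDerivAt.comp z hdiff.hasFDerivAt)
  have hR := hD.hasFDerivAt.clm_apply hF₀.hasFDerivAt
  have heq := (hL.congr_of_eventuallyEq (EventuallyEq.symm h)).unique hR
  have hz := h.self_of_nhds
  have hF₀z : A.det • B (F₁ (Φ z)) = F₀ z := by
    rw [← map_smul, hz, hBA']
  -- The relation `h` is differentiated by the product rule and multiplied by `B = A⁻¹`. The
  -- symmetry of the second derivative replaces `D v (F₀ z)` by `D (F₀ z) v`, so that this term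
  -- becomes an operator whose trace can be taken.
  have key : fderiv ℝ F₀ z =
      ((fderiv ℝ (fun A : Coord n →L[ℝ] Coord n => A.det) A) ∘L D).smulRight (B (F₁ (Φ z)))
        + A.det • (B ∘L (fderiv ℝ F₁ (Φ z)) ∘L A) - B ∘L (D (F₀ z)) := by
    ext v : 1
    have h1 := congrArg B (DFunLike.congr_fun heq v)
    have h2 : D v (F₀ z) = D (F₀ z) v := hsymm v (F₀ z)
    simp only [_root_.add_apply, _root_.smul_apply,
      ContinuousLinearMap.comp_apply, ContinuousLinearMap.smulRight_apply,
      ContinuousLinearMap.flip_apply, map_add, map_smul, Function.comp_apply,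
      ← hA, ← hDdef, hBA', h2] at h1
    simp only [_root_.sub_apply, _root_.add_apply,
      _root_.smul_apply,
      ContinuousLinearMap.comp_apply, ContinuousLinearMap.smulRight_apply]
    rw [eq_sub_iff_add_eq, ← h1]
    abel
  rw [key]
  have ht : LinearMap.trace ℝ (Coord n) (B ∘L (fderiv ℝ F₁ (Φ z)) ∘L A : Coord n →L[ℝ] Coord n) =
      LinearMap.trace ℝ (Coord n) (fderiv ℝ F₁ (Φ z)) := by
    rw [ContinuousLinearMap.toLinearMap_comp, LinearMap.trace_comp_comm']
    congr 1
    ext v : 1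
    have := DFunLike.congr_fun hAB v
    simp only [ContinuousLinearMap.comp_apply, ContinuousLinearMap.id_apply] at this
    simp [this]
  rw [ContinuousLinearMap.toLinearMap_sub, ContinuousLinearMap.toLinearMap_add, ContinuousLinearMap.toLinearMap_smul,
    map_sub, map_add, map_smul, ht, trace_smulRight, ContinuousLinearMap.comp_apply,
    fderiv_det_apply A B _ hAB]
  -- By Jacobi's formula the trace of the rank-one term is the left-hand side; since `det A • B F₁ =
  -- F₀`, it cancels the second-derivative term.
  have h3 : A.det * LinearMap.trace ℝ (Coord n)
      (B ∘L D (B (F₁ (Φ z))) : Coord n →L[ℝ] Coord n) =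
      LinearMap.trace ℝ (Coord n) (B ∘L D (F₀ z) : Coord n →L[ℝ] Coord n) := by
    rw [← hF₀z, map_smul, ContinuousLinearMap.comp_smul, ContinuousLinearMap.toLinearMap_smul, map_smul,
      smul_eq_mul]
  rw [h3, smul_eq_mul]
  ring

/-- The Jacobian does not change sign near `z`; where it is negative, the sign is moved into `F₁`.
No orientation is therefore needed. -/
theorem trace_fderiv_piola_abs {Φ F₀ F₁ : Coord n → Coord n} {z : Coord n}
    (hΦ : ContDiffAt ℝ 2 Φ z) (hdet : (fderiv ℝ Φ z).det ≠ 0)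
    (hF₀ : DifferentiableAt ℝ F₀ z) (hF₁ : DifferentiableAt ℝ F₁ (Φ z))
    (h : ∀ᶠ y in 𝓝 z, |(fderiv ℝ Φ y).det| • F₁ (Φ y) = fderiv ℝ Φ y (F₀ y)) :
    LinearMap.trace ℝ (Coord n) (fderiv ℝ F₀ z) =
      |(fderiv ℝ Φ z).det| * LinearMap.trace ℝ (Coord n) (fderiv ℝ F₁ (Φ z)) := by
  have hcont : ContinuousAt (fun y => (fderiv ℝ Φ y).det) z :=
    (differentiable_continuousLinearMap_det _).continuousAt.comp
      (hΦ.fderiv_right (m := 1) (by norm_num)).continuousAt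
  rcases hdet.lt_or_gt with h0 | h0
  · have h1 : ∀ᶠ y in 𝓝 z, (fderiv ℝ Φ y).det • (-F₁) (Φ y) = fderiv ℝ Φ y (F₀ y) := by
      filter_upwards [h, hcont.eventually_lt_const h0] with y hy hy0
      rw [← hy, abs_of_neg hy0]
      simp
    rw [trace_fderiv_piola hΦ hdet hF₀ hF₁.neg h1, abs_of_neg h0, fderiv_neg]
    simp
  · have h1 : ∀ᶠ y in 𝓝 z, (fderiv ℝ Φ y).det • F₁ (Φ y) = fderiv ℝ Φ y (F₀ y) := by
      filter_upwards [h, hcont.eventually_const_lt h0] with y hy hy0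
      rw [← hy, abs_of_pos hy0]
    rw [trace_fderiv_piola hΦ hdet hF₀ hF₁ h1, abs_of_pos h0]

end Piola

/-! ### Smooth vector fields and the chart independence of the divergence -/

section Divergence

open Filter Topology

variable {n : ℕ} {M : Type*} [TopologicalSpace M]
  [ChartedSpace (EuclideanSpace ℝ (Fin n)) M] [IsManifold (𝓡 n) ∞ M]

/-- A vector field that is smooth at the point `x`. -/
def SmoothFieldAt (X : (x : M) → TangentSpace (𝓡 n) x) (x : M) : Prop :=
  ContMDiffAt (𝓡 n) (𝓡 n).tangent ∞ (fun x => (⟨x, X x⟩ : TangentBundle (𝓡 n) M)) x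

theorem IsSmoothVectorField.smoothFieldAt {X : (x : M) → TangentSpace (𝓡 n) x}
    (hX : IsSmoothVectorField X) (x : M) : SmoothFieldAt X x :=
  hX x

theorem isSmoothVectorField_of_smoothFieldAt {X : (x : M) → TangentSpace (𝓡 n) x}
    (hX : ∀ x, SmoothFieldAt X x) : IsSmoothVectorField X :=
  hX

theorem smoothFieldAt_iff_toCoord {X : (x : M) → TangentSpace (𝓡 n) x} {x₀ x : M}
    (hx : x ∈ (chartAt (Coord n) x₀).source) :
    SmoothFieldAt X x ↔
      ContMDiffAt (𝓡 n) 𝓘(ℝ, Coord n) ∞ (fun y => toCoord x₀ y (X y)) x := by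
  refine ((trivializationAt (Coord n) (TangentSpace (𝓡 n)) x₀).contMDiffAt_section_iff
    (s := X) (IB := 𝓡 n) (n := ∞) (by simpa using hx)).trans ?_
  refine EventuallyEq.contMDiffAt_iff ?_
  filter_upwards [(chartAt (Coord n) x₀).open_source.mem_nhds hx] with y hy
  have hb : y ∈ (trivializationAt (Coord n) (TangentSpace (𝓡 n)) x₀).baseSet := by
    simpa using hy
  exact (Bundle.Trivialization.continuousLinearMapAt_apply_of_mem ℝ _ hb (X y)).symm

theorem SmoothFieldAt.congr {X Y : (x : M) → TangentSpace (𝓡 n) x} {x : M}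
    (hX : SmoothFieldAt X x) (h : ∀ᶠ y in 𝓝 x, Y y = X y) : SmoothFieldAt Y x :=
  ContMDiffAt.congr_of_eventuallyEq hX (h.mono fun y hy => by simp only [hy])

theorem smoothFieldAt_zero (x : M) :
    SmoothFieldAt (fun x : M => (0 : TangentSpace (𝓡 n) x)) x := by
  rw [smoothFieldAt_iff_toCoord (mem_chart_source (Coord n) x)]
  simp only [map_zero]
  exact contMDiffAt_const

theorem SmoothFieldAt.smul {X : (x : M) → TangentSpace (𝓡 n) x} {f : M → ℝ} {x : M}
    (hf : ContMDiffAt (𝓡 n) 𝓘(ℝ, ℝ) ∞ f x) (hX : SmoothFieldAt X x) :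
    SmoothFieldAt (fun x => f x • X x) x := by
  rw [smoothFieldAt_iff_toCoord (mem_chart_source (Coord n) x)] at hX ⊢
  simp only [map_smul]
  exact hf.smul hX

theorem SmoothFieldAt.add {X Y : (x : M) → TangentSpace (𝓡 n) x} {x : M}
    (hX : SmoothFieldAt X x) (hY : SmoothFieldAt Y x) :
    SmoothFieldAt (fun x => X x + Y x) x := by
  rw [smoothFieldAt_iff_toCoord (mem_chart_source (Coord n) x)] at hX hY ⊢
  simp only [map_add]
  exact hX.add hY

theorem contDiffAt_comp_chart_symm {F : Type*} [NormedAddCommGroup F] [NormedSpace ℝ F]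
    {f : M → F} {x₀ x : M} (hx : x ∈ (chartAt (Coord n) x₀).source)
    (hf : ContMDiffAt (𝓡 n) 𝓘(ℝ, F) ∞ f x) :
    ContDiffAt ℝ ∞ (f ∘ (chartAt (Coord n) x₀).symm) (chartAt (Coord n) x₀ x) := by
  rw [← contMDiffAt_iff_contDiffAt]
  have hz := (chartAt (Coord n) x₀).map_source hx
  have h2 := (contMDiffOn_chart_symm (I := 𝓡 n) (n := ∞) (x := x₀)).contMDiffAt
    ((chartAt (Coord n) x₀).open_target.mem_nhds hz)
  refine ContMDiffAt.comp _ ?_ h2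
  rwa [(chartAt (Coord n) x₀).left_inv hx]

theorem contMDiffAt_comp_chart {F : Type*} [NormedAddCommGroup F] [NormedSpace ℝ F]
    {f : Coord n → F} {x₀ x : M} (hx : x ∈ (chartAt (Coord n) x₀).source)
    (hf : ContDiffAt ℝ ∞ f (chartAt (Coord n) x₀ x)) :
    ContMDiffAt (𝓡 n) 𝓘(ℝ, F) ∞ (fun y => f (chartAt (Coord n) x₀ y)) x := by
  rw [← contMDiffAt_iff_contDiffAt] at hf
  exact ContMDiffAt.comp x hf ((contMDiffOn_chart (I := 𝓡 n) (n := ∞) (x := x₀)).contMDiffAt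
    ((chartAt (Coord n) x₀).open_source.mem_nhds hx))

/-- The differential of a real-valued function. -/
def differential (f : M → ℝ) (x : M) : TangentSpace (𝓡 n) x →L[ℝ] ℝ :=
  mfderiv (𝓡 n) 𝓘(ℝ, ℝ) f x

theorem differential_eq_fderiv {f : M → ℝ} {x₀ x : M} (hx : x ∈ (chartAt (Coord n) x₀).source)
    (hf : MDifferentiableAt (𝓡 n) 𝓘(ℝ, ℝ) f x) (v : TangentSpace (𝓡 n) x) :
    differential f x v =
      fderiv ℝ (f ∘ (chartAt (Coord n) x₀).symm) (chartAt (Coord n) x₀ x) (toCoord x₀ x v) :=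
  mfderiv_eq_fderiv_chart hx hf v

/-- The components of a vector field in the coordinates of the chart at `x₀`. -/
def coordField (X : (x : M) → TangentSpace (𝓡 n) x) (x₀ : M) (z : Coord n) : Coord n :=
  toCoord x₀ ((chartAt (Coord n) x₀).symm z) (X ((chartAt (Coord n) x₀).symm z))

theorem coordField_chart (X : (x : M) → TangentSpace (𝓡 n) x) {x₀ x : M}
    (hx : x ∈ (chartAt (Coord n) x₀).source) :
    coordField X x₀ (chartAt (Coord n) x₀ x) = toCoord x₀ x (X x) := by
  rw [coordField, (chartAt (Coord n) x₀).left_inv hx]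

theorem contDiffAt_coordField {X : (x : M) → TangentSpace (𝓡 n) x} {x₀ x : M}
    (hx : x ∈ (chartAt (Coord n) x₀).source) (hX : SmoothFieldAt X x) :
    ContDiffAt ℝ ∞ (coordField X x₀) (chartAt (Coord n) x₀ x) :=
  contDiffAt_comp_chart_symm hx ((smoothFieldAt_iff_toCoord hx).1 hX)

/-- The vector field `√(det g) X` in the coordinates of the chart at `x₀`. -/
def flux (g : SmoothMetric n M) (X : (x : M) → TangentSpace (𝓡 n) x) (x₀ : M) (z : Coord n) :
    Coord n :=
  volDensity g x₀ z • coordField X x₀ z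

theorem contDiffAt_volDensity (g : SmoothMetric n M) {x₀ x : M}
    (hx : x ∈ (chartAt (Coord n) x₀).source) :
    ContDiffAt ℝ ∞ (volDensity g x₀) (chartAt (Coord n) x₀ x) :=
  (contDiffOn_volDensity g x₀).contDiffAt
    ((chartAt (Coord n) x₀).open_target.mem_nhds ((chartAt (Coord n) x₀).map_source hx))

theorem contDiffAt_flux (g : SmoothMetric n M) {X : (x : M) → TangentSpace (𝓡 n) x} {x₀ x : M}
    (hx : x ∈ (chartAt (Coord n) x₀).source) (hX : SmoothFieldAt X x) :
    ContDiffAt ℝ ∞ (flux g X x₀) (chartAt (Coord n) x₀ x) :=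
  (contDiffAt_volDensity g hx).smul (contDiffAt_coordField hx hX)

theorem sum_apply_single_eq_trace (A : Coord n →L[ℝ] Coord n) :
    ∑ i, A (EuclideanSpace.single i (1 : ℝ)) i = LinearMap.trace ℝ (Coord n) A := by
  rw [LinearMap.trace_eq_matrix_trace ℝ (EuclideanSpace.basisFun (Fin n) ℝ).toBasis]
  simp [Matrix.trace, LinearMap.toMatrix_apply]

theorem fderiv_coord {F : Coord n → Coord n} {z : Coord n} (hF : DifferentiableAt ℝ F z)
    (v : Coord n) (i : Fin n) : fderiv ℝ (fun y => F y i) z v = fderiv ℝ F z v i := by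
  have h := ((EuclideanSpace.proj i : Coord n →L[ℝ] ℝ).hasFDerivAt.comp z hF.hasFDerivAt).fderiv
  exact DFunLike.congr_fun h v

theorem divergence_eq_trace_self (g : SmoothMetric n M) {X : (x : M) → TangentSpace (𝓡 n) x}
    {x : M} (hX : SmoothFieldAt X x) :
    divergence g X x = (volDensity g x (chartAt (Coord n) x x))⁻¹ *
      LinearMap.trace ℝ (Coord n) (fderiv ℝ (flux g X x) (chartAt (Coord n) x x)) := by
  have hx := mem_chart_source (Coord n) x
  rw [divergence, ← sum_apply_single_eq_trace]
  congr 1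
  refine Finset.sum_congr rfl fun i _ => ?_
  rw [← fderiv_coord ((contDiffAt_flux g hx hX).differentiableAt (by simp))]
  congr 1
  refine EventuallyEq.fderiv_eq ?_
  filter_upwards [(chartAt (Coord n) x).open_target.mem_nhds (mem_chart_target (Coord n) x)]
    with z hz
  rw [fieldCoord_eq_toCoord X hz]
  simp [flux, coordField]

/-- The components of `X` are multiplied by the Jacobian matrix and the density by its absolute
determinant. So the fluxes in two charts are Piola transforms of each other, up to the sign of the
determinant. -/
theorem flux_chartChange (g : SmoothMetric n M) (X : (x : M) → TangentSpace (𝓡 n) x) {x₀ x₁ : M}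
    {z : Coord n} (hz : z ∈ (chartChange x₀ x₁).source) :
    |(fderiv ℝ (chartChange x₀ x₁) z).det| • flux g X x₁ (chartChange x₀ x₁ z) =
      fderiv ℝ (chartChange x₀ x₁) z (flux g X x₀ z) := by
  obtain ⟨h0, h1⟩ := mem_chartChange_source.1 hz
  have hx := (chartAt (Coord n) x₀).map_target h0
  have hr := (chartAt (Coord n) x₀).right_inv h0
  have hl : (chartAt (Coord n) x₁).symm (chartChange x₀ x₁ z) = (chartAt (Coord n) x₀).symm z :=
    (chartAt (Coord n) x₁).left_inv h1
  rw [flux, flux, coordField, coordField, hl, toCoord_chartChange hx h1, hr,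
    volDensity_chartChange g hz, map_smul, mul_smul]

/-- The divergence can be computed in the coordinates of any chart. -/
theorem divergence_eq_trace (g : SmoothMetric n M) {X : (x : M) → TangentSpace (𝓡 n) x}
    {x₀ x : M} (hx : x ∈ (chartAt (Coord n) x₀).source) (hX : SmoothFieldAt X x) :
    divergence g X x = (volDensity g x₀ (chartAt (Coord n) x₀ x))⁻¹ *
      LinearMap.trace ℝ (Coord n) (fderiv ℝ (flux g X x₀) (chartAt (Coord n) x₀ x)) := by
  have hx' := mem_chart_source (Coord n) x
  set z := chartAt (Coord n) x₀ x with hz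
  have hl : (chartAt (Coord n) x₀).symm z = x := (chartAt (Coord n) x₀).left_inv hx
  have hzs : z ∈ (chartChange x₀ x).source :=
    mem_chartChange_source.2 ⟨(chartAt (Coord n) x₀).map_source hx, by rwa [hl]⟩
  have hc : chartChange x₀ x z = chartAt (Coord n) x x := by
    change chartAt (Coord n) x ((chartAt (Coord n) x₀).symm z) = _
    rw [hl]
  have hnhds := (chartChange x₀ x).open_source.mem_nhds hzs
  have hP := trace_fderiv_piola_abs (F₀ := flux g X x₀) (F₁ := flux g X x)
    (((contDiffOn_chartChange x₀ x).contDiffAt hnhds).of_le (by norm_cast))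
    (fderiv_chartChange_det_ne_zero hzs)
    ((contDiffAt_flux g hx hX).differentiableAt (by simp))
    (by rw [hc]; exact (contDiffAt_flux g hx' hX).differentiableAt (by simp))
    (Filter.mem_of_superset hnhds fun y hy => flux_chartChange g X hy)
  rw [divergence_eq_trace_self g hX, hP, volDensity_chartChange g hzs, hc, mul_inv,
    mul_mul_mul_comm, inv_mul_cancel₀ (abs_ne_zero.2 (fderiv_chartChange_det_ne_zero hzs)),
    one_mul]

theorem divergence_congr (g : SmoothMetric n M) {X Y : (x : M) → TangentSpace (𝓡 n) x} {x : M}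
    (hX : SmoothFieldAt X x) (h : ∀ᶠ y in 𝓝 x, Y y = X y) :
    divergence g Y x = divergence g X x := by
  rw [divergence_eq_trace_self g hX, divergence_eq_trace_self g (hX.congr h)]
  congr 3
  refine EventuallyEq.fderiv_eq ?_
  have hx := mem_chart_target (Coord n) x
  have hc : Tendsto (chartAt (Coord n) x).symm (𝓝 (chartAt (Coord n) x x)) (𝓝 x) := by
    have := (chartAt (Coord n) x).continuousAt_symm hx
    rwa [ContinuousAt, (chartAt (Coord n) x).left_inv (mem_chart_source (Coord n) x)] at this
  filter_upwards [hc.eventually h] with z hz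
  rw [flux, flux, coordField, coordField, hz]

theorem divergence_add (g : SmoothMetric n M) {X Y : (x : M) → TangentSpace (𝓡 n) x} {x : M}
    (hX : SmoothFieldAt X x) (hY : SmoothFieldAt Y x) :
    divergence g (fun x => X x + Y x) x = divergence g X x + divergence g Y x := by
  have hx := mem_chart_source (Coord n) x
  rw [divergence_eq_trace_self g hX, divergence_eq_trace_self g hY,
    divergence_eq_trace_self g (hX.add hY), ← mul_add, ← map_add]
  have hXd := (contDiffAt_flux g hx hX).differentiableAt (by simp)
  have hYd := (contDiffAt_flux g hx hY).differentiableAt (by simp)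
  have : flux g (fun x => X x + Y x) x = flux g X x + flux g Y x := by
    ext z : 1
    simp [flux, coordField]
  rw [this, fderiv_add hXd hYd]
  rfl

theorem divergence_smul (g : SmoothMetric n M) {X : (x : M) → TangentSpace (𝓡 n) x} {f : M → ℝ}
    {x : M} (hf : ContMDiffAt (𝓡 n) 𝓘(ℝ, ℝ) ∞ f x) (hX : SmoothFieldAt X x) :
    divergence g (fun x => f x • X x) x =
      f x * divergence g X x + differential f x (X x) := by
  have hx := mem_chart_source (Coord n) x
  have hl := (chartAt (Coord n) x).left_inv hx
  rw [divergence_eq_trace_self g hX, divergence_eq_trace_self g (hX.smul hf),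
    differential_eq_fderiv hx (hf.mdifferentiableAt (by simp))]
  have hXd := (contDiffAt_flux g hx hX).differentiableAt (by simp)
  have hfd := (contDiffAt_comp_chart_symm hx hf).differentiableAt (by simp)
  have : flux g (fun x => f x • X x) x = (f ∘ (chartAt (Coord n) x).symm) • flux g X x := by
    ext z : 1
    simp [flux, coordField, smul_comm (volDensity g x z)]
  rw [this, fderiv_smul hfd hXd, ContinuousLinearMap.toLinearMap_add,
    ContinuousLinearMap.toLinearMap_smul, map_add, map_smul, trace_smulRight]
  simp only [Function.comp_apply, hl, flux, coordField_chart X hx, map_smul, smul_eq_mul]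
  have := (volDensity_pos g (mem_chart_target (Coord n) x)).ne'
  field_simp

/-- The definition uses a different chart at every point, which says nothing about continuity. Chart
independence makes it possible to keep the chart at `x₀` fixed on a neighbourhood. -/
theorem continuousOn_divergence (g : SmoothMetric n M) {X : (x : M) → TangentSpace (𝓡 n) x}
    {s : Set M} (hX : ∀ x ∈ s, SmoothFieldAt X x) (hs : IsOpen s) :
    ContinuousOn (divergence g X) s := by
  intro x₀ hx₀
  refine ContinuousAt.continuousWithinAt ?_
  have hx := mem_chart_source (Coord n) x₀
  have h1 : divergence g X =ᶠ[𝓝 x₀] fun x => (volDensity g x₀ (chartAt (Coord n) x₀ x))⁻¹ *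
      LinearMap.trace ℝ (Coord n) (fderiv ℝ (flux g X x₀) (chartAt (Coord n) x₀ x)) := by
    filter_upwards [hs.mem_nhds hx₀, (chartAt (Coord n) x₀).open_source.mem_nhds hx] with y hy hy'
    exact divergence_eq_trace g hy' (hX y hy)
  refine ContinuousAt.congr ?_ h1.symm
  have hc := (chartAt (Coord n) x₀).continuousAt hx
  have hv := (volDensity_pos g (mem_chart_target (Coord n) x₀)).ne'
  refine ((ContinuousAt.comp (contDiffAt_volDensity g hx).continuousAt hc).inv₀ hv).mul ?_
  have h3 : ContinuousAt (fderiv ℝ (flux g X x₀)) (chartAt (Coord n) x₀ x₀) :=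
    ((contDiffAt_flux g hx (hX _ hx₀)).fderiv_right (m := 0) (by simp)).continuousAt
  simp only [← sum_apply_single_eq_trace]
  refine tendsto_finsetSum _ fun i _ => ?_
  have h4 : Continuous fun A : Coord n →L[ℝ] Coord n => A (EuclideanSpace.single i (1 : ℝ)) i := by
    fun_prop
  exact h4.continuousAt.comp (ContinuousAt.comp h3 hc)

end Divergence

/-! ### Rules for the differential, and the gradient -/

section Gradient

open Filter Topology

variable {n : ℕ} {M : Type*} [TopologicalSpace M]
  [ChartedSpace (EuclideanSpace ℝ (Fin n)) M] [IsManifold (𝓡 n) ∞ M]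

omit [IsManifold (𝓡 n) ∞ M] in
theorem differential_congr {f h : M → ℝ} {x : M} (H : f =ᶠ[𝓝 x] h)
    (v : TangentSpace (𝓡 n) x) : differential f x v = differential h x v :=
  DFunLike.congr_fun (F := TangentSpace (𝓡 n) x →L[ℝ] ℝ) (H.mfderiv_eq (I := 𝓡 n)) v

theorem differential_eq_fderiv_of_contMDiffAt {f : M → ℝ} {x : M}
    (hf : ContMDiffAt (𝓡 n) 𝓘(ℝ, ℝ) ∞ f x) (v : TangentSpace (𝓡 n) x) :
    differential f x v = fderiv ℝ (f ∘ (chartAt (Coord n) x).symm) (chartAt (Coord n) x x)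
      (toCoord x x v) ∧
    DifferentiableAt ℝ (f ∘ (chartAt (Coord n) x).symm) (chartAt (Coord n) x x) :=
  ⟨differential_eq_fderiv (mem_chart_source (Coord n) x) (hf.mdifferentiableAt (by simp)) v,
    (contDiffAt_comp_chart_symm (mem_chart_source (Coord n) x) hf).differentiableAt (by simp)⟩

theorem differential_add {f h : M → ℝ} {x : M} (hf : ContMDiffAt (𝓡 n) 𝓘(ℝ, ℝ) ∞ f x)
    (hh : ContMDiffAt (𝓡 n) 𝓘(ℝ, ℝ) ∞ h x) (v : TangentSpace (𝓡 n) x) :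
    differential (fun y => f y + h y) x v = differential f x v + differential h x v := by
  obtain ⟨e1, d1⟩ := differential_eq_fderiv_of_contMDiffAt hf v
  obtain ⟨e2, d2⟩ := differential_eq_fderiv_of_contMDiffAt hh v
  have hs : ContMDiffAt (𝓡 n) 𝓘(ℝ, ℝ) ∞ (fun y => f y + h y) x := hf.add hh
  rw [(differential_eq_fderiv_of_contMDiffAt hs v).1, e1, e2]
  exact DFunLike.congr_fun (fderiv_add d1 d2) _

theorem differential_mul {f h : M → ℝ} {x : M} (hf : ContMDiffAt (𝓡 n) 𝓘(ℝ, ℝ) ∞ f x)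
    (hh : ContMDiffAt (𝓡 n) 𝓘(ℝ, ℝ) ∞ h x) (v : TangentSpace (𝓡 n) x) :
    differential (fun y => f y * h y) x v =
      f x * differential h x v + h x * differential f x v := by
  obtain ⟨e1, d1⟩ := differential_eq_fderiv_of_contMDiffAt hf v
  obtain ⟨e2, d2⟩ := differential_eq_fderiv_of_contMDiffAt hh v
  have hs : ContMDiffAt (𝓡 n) 𝓘(ℝ, ℝ) ∞ (fun y => f y * h y) x := hf.mul hh
  rw [(differential_eq_fderiv_of_contMDiffAt hs v).1, e1, e2]
  have := DFunLike.congr_fun (fderiv_mul d1 d2) (toCoord x x v)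
  simp only [_root_.add_apply, _root_.smul_apply, Function.comp_apply,
    (chartAt (Coord n) x).left_inv (mem_chart_source (Coord n) x), smul_eq_mul] at this
  exact this

theorem differential_comp {f : M → ℝ} {F : ℝ → ℝ} {x : M}
    (hf : ContMDiffAt (𝓡 n) 𝓘(ℝ, ℝ) ∞ f x) (hF : ContDiffAt ℝ ∞ F (f x))
    (v : TangentSpace (𝓡 n) x) :
    differential (fun y => F (f y)) x v = deriv F (f x) * differential f x v := by
  obtain ⟨e1, d1⟩ := differential_eq_fderiv_of_contMDiffAt hf v
  have hl := (chartAt (Coord n) x).left_inv (mem_chart_source (Coord n) x)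
  have hc : ContMDiffAt (𝓡 n) 𝓘(ℝ, ℝ) ∞ (fun y => F (f y)) x :=
    ContMDiffAt.comp (I' := 𝓘(ℝ, ℝ)) x hF.contMDiffAt hf
  rw [(differential_eq_fderiv_of_contMDiffAt hc v).1, e1]
  have hFd : DifferentiableAt ℝ F
      ((f ∘ (chartAt (Coord n) x).symm) (chartAt (Coord n) x x)) := by
    rw [Function.comp_apply, hl]
    exact hF.differentiableAt (by simp)
  have h3 : HasFDerivAt ((fun y => F (f y)) ∘ (chartAt (Coord n) x).symm) _
      (chartAt (Coord n) x x) := hFd.hasDerivAt.comp_hasFDerivAt _ d1.hasFDerivAt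
  rw [h3.fderiv]
  simp [hl]

omit [IsManifold (𝓡 n) ∞ M] in
theorem differential_const (c : ℝ) (x : M) (v : TangentSpace (𝓡 n) x) :
    differential (fun _ : M => c) x v = 0 :=
  DFunLike.congr_fun (F := TangentSpace (𝓡 n) x →L[ℝ] ℝ) (mfderiv_const (I := 𝓡 n)) v

theorem inner_grad (g : SmoothMetric n M) (f : M → ℝ) (x : M) (v : TangentSpace (𝓡 n) x) :
    g.inner x (grad g f x) v = differential f x v := by
  have : FiniteDimensional ℝ (TangentSpace (𝓡 n) x) :=
    inferInstanceAs (FiniteDimensional ℝ (EuclideanSpace ℝ (Fin n)))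
  exact LinearMap.BilinForm.apply_toDual_symm_apply
    (hB := metricForm_nondegenerate g x) _ v

theorem inner_sub_apply (g : SmoothMetric n M) {x : M} (v w y : TangentSpace (𝓡 n) x) :
    g.inner x (v - w) y = g.inner x v y - g.inner x w y := by
  rw [map_sub]
  rfl

theorem grad_eq_of_inner (g : SmoothMetric n M) {f : M → ℝ} {x : M} {w : TangentSpace (𝓡 n) x}
    (h : ∀ v, g.inner x w v = differential f x v) : grad g f x = w := by
  by_contra hne
  have h1 := g.pos x (grad g f x - w) (sub_ne_zero.2 hne)
  have h2 : g.inner x (grad g f x - w) (grad g f x - w) = 0 := by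
    rw [map_sub, inner_sub_apply g, inner_sub_apply g, inner_grad, inner_grad, h, h, sub_self,
      sub_self, sub_self]
  exact h1.ne' h2

theorem inner_grad_right (g : SmoothMetric n M) (f : M → ℝ) (x : M) (v : TangentSpace (𝓡 n) x) :
    g.inner x v (grad g f x) = differential f x v := by
  rw [g.symm, inner_grad]

theorem metricNorm_sq (g : SmoothMetric n M) (x : M) (v : TangentSpace (𝓡 n) x) :
    metricNorm g x v ^ 2 = g.inner x v v := by
  refine Real.sq_sqrt ?_
  by_cases h : v = 0
  · simp [h]
  · exact (g.pos x v h).le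

theorem metricNorm_nonneg (g : SmoothMetric n M) (x : M) (v : TangentSpace (𝓡 n) x) :
    0 ≤ metricNorm g x v :=
  Real.sqrt_nonneg _

/-- The Cauchy–Schwarz inequality. -/
theorem abs_inner_le (g : SmoothMetric n M) (x : M) (v w : TangentSpace (𝓡 n) x) :
    |g.inner x v w| ≤ metricNorm g x v * metricNorm g x w := by
  refine abs_le_of_sq_le_sq ?_ (mul_nonneg (metricNorm_nonneg g x v) (metricNorm_nonneg g x w))
  rw [mul_pow, metricNorm_sq, metricNorm_sq]
  refine LinearMap.BilinForm.apply_sq_le_of_symm (metricForm g x)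
    (fun v => (sq_nonneg _).trans_eq (metricNorm_sq g x v)) ⟨fun v w => g.symm x v w⟩ v w

/-- The components of a tangent vector in terms of its scalar products with the frame. -/
theorem toCoord_eq_inv_gram (g : SmoothMetric n M) {x₀ x : M}
    (hx : x ∈ (chartAt (Coord n) x₀).source) (v : TangentSpace (𝓡 n) x) (i : Fin n) :
    toCoord x₀ x v i = ∑ j, (gram g x₀ (chartAt (Coord n) x₀ x))⁻¹ i j *
      g.inner x v (frame x₀ x (EuclideanSpace.single j (1 : ℝ))) := by
  have hdet := gram_det_pos g ((chartAt (Coord n) x₀).map_source hx)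
  have h1 : (gram g x₀ (chartAt (Coord n) x₀ x)).mulVec (toCoord x₀ x v).ofLp =
      fun j => g.inner x v (frame x₀ x (EuclideanSpace.single j (1 : ℝ))) := by
    ext j
    rw [g.symm, inner_eq_dotProduct g hx, toCoord_frame hx]
    simp
  have h2 := congrArg (gram g x₀ (chartAt (Coord n) x₀ x))⁻¹.mulVec h1
  rw [Matrix.mulVec_mulVec, Matrix.nonsing_inv_mul _ (isUnit_iff_ne_zero.2 hdet.ne'),
    Matrix.one_mulVec] at h2
  rw [h2]
  rfl

/-- In coordinates the gradient has components `∑ⱼ g^{ij} ∂ⱼ f`. Smoothness of `f` is required near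
`x` because this formula has to hold on a neighbourhood. -/
theorem smoothFieldAt_grad (g : SmoothMetric n M) {f : M → ℝ} {x : M}
    (hf : ∀ᶠ y in 𝓝 x, ContMDiffAt (𝓡 n) 𝓘(ℝ, ℝ) ∞ f y) : SmoothFieldAt (grad g f) x := by
  have hx := mem_chart_source (Coord n) x
  have hxt := mem_chart_target (Coord n) x
  rw [smoothFieldAt_iff_toCoord hx]
  have h1 : (fun y => toCoord x y (grad g f y)) =ᶠ[𝓝 x] fun y =>
      (fun z => WithLp.toLp 2 fun i => ∑ j, (gram g x z)⁻¹ i j *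
        fderiv ℝ (f ∘ (chartAt (Coord n) x).symm) z (EuclideanSpace.single j (1 : ℝ)))
        (chartAt (Coord n) x y) := by
    filter_upwards [hf, (chartAt (Coord n) x).open_source.mem_nhds hx] with y hy hys
    ext i
    rw [toCoord_eq_inv_gram g hys]
    refine Finset.sum_congr rfl fun j _ => ?_
    rw [inner_grad, differential_eq_fderiv hys (hy.mdifferentiableAt (by simp)),
      toCoord_frame hys]
  suffices h2 : ContDiffAt ℝ ∞ (fun z => (WithLp.toLp 2 fun i => ∑ j, (gram g x z)⁻¹ i j *
      fderiv ℝ (f ∘ (chartAt (Coord n) x).symm) z (EuclideanSpace.single j (1 : ℝ)) : Coord n))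
      (chartAt (Coord n) x x) from
    ContMDiffAt.congr_of_eventuallyEq (contMDiffAt_comp_chart hx h2) h1
  refine (contDiffAt_euclidean (𝕜 := ℝ)).2 fun i => ?_
  change ContDiffAt ℝ ∞ (fun z => ∑ j, (gram g x z)⁻¹ i j *
      fderiv ℝ (f ∘ (chartAt (Coord n) x).symm) z (EuclideanSpace.single j (1 : ℝ))) _
  refine ContDiffAt.sum fun j _ => ?_
  have h3 : ContDiffAt ℝ ∞ (fun z => (gram g x z)⁻¹ i j) (chartAt (Coord n) x x) :=
    (contDiffOn_matrix_inv (contDiffOn_gram g x) (fun z hz => (gram_det_pos g hz).ne')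
      i j).contDiffAt ((chartAt (Coord n) x).open_target.mem_nhds hxt)
  have h4 := (contDiffAt_comp_chart_symm hx hf.self_of_nhds).fderiv_right (m := ∞) (by simp)
  exact h3.mul (h4.clm_apply contDiffAt_const)

theorem isSmoothVectorField_grad (g : SmoothMetric n M) {f : M → ℝ}
    (hf : ContMDiff (𝓡 n) 𝓘(ℝ, ℝ) ∞ f) : IsSmoothVectorField (grad g f) :=
  fun x => smoothFieldAt_grad g (x := x) (Eventually.of_forall fun y => hf y)

theorem grad_add (g : SmoothMetric n M) {f h : M → ℝ} {x : M}
    (hf : ContMDiffAt (𝓡 n) 𝓘(ℝ, ℝ) ∞ f x) (hh : ContMDiffAt (𝓡 n) 𝓘(ℝ, ℝ) ∞ h x) :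
    grad g (fun y => f y + h y) x = grad g f x + grad g h x :=
  grad_eq_of_inner g fun v => by
    rw [map_add, _root_.add_apply, inner_grad, inner_grad, differential_add hf hh]

theorem grad_mul (g : SmoothMetric n M) {f h : M → ℝ} {x : M}
    (hf : ContMDiffAt (𝓡 n) 𝓘(ℝ, ℝ) ∞ f x) (hh : ContMDiffAt (𝓡 n) 𝓘(ℝ, ℝ) ∞ h x) :
    grad g (fun y => f y * h y) x = f x • grad g h x + h x • grad g f x :=
  grad_eq_of_inner g fun v => by
    rw [map_add, _root_.add_apply, map_smul, map_smul, _root_.smul_apply, _root_.smul_apply,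
      inner_grad, inner_grad, differential_mul hf hh, smul_eq_mul, smul_eq_mul]

theorem SmoothFieldAt.continuousAt_inner {X Y : (x : M) → TangentSpace (𝓡 n) x}
    {x : M} (g : SmoothMetric n M) (hX : SmoothFieldAt X x) (hY : SmoothFieldAt Y x) :
    ContinuousAt (fun x => g.inner x (X x) (Y x)) x := by
  have hx := mem_chart_source (Coord n) x
  have h1 : (fun x => g.inner x (X x) (Y x)) =ᶠ[𝓝 x] fun y =>
      ∑ i, ∑ j, gram g x (chartAt (Coord n) x y) i j * toCoord x y (X y) i *
        toCoord x y (Y y) j := by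
    filter_upwards [(chartAt (Coord n) x).open_source.mem_nhds hx] with y hys
    exact inner_eq_gram g hys _ _
  refine ContinuousAt.congr ?_ h1.symm
  have hX' := ((smoothFieldAt_iff_toCoord hx).1 hX).continuousAt
  have hY' := ((smoothFieldAt_iff_toCoord hx).1 hY).continuousAt
  refine tendsto_finsetSum _ fun i _ => tendsto_finsetSum _ fun j _ => ?_
  have hp : ∀ i, Continuous fun v : Coord n => v i := fun i => by fun_prop
  refine Tendsto.mul (Tendsto.mul ?_ ((hp i).continuousAt.comp hX')) ((hp j).continuousAt.comp hY')
  exact ContinuousAt.comp (f := chartAt (Coord n) x) ((contDiffOn_gram g x i j).contDiffAt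
    ((chartAt (Coord n) x).open_target.mem_nhds (mem_chart_target (Coord n) x))).continuousAt
    ((chartAt (Coord n) x).continuousAt hx)

end Gradient

/-! ### The Riemannian volume in the coordinates of a chart -/

section Volume

open Filter Topology

variable {n : ℕ} {M : Type*} [TopologicalSpace M]
  [ChartedSpace (EuclideanSpace ℝ (Fin n)) M] [IsManifold (𝓡 n) ∞ M]
  [MeasurableSpace M] [BorelSpace M]

omit [IsManifold (𝓡 n) ∞ M] in
theorem measurableSet_target_inter_preimage (x₀ : M) {S : Set M} (hS : MeasurableSet S) :
    MeasurableSet ((chartAt (Coord n) x₀).symm ⁻¹' S ∩ (chartAt (Coord n) x₀).target) := by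
  have h := ((continuousOn_iff_continuous_domRestrict.1
    (chartAt (Coord n) x₀).continuousOn_symm).measurable hS)
  convert (chartAt (Coord n) x₀).open_target.measurableSet.subtype_image h using 1
  ext z
  simp [and_comm]

omit [IsManifold (𝓡 n) ∞ M] in
theorem measurableSet_source_inter_preimage (x₀ : M) {S : Set (Coord n)} (hS : MeasurableSet S) :
    MeasurableSet ((chartAt (Coord n) x₀) ⁻¹' S ∩ (chartAt (Coord n) x₀).source) := by
  have h := ((continuousOn_iff_continuous_domRestrict.1
    (chartAt (Coord n) x₀).continuousOn).measurable hS)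
  convert (chartAt (Coord n) x₀).open_source.measurableSet.subtype_image h using 1
  ext z
  simp [and_comm]

omit [IsManifold (𝓡 n) ∞ M] in
theorem aemeasurable_chart_symm (x₀ : M) {μ : Measure (Coord n)}
    (hμ : μ ≪ volume.restrict (chartAt (Coord n) x₀).target) :
    AEMeasurable (chartAt (Coord n) x₀).symm μ :=
  ((chartAt (Coord n) x₀).continuousOn_symm.aemeasurable
    (chartAt (Coord n) x₀).open_target.measurableSet).mono_ac hμ

theorem chartVolume_apply (g : SmoothMetric n M) (x₀ : M) {S : Set M} (hS : MeasurableSet S) :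
    chartVolume g x₀ S = ∫⁻ z in (chartAt (Coord n) x₀).symm ⁻¹' S ∩ (chartAt (Coord n) x₀).target,
      ENNReal.ofReal (volDensity g x₀ z) := by
  rw [chartVolume, Measure.map_apply_of_aemeasurable
    (aemeasurable_chart_symm x₀ (withDensity_absolutelyContinuous _ _)) hS, withDensity_apply',
    Measure.restrict_restrict' (chartAt (Coord n) x₀).open_target.measurableSet]

theorem chartVolume_compl_source (g : SmoothMetric n M) (x₀ : M) :
    chartVolume g x₀ (chartAt (Coord n) x₀).sourceᶜ = 0 := by
  rw [chartVolume_apply g x₀ (chartAt (Coord n) x₀).open_source.measurableSet.compl]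
  have : (chartAt (Coord n) x₀).symm ⁻¹' (chartAt (Coord n) x₀).sourceᶜ ∩
      (chartAt (Coord n) x₀).target = ∅ := by
    ext z
    simp only [mem_inter_iff, mem_preimage, mem_compl_iff, mem_empty_iff_false, iff_false,
      not_and]
    exact fun h hz => h ((chartAt (Coord n) x₀).map_target hz)
  rw [this]
  simp

/-- The volume elements of two charts agree on the overlap of their domains. -/
theorem chartVolume_eq (g : SmoothMetric n M) {x₀ x₁ : M} {S : Set M} (hS : MeasurableSet S)
    (h₀ : S ⊆ (chartAt (Coord n) x₀).source) (h₁ : S ⊆ (chartAt (Coord n) x₁).source) :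
    chartVolume g x₁ S = chartVolume g x₀ S := by
  rw [chartVolume_apply g x₀ hS, chartVolume_apply g x₁ hS]
  set T := (chartAt (Coord n) x₀).symm ⁻¹' S ∩ (chartAt (Coord n) x₀).target with hT
  have hTs : T ⊆ (chartChange x₀ x₁).source := fun z hz =>
    mem_chartChange_source.2 ⟨hz.2, h₁ hz.1⟩
  have himg : (chartAt (Coord n) x₁).symm ⁻¹' S ∩ (chartAt (Coord n) x₁).target =
      chartChange x₀ x₁ '' T := by
    ext y
    constructor
    · rintro ⟨hy, hyt⟩
      have hy0 := h₀ hy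
      refine ⟨chartAt (Coord n) x₀ ((chartAt (Coord n) x₁).symm y), ⟨?_, ?_⟩, ?_⟩
      · rw [mem_preimage, (chartAt (Coord n) x₀).left_inv hy0]
        exact hy
      · exact (chartAt (Coord n) x₀).map_source hy0
      · change chartAt (Coord n) x₁ ((chartAt (Coord n) x₀).symm _) = y
        rw [(chartAt (Coord n) x₀).left_inv hy0, (chartAt (Coord n) x₁).right_inv hyt]
    · rintro ⟨z, ⟨hzS, hzt⟩, rfl⟩
      have hz1 := h₁ hzS
      change (chartAt (Coord n) x₁).symm (chartAt (Coord n) x₁ ((chartAt (Coord n) x₀).symm z)) ∈ S ∧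
        chartAt (Coord n) x₁ ((chartAt (Coord n) x₀).symm z) ∈ _
      rw [(chartAt (Coord n) x₁).left_inv hz1]
      exact ⟨hzS, (chartAt (Coord n) x₁).map_source hz1⟩
  -- Change of variables: the Jacobian factor is exactly the ratio of the two densities.
  rw [himg, lintegral_image_eq_lintegral_abs_det_fderiv_mul volume
    (measurableSet_target_inter_preimage x₀ hS)
    (f' := fun z => fderiv ℝ (chartChange x₀ x₁) z) (fun z hz => ?_)
    ((chartChange x₀ x₁).injOn.mono hTs)]
  · refine setLIntegral_congr_fun (measurableSet_target_inter_preimage x₀ hS) fun z hz => ?_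
    simp only [volDensity_chartChange g (hTs hz)]
    rw [ENNReal.ofReal_mul (abs_nonneg _)]
  · exact (((contDiffOn_chartChange x₀ x₁).contDiffAt ((chartChange x₀ x₁).open_source.mem_nhds
      (hTs hz))).differentiableAt (by simp)).hasFDerivAt.hasFDerivWithinAt

/-- Since the chart measures agree on overlaps, none of them charges a subset of this chart domain
more than `chartVolume g x₀` does, so the supremum adds nothing there. -/
theorem riemannianVolume_restrict_source (g : SmoothMetric n M) (x₀ : M) :
    (riemannianVolume g).restrict (chartAt (Coord n) x₀).source = chartVolume g x₀ := by
  set U := (chartAt (Coord n) x₀).source with hU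
  have hUm : MeasurableSet U := (chartAt (Coord n) x₀).open_source.measurableSet
  have hself : (chartVolume g x₀).restrict U = chartVolume g x₀ := by
    exact Measure.restrict_eq_self_of_ae_mem (chartVolume_compl_source g x₀)
  -- A measure dominating every chart measure dominates their supremum. The candidate is the
  -- expected measure on `U` plus the supremum itself off `U`; each chart measure is compared on the
  -- two pieces separately.
  have hle : riemannianVolume g ≤ chartVolume g x₀ + (riemannianVolume g).restrict Uᶜ := by
    refine iSup_le fun x₁ => Measure.le_iff.2 fun S hS => ?_
    rw [Measure.add_apply, Measure.restrict_apply hS, ← measure_inter_add_sdiff S hUm]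
    refine add_le_add ?_ ?_
    · have hV : MeasurableSet (chartAt (Coord n) x₁).source :=
        (chartAt (Coord n) x₁).open_source.measurableSet
      have h1 : chartVolume g x₁ (S ∩ U) =
          chartVolume g x₁ (S ∩ U ∩ (chartAt (Coord n) x₁).source) := by
        exact (measure_inter_conull (chartVolume_compl_source g x₁)).symm
      rw [h1, chartVolume_eq g (x₀ := x₀) ((hS.inter hUm).inter hV)
        (fun y hy => hy.1.2) (fun y hy => hy.2)]
      exact measure_mono fun y hy => hy.1.1
    · rw [Set.sdiff_eq]
      exact le_iSup (fun x₁ => chartVolume g x₁) x₁ _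
  refine le_antisymm ?_ ?_
  · refine (Measure.restrict_mono_measure hle U).trans ?_
    rw [Measure.restrict_add, hself, Measure.restrict_restrict hUm, inter_compl_self]
    simp
  · rw [← hself]
    exact Measure.restrict_mono_measure (le_iSup (fun x₁ => chartVolume g x₁) x₀) U

theorem ae_riemannianVolume_of_ae_coord (g : SmoothMetric n M) (x₀ : M) {Q : Coord n → Prop}
    (hQ : ∀ᵐ z, Q z) :
    ∀ᵐ x ∂(riemannianVolume g), x ∈ (chartAt (Coord n) x₀).source →
      Q (chartAt (Coord n) x₀ x) := by
  obtain ⟨N, hNsub, hNm, hN0⟩ := exists_measurable_superset_of_null hQ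
  rw [← ae_restrict_iff' (chartAt (Coord n) x₀).open_source.measurableSet,
    riemannianVolume_restrict_source]
  have h0 : chartVolume g x₀ ((chartAt (Coord n) x₀) ⁻¹' N ∩ (chartAt (Coord n) x₀).source) = 0 := by
    rw [chartVolume_apply g x₀ (measurableSet_source_inter_preimage x₀ hNm)]
    refine setLIntegral_measure_zero _ _ (measure_mono_null ?_ hN0)
    rintro z ⟨⟨h1, -⟩, h2⟩
    rwa [mem_preimage, (chartAt (Coord n) x₀).right_inv h2] at h1
  refine measure_mono_null ?_ (measure_union_null h0 (chartVolume_compl_source g x₀))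
  intro x hx
  by_cases hxs : x ∈ (chartAt (Coord n) x₀).source
  · exact Or.inl ⟨hNsub hx, hxs⟩
  · exact Or.inr hxs

/-- The density is strictly positive on the target of the chart, so null sets for the volume are
Lebesgue null in coordinates. -/
theorem ae_coord_of_ae_riemannianVolume (g : SmoothMetric n M) (x₀ : M) {P : M → Prop}
    (hP : ∀ᵐ x ∂(riemannianVolume g), P x) :
    ∀ᵐ z, z ∈ (chartAt (Coord n) x₀).target → P ((chartAt (Coord n) x₀).symm z) := by
  have h1 : ∀ᵐ x ∂(chartVolume g x₀), P x := by
    rw [← riemannianVolume_restrict_source]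
    exact ae_restrict_of_ae hP
  have h2 := ae_of_ae_map (aemeasurable_chart_symm x₀ (withDensity_absolutelyContinuous _ _)) h1
  rw [← ae_restrict_iff' (chartAt (Coord n) x₀).open_target.measurableSet]
  have hc : AEMeasurable (fun z => ENNReal.ofReal (volDensity g x₀ z))
      (volume.restrict (chartAt (Coord n) x₀).target) :=
    ((contDiffOn_volDensity g x₀).continuousOn.aemeasurable
      (chartAt (Coord n) x₀).open_target.measurableSet).ennreal_ofReal
  have h3 := (ae_withDensity_iff' hc).1 h2
  filter_upwards [h3, ae_restrict_mem (chartAt (Coord n) x₀).open_target.measurableSet]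
    with z hz hzt
  exact hz (by simpa using volDensity_pos g hzt)

theorem integrable_chart_iff (g : SmoothMetric n M) {x₀ : M} {f : M → ℝ}
    (hf : AEStronglyMeasurable f (riemannianVolume g))
    (hs : ∀ x, x ∉ (chartAt (Coord n) x₀).source → f x = 0) :
    (Integrable f (riemannianVolume g) ↔ IntegrableOn
      (fun z => volDensity g x₀ z * f ((chartAt (Coord n) x₀).symm z))
      (chartAt (Coord n) x₀).target) ∧
    ∫ x, f x ∂(riemannianVolume g) = ∫ z in (chartAt (Coord n) x₀).target,
      volDensity g x₀ z * f ((chartAt (Coord n) x₀).symm z) := by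
  have hm := (chartAt (Coord n) x₀).open_target.measurableSet
  have hae := aemeasurable_chart_symm x₀ (μ := ((volume.restrict (chartAt (Coord n) x₀).target).withDensity
    (fun z => ENNReal.ofReal (volDensity g x₀ z)))) (withDensity_absolutelyContinuous _ _)
  have hf' : AEStronglyMeasurable f (chartVolume g x₀) := by
    rw [← riemannianVolume_restrict_source]
    exact hf.restrict
  have hc : AEMeasurable (fun z => ENNReal.ofReal (volDensity g x₀ z))
      (volume.restrict (chartAt (Coord n) x₀).target) :=
    ((contDiffOn_volDensity g x₀).continuousOn.aemeasurable hm).ennreal_ofReal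
  have hfin : ∀ᵐ z ∂(volume.restrict (chartAt (Coord n) x₀).target),
      ENNReal.ofReal (volDensity g x₀ z) < ⊤ := by simp
  have hsub : Function.support f ⊆ (chartAt (Coord n) x₀).source := by
    intro x hx
    by_contra h
    exact hx (hs x h)
  have hpos : ∀ z ∈ (chartAt (Coord n) x₀).target,
      (ENNReal.ofReal (volDensity g x₀ z)).toReal = volDensity g x₀ z := fun z hz =>
    ENNReal.toReal_ofReal (volDensity_pos g hz).le
  constructor
  · rw [← integrableOn_iff_integrable_of_support_subset hsub, IntegrableOn,
      riemannianVolume_restrict_source]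
    unfold chartVolume at hf' ⊢
    rw [integrable_map_measure hf' hae, integrable_withDensity_iff_integrable_smul₀' hc hfin,
      IntegrableOn]
    refine integrable_congr ?_
    filter_upwards [ae_restrict_mem hm] with z hz
    simp [hpos z hz]
  · rw [← setIntegral_eq_integral_of_forall_compl_eq_zero hs, riemannianVolume_restrict_source]
    unfold chartVolume at hf' ⊢
    rw [integral_map hae hf', integral_withDensity_eq_integral_toReal_smul₀ hc hfin]
    refine setIntegral_congr_fun hm fun z hz => ?_
    simp only [hpos z hz, smul_eq_mul]

/-- The density is bounded on a closed ball inside the target of a chart. Local finiteness gives the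
integrability of functions that are continuous on a compact set and vanish outside it. -/
instance isLocallyFiniteMeasure_riemannianVolume (g : SmoothMetric n M) :
    IsLocallyFiniteMeasure (riemannianVolume g) := by
  refine ⟨fun x => ?_⟩
  have ht := mem_chart_target (Coord n) x
  obtain ⟨r, hr, hball⟩ := Metric.nhds_basis_closedBall.mem_iff.1
    ((chartAt (Coord n) x).open_target.mem_nhds ht)
  have hK := isCompact_closedBall (chartAt (Coord n) x x) r
  obtain ⟨C, hC⟩ := hK.exists_bound_of_continuousOn
    ((contDiffOn_volDensity g x).continuousOn.mono hball)
  refine ⟨(chartAt (Coord n) x) ⁻¹' (Metric.ball (chartAt (Coord n) x x) r) ∩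
    (chartAt (Coord n) x).source, inter_mem ((chartAt (Coord n) x).continuousAt
      (mem_chart_source (Coord n) x) (Metric.ball_mem_nhds _ hr))
    ((chartAt (Coord n) x).open_source.mem_nhds (mem_chart_source (Coord n) x)), ?_⟩
  have hm := measurableSet_source_inter_preimage x (Metric.isOpen_ball
    (x := chartAt (Coord n) x x) (ε := r)).measurableSet
  rw [← inter_eq_self_of_subset_left (inter_subset_right
    (s := (chartAt (Coord n) x) ⁻¹' (Metric.ball (chartAt (Coord n) x x) r))
    (t := (chartAt (Coord n) x).source)), ← Measure.restrict_apply hm,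
    riemannianVolume_restrict_source, chartVolume_apply g x hm]
  refine lt_of_le_of_lt (b := ∫⁻ z in Metric.closedBall (chartAt (Coord n) x x) r,
    ENNReal.ofReal C) ?_ ?_
  · refine (lintegral_mono_set (t := Metric.closedBall (chartAt (Coord n) x x) r) ?_).trans ?_
    · rintro z ⟨⟨h1, -⟩, h2⟩
      rw [mem_preimage, (chartAt (Coord n) x).right_inv h2] at h1
      exact Metric.ball_subset_closedBall h1
    · refine setLIntegral_mono' Metric.isClosed_closedBall.measurableSet fun z hz => ?_
      exact ENNReal.ofReal_le_ofReal ((le_abs_self _).trans (hC z hz))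
  · rw [setLIntegral_const]
    exact ENNReal.mul_lt_top ENNReal.ofReal_lt_top hK.measure_lt_top

end Volume

/-! ### Mollification in coordinate space -/

section Mollification

open Filter Topology Convolution ContinuousLinearMap

variable {n : ℕ}

/-- A sequence of bump functions around the origin with supports shrinking to the origin. -/
def shrinkingBump (n k : ℕ) : ContDiffBump (0 : Coord n) where
  rIn := 1 / (2 * ((k : ℝ) + 1))
  rOut := 1 / ((k : ℝ) + 1)
  rIn_pos := by positivity
  rIn_lt_rOut := by
    have : (0 : ℝ) < (k : ℝ) + 1 := by positivity
    exact one_div_lt_one_div_of_lt this (by linarith)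

/-- The convolution of a function with a smooth approximate identity. -/
def mollify (k : ℕ) (f : Coord n → ℝ) : Coord n → ℝ :=
  (shrinkingBump n k).normed volume ⋆[lsmul ℝ ℝ, volume] f

theorem tendsto_shrinkingBump_rOut : Tendsto (fun k => (shrinkingBump n k).rOut) atTop (𝓝 0) :=
  tendsto_one_div_add_atTop_nhds_zero_nat

theorem tendsto_mollify_of_continuous {f : Coord n → ℝ} (hf : Continuous f) (z : Coord n) :
    Tendsto (fun k => mollify k f z) atTop (𝓝 (f z)) :=
  ContDiffBump.convolution_tendsto_right_of_continuous tendsto_shrinkingBump_rOut hf z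

/-- This is Lebesgue's differentiation theorem, which requires the ratio of the outer and inner
radii of the bumps to stay bounded; here it is always `2`. -/
theorem ae_tendsto_mollify {f : Coord n → ℝ} (hf : LocallyIntegrable f) :
    ∀ᵐ z, Tendsto (fun k => mollify k f z) atTop (𝓝 (f z)) := by
  refine ContDiffBump.ae_convolution_tendsto_right_of_locallyIntegrable (K := 2)
    tendsto_shrinkingBump_rOut (Eventually.of_forall fun k => ?_) hf
  change 1 / ((k : ℝ) + 1) ≤ 2 * (1 / (2 * ((k : ℝ) + 1)))
  have : (0 : ℝ) < (k : ℝ) + 1 := by positivity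
  apply le_of_eq
  field_simp

theorem mollify_apply_swap (k : ℕ) (f : Coord n → ℝ) (z : Coord n) :
    mollify k f z = ∫ y, (shrinkingBump n k).normed volume (z - y) * f y :=
  convolution_eq_swap _

theorem contDiff_mollify (k : ℕ) {f : Coord n → ℝ} (hf : LocallyIntegrable f) :
    ContDiff ℝ ∞ (mollify k f) :=
  (shrinkingBump n k).hasCompactSupport_normed.contDiff_convolution_left _
    (n := ⊤) (shrinkingBump n k).contDiff_normed hf

/-- The mollified value is an average with respect to a probability density, so almost-everywhere
bounds become bounds at every point. -/
theorem mollify_mem_Icc (k : ℕ) {f : Coord n → ℝ} (hf : LocallyIntegrable f) {a b : ℝ}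
    (h : ∀ᵐ z, f z ∈ Icc a b) (z : Coord n) : mollify k f z ∈ Icc a b := by
  set φ := (shrinkingBump n k).normed (volume : Measure (Coord n)) with hφ
  have hφi : Integrable φ := (shrinkingBump n k).integrable_normed
  have hint : Integrable (fun t => φ t * f (z - t)) :=
    (shrinkingBump n k).hasCompactSupport_normed.convolutionExists_left (lsmul ℝ ℝ)
      (shrinkingBump n k).continuous_normed hf z
  have hae : ∀ᵐ t, f (z - t) ∈ Icc a b :=
    (Measure.measurePreserving_sub_left volume z).quasiMeasurePreserving.ae h
  have h1 : ∀ c : ℝ, ∫ t, φ t * c = c := fun c => by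
    rw [integral_mul_const, (shrinkingBump n k).integral_normed, one_mul]
  change (∫ t, φ t * f (z - t)) ∈ Icc a b
  constructor
  · rw [← h1 a]
    refine integral_mono_ae (hφi.mul_const a) hint ?_
    filter_upwards [hae] with t ht
    exact mul_le_mul_of_nonneg_left ht.1 ((shrinkingBump n k).nonneg_normed t)
  · rw [← h1 b]
    refine integral_mono_ae hint (hφi.mul_const b) ?_
    filter_upwards [hae] with t ht
    exact mul_le_mul_of_nonneg_left ht.2 ((shrinkingBump n k).nonneg_normed t)

/-- Mollification commutes with weak derivatives. -/
theorem fderiv_mollify (k : ℕ) {f q : Coord n → ℝ} {v : Coord n} (hf : LocallyIntegrable f)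
    (hweak : ∀ η : Coord n → ℝ, ContDiff ℝ ∞ η → HasCompactSupport η →
      ∫ y, f y * fderiv ℝ η y v = -∫ y, q y * η y) (z : Coord n) :
    fderiv ℝ (mollify k f) z v = mollify k q z := by
  set φ := (shrinkingBump n k).normed (volume : Measure (Coord n)) with hφ
  have hφc : HasCompactSupport φ := (shrinkingBump n k).hasCompactSupport_normed
  have hφs : ContDiff ℝ ∞ φ := (shrinkingBump n k).contDiff_normed
  have h1 := hφc.hasFDerivAt_convolution_left (lsmul ℝ ℝ) (μ := volume)
    (hφs.of_le (by norm_cast)) hf z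
  have hint : Integrable (fun y => (precompL (Coord n) (lsmul ℝ ℝ)) (fderiv ℝ φ (z - y)) (f y)) := by
    have := ((hφc.fderiv ℝ).convolutionExists_left (precompL (Coord n) (lsmul ℝ ℝ))
      (hφs.continuous_fderiv (by simp)) hf z).integrable_swap
    exact this
  have h2 : fderiv ℝ (mollify k f) z v = ∫ y, f y * fderiv ℝ φ (z - y) v := by
    rw [mollify, h1.fderiv, convolution_eq_swap, ContinuousLinearMap.integral_apply hint]
    refine integral_congr_ae (Eventually.of_forall fun y => ?_)
    simp [precompL_apply, mul_comm]
  -- For fixed `z` the reflected kernel is an admissible test function. The sign produced by the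
  -- reflection cancels the one in the definition of the weak derivative.
  have hηs : ContDiff ℝ ∞ fun y => φ (z - y) := hφs.comp (contDiff_const.sub contDiff_id)
  have hηc : HasCompactSupport fun y => φ (z - y) :=
    hφc.comp_homeomorph (Homeomorph.subLeft z)
  have h3 := hweak _ hηs hηc
  have h4 : ∀ y, fderiv ℝ (fun y => φ (z - y)) y v = -fderiv ℝ φ (z - y) v := fun y => by
    have := ((hφs.differentiable (by simp) (z - y)).hasFDerivAt.comp y
      ((hasFDerivAt_id y).const_sub z)).fderiv
    have h5 := DFunLike.congr_fun this v
    simpa [Function.comp_def] using h5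
  simp only [h4, mul_neg, integral_neg, neg_inj] at h3
  rw [h2, h3, mollify_apply_swap]
  exact integral_congr_ae (Eventually.of_forall fun y => mul_comm _ _)

/-- Integration by parts against the constant function `1`. -/
theorem integral_fderiv_eq_zero_of_hasCompactSupport {η : Coord n → ℝ} (hη : ContDiff ℝ ∞ η)
    (hηc : HasCompactSupport η) (v : Coord n) : ∫ y, fderiv ℝ η y v = 0 := by
  have hc : Continuous fun y => fderiv ℝ η y v :=
    (hη.continuous_fderiv (by simp)).clm_apply continuous_const
  have h := integral_mul_fderiv_eq_neg_fderiv_mul_of_integrable (μ := volume)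
    (f := fun _ : Coord n => (1 : ℝ)) (g := η) (v := v) (by simp)
    (by simpa using hc.integrable_of_hasCompactSupport (hηc.fderiv_apply ℝ v))
    (by simpa using hη.continuous.integrable_of_hasCompactSupport hηc)
    (fun x _ => differentiableAt_const _) (fun x _ => hη.differentiable (by simp) x)
  simpa using h

theorem continuous_mul_of_tsupport_subset {X : Type*} [TopologicalSpace X] {χ f : X → ℝ}
    {U : Set X} (hU : IsOpen U) (hχ : Continuous χ) (hs : tsupport χ ⊆ U)
    (hf : ContinuousOn f U) : Continuous fun z => χ z * f z := by
  rw [continuous_iff_continuousAt]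
  intro z
  by_cases hz : z ∈ U
  · exact hχ.continuousAt.mul (hf.continuousAt (hU.mem_nhds hz))
  · have h0 : (fun z => χ z * f z) =ᶠ[𝓝 z] fun _ => 0 := by
      filter_upwards [(isClosed_tsupport χ).isOpen_compl.mem_nhds fun h => hz (hs h)] with y hy
      rw [image_eq_zero_of_notMem_tsupport hy, zero_mul]
    exact continuousAt_const.congr h0.symm

/-- A positive continuous function with a locally bounded weak gradient is approximated on a
compact set by positive smooth functions whose derivatives are bounded and converge almost
everywhere. -/
theorem exists_smooth_approximation {U : Set (Coord n)} (hU : IsOpen U) {r : Coord n → ℝ}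
    (hr : ContinuousOn r U) (hpos : ∀ z ∈ U, 0 < r z) {p : Fin n → Coord n → ℝ}
    (hint : ∀ i, ∀ η : Coord n → ℝ, ContDiff ℝ ∞ η → HasCompactSupport η → tsupport η ⊆ U →
      Integrable fun z => p i z * η z)
    (hweak : ∀ i, ∀ η : Coord n → ℝ, ContDiff ℝ ∞ η → HasCompactSupport η → tsupport η ⊆ U →
      ∫ z, r z * fderiv ℝ η z (EuclideanSpace.single i (1 : ℝ)) = -∫ z, p i z * η z)
    (hbd : ∀ K ⊆ U, IsCompact K → ∃ C, ∀ᵐ z, z ∈ K → ∀ i, |p i z| ≤ C)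
    {K : Set (Coord n)} (hK : IsCompact K) (hKU : K ⊆ U) :
    ∃ (R : ℕ → Coord n → ℝ) (m M C : ℝ), 0 < m ∧ (∀ k, ContDiff ℝ ∞ (R k)) ∧
      (∀ k z, R k z ∈ Icc m M) ∧ (∀ z ∈ K, Tendsto (fun k => R k z) atTop (𝓝 (r z))) ∧
      (∀ k z i, |fderiv ℝ (R k) z (EuclideanSpace.single i (1 : ℝ))| ≤ C) ∧
      ∀ᵐ z, z ∈ K → ∀ i, Tendsto
        (fun k => fderiv ℝ (R k) z (EuclideanSpace.single i (1 : ℝ))) atTop (𝓝 (p i z)) := by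
  obtain ⟨K', hK', hKK', hK'U⟩ := exists_compact_between hK hU hKU
  obtain ⟨χ, hχ1, hχ0, hχI⟩ := exists_contMDiffMap_one_nhds_of_subset_interior 𝓘(ℝ, Coord n)
    (n := ⊤) hK.isClosed hKK'
  have hχs : ContDiff ℝ ∞ χ := χ.contMDiff.contDiff
  have hχt : tsupport χ ⊆ K' := closure_minimal
    (fun z hz => by_contra fun h => hz (hχ0 z h)) hK'.isClosed
  have hχc : HasCompactSupport χ := HasCompactSupport.intro hK' hχ0
  set e : Fin n → Coord n := fun i => EuclideanSpace.single i (1 : ℝ) with he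
  -- Cutting off `r - 1` instead of `r` keeps positivity: `1 + f = (1 - χ) + χ r` is a convex
  -- combination of `1` and `r`, defined and positive everywhere and equal to `r` on `K`.
  set f : Coord n → ℝ := fun z => χ z * (r z - 1) with hf
  have hfc : Continuous f := continuous_mul_of_tsupport_subset hU hχs.continuous
    (hχt.trans hK'U) (hr.sub continuousOn_const)
  set dχ : Fin n → Coord n → ℝ := fun i z => fderiv ℝ χ z (e i) with hdχ
  have hdχc : ∀ i, Continuous (dχ i) := fun i =>
    (hχs.continuous_fderiv (by simp)).clm_apply continuous_const
  have hdχt : ∀ i, tsupport (dχ i) ⊆ tsupport χ := fun i => tsupport_fderiv_apply_subset ℝ (e i)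
  have hd0 : ∀ i, ∀ z ∉ K', dχ i z = 0 := fun i z hz =>
    image_eq_zero_of_notMem_tsupport fun h => hz (hχt (hdχt i h))
  have hqc : ∀ i, Continuous fun z => dχ i z * (r z - 1) := fun i =>
    continuous_mul_of_tsupport_subset hU (hdχc i) ((hdχt i).trans (hχt.trans hK'U))
      (hr.sub continuousOn_const)
  have hqs : ∀ i, HasCompactSupport fun z => dχ i z * (r z - 1) := fun i =>
    HasCompactSupport.intro hK' fun z hz => by rw [hd0 i z hz, zero_mul]
  -- The weak derivative of `f`, by the product rule; `hweakq` verifies it.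
  set q : Fin n → Coord n → ℝ := fun i z => p i z * χ z + dχ i z * (r z - 1) with hq
  have hqi : ∀ i, Integrable (q i) := fun i =>
    (hint i χ hχs hχc (hχt.trans hK'U)).add ((hqc i).integrable_of_hasCompactSupport (hqs i))
  have hweakq : ∀ i, ∀ η : Coord n → ℝ, ContDiff ℝ ∞ η → HasCompactSupport η →
      ∫ y, f y * fderiv ℝ η y (e i) = -∫ y, q i y * η y := by
    intro i η hη hηc
    -- The weak derivative of `r` is tested with `χ η`, whose support lies in `U`; the constant `1`
    -- in `r - 1` contributes the integral of a derivative, which vanishes.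
    have hχη : ContDiff ℝ ∞ fun z => χ z * η z := hχs.mul hη
    have hχηc : HasCompactSupport fun z => χ z * η z := hχc.mul_right
    have hχηt : tsupport (fun z => χ z * η z) ⊆ U :=
      (tsupport_mul_subset_left (f := χ)).trans (hχt.trans hK'U)
    have hderiv : ∀ y, fderiv ℝ (fun z => χ z * η z) y (e i) =
        χ y * fderiv ℝ η y (e i) + η y * dχ i y := fun y => by
      have := DFunLike.congr_fun (fderiv_mul (hχs.differentiable (by simp) y)
        (hη.differentiable (by simp) y)) (e i)
      exact this
    have h0 : ∫ y, fderiv ℝ (fun z => χ z * η z) y (e i) = 0 :=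
      integral_fderiv_eq_zero_of_hasCompactSupport hχη hχηc (e i)
    have h1 := hweak i _ hχη hχηc hχηt
    have hdc : Continuous fun y => fderiv ℝ (fun z => χ z * η z) y (e i) :=
      (hχη.continuous_fderiv (by simp)).clm_apply continuous_const
    have hdt : tsupport (fun y => fderiv ℝ (fun z => χ z * η z) y (e i)) ⊆ U :=
      (tsupport_fderiv_apply_subset ℝ (e i)).trans hχηt
    have hdcs : HasCompactSupport fun y => fderiv ℝ (fun z => χ z * η z) y (e i) :=
      hχηc.fderiv_apply ℝ (e i)
    have i1 : Integrable fun y => r y * fderiv ℝ (fun z => χ z * η z) y (e i) := by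
      simp_rw [mul_comm (r _)]
      exact (continuous_mul_of_tsupport_subset hU hdc hdt hr).integrable_of_hasCompactSupport
        hdcs.mul_right
    have i2 : Integrable fun y => fderiv ℝ (fun z => χ z * η z) y (e i) :=
      hdc.integrable_of_hasCompactSupport hdcs
    have i3 : Integrable fun y => dχ i y * (r y - 1) * η y :=
      ((hqc i).mul hη.continuous).integrable_of_hasCompactSupport (hqs i).mul_right
    have i4 : Integrable fun y => p i y * (χ y * η y) := hint i _ hχη hχηc hχηt
    have e1 : ∀ y, f y * fderiv ℝ η y (e i) = r y * fderiv ℝ (fun z => χ z * η z) y (e i)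
        - fderiv ℝ (fun z => χ z * η z) y (e i) - dχ i y * (r y - 1) * η y := fun y => by
      rw [hderiv]
      simp only [hf]
      ring
    have e2 : ∀ y, q i y * η y = p i y * (χ y * η y) + dχ i y * (r y - 1) * η y := fun y => by
      simp only [hq]
      ring
    simp_rw [e1, e2]
    have j1 := integral_sub (i1.sub i2) i3
    simp only [Pi.sub_apply] at j1
    rw [j1, integral_sub i1 i2, integral_add i4 i3, h0, h1]
    ring
  obtain ⟨m₀, hm₀, hm₀K⟩ : ∃ m₀ : ℝ, 0 < m₀ ∧ ∀ z ∈ K', m₀ ≤ r z := by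
    rcases K'.eq_empty_or_nonempty with h | h
    · exact ⟨1, one_pos, by simp [h]⟩
    · obtain ⟨z, hz, hmin⟩ := hK'.exists_isMinOn h (hr.mono hK'U)
      exact ⟨r z, hpos z (hK'U hz), fun y hy => hmin hy⟩
  obtain ⟨M₀, hM₀⟩ := hK'.exists_bound_of_continuousOn (hr.mono hK'U)
  -- Bounds for the convex combination, shifted by `1`. Mollification preserves them, and the lower
  -- bound `min 1 m₀` is positive.
  have hfI : ∀ z, f z ∈ Icc (min 1 m₀ - 1) (max 1 M₀ - 1) := by
    intro z
    by_cases hz : z ∈ K'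
    · have h1 := hm₀K z hz
      have h2 := (le_abs_self _).trans (hM₀ z hz)
      obtain ⟨h3, h4⟩ := hχI z
      have h5 : min 1 m₀ ≤ 1 := min_le_left _ _
      have h6 : min 1 m₀ ≤ m₀ := min_le_right _ _
      have h7 : 1 ≤ max 1 M₀ := le_max_left _ _
      have h8 : M₀ ≤ max 1 M₀ := le_max_right _ _
      constructor
      · simp only [hf]
        nlinarith
      · simp only [hf]
        nlinarith
    · simp [hf, hχ0 z hz]
  have hfl : LocallyIntegrable f := hfc.locallyIntegrable
  obtain ⟨C₁, hC₁⟩ := hbd K' hK'U hK'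
  obtain ⟨C₂, hC₂⟩ : ∃ C, ∀ i z, |dχ i z * (r z - 1)| ≤ C := by
    have h1 : ∀ i, ∃ C, ∀ z, |dχ i z * (r z - 1)| ≤ C := fun i =>
      (hqs i).exists_bound_of_continuous (hqc i)
    choose C hC using h1
    refine ⟨∑ i, |C i|, fun i z => (hC i z).trans ((le_abs_self _).trans ?_)⟩
    exact Finset.single_le_sum (f := fun i => |C i|) (fun i _ => abs_nonneg _) (Finset.mem_univ i)
  have hqI : ∀ i, ∀ᵐ z, q i z ∈ Icc (-(|C₁| + C₂)) (|C₁| + C₂) := by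
    intro i
    filter_upwards [hC₁] with z hz
    rw [mem_Icc, ← abs_le]
    refine (abs_add_le _ _).trans (add_le_add ?_ (hC₂ i z))
    by_cases hzK : z ∈ K'
    · rw [abs_mul]
      obtain ⟨h3, h4⟩ := hχI z
      rw [abs_of_nonneg h3]
      exact (mul_le_of_le_one_right (abs_nonneg _) h4).trans ((hz hzK i).trans (le_abs_self _))
    · simp [hχ0 z hzK]
  -- As `χ = 1` near `K`, the weak derivative `q` of the cut-off function coincides with `p` on `K`.
  have hχK : ∀ z ∈ K, χ z = 1 ∧ ∀ i, dχ i z = 0 := by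
    intro z hz
    have h1 : χ =ᶠ[𝓝 z] fun _ => 1 := hχ1.filter_mono (nhds_le_nhdsSet hz)
    refine ⟨h1.eq_of_nhds, fun i => ?_⟩
    change fderiv ℝ χ z (e i) = 0
    rw [h1.fderiv_eq]
    simp
  have hfd : ∀ k z i, fderiv ℝ (fun y => 1 + mollify k f y) z (e i) = mollify k (q i) z := by
    intro k z i
    rw [fderiv_const_add]
    exact fderiv_mollify k hfl (hweakq i) z
  refine ⟨fun k z => 1 + mollify k f z, min 1 m₀, max 1 M₀, |C₁| + C₂, lt_min one_pos hm₀,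
    fun k => contDiff_const.add (contDiff_mollify k hfl), fun k z => ?_, fun z hz => ?_,
    fun k z i => ?_, ?_⟩
  · have := mollify_mem_Icc k hfl (Eventually.of_forall hfI) z
    exact ⟨by linarith [this.1], by linarith [this.2]⟩
  · have := (tendsto_mollify_of_continuous hfc z).const_add 1
    simpa [hf, (hχK z hz).1] using this
  · rw [hfd, abs_le]
    exact mollify_mem_Icc k (hqi i).locallyIntegrable (hqI i) z
  · have h1 : ∀ᵐ z, ∀ i, Tendsto (fun k => mollify k (q i) z) atTop (𝓝 (q i z)) :=
      ae_all_iff.2 fun i => ae_tendsto_mollify (hqi i).locallyIntegrable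
    filter_upwards [h1] with z hz hzK i
    have h2 := hz i
    simp only [hq, (hχK z hzK).1, (hχK z hzK).2 i, mul_one, zero_mul, add_zero] at h2
    exact h2.congr fun k => (hfd k z i).symm

end Mollification

/-! ### Extension by zero from a chart, and weak gradients in coordinates -/

section LocalApproximation

open Filter Topology

variable {n : ℕ} {M : Type*} [TopologicalSpace M]
  [ChartedSpace (EuclideanSpace ℝ (Fin n)) M] [IsManifold (𝓡 n) ∞ M]

omit [IsManifold (𝓡 n) ∞ M] in
theorem contMDiff_mul_of_tsupport_subset {h f : M → ℝ} {s : Set M}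
    (hh : ContMDiff (𝓡 n) 𝓘(ℝ, ℝ) ∞ h) (hs : tsupport h ⊆ s)
    (hf : ∀ x ∈ s, ContMDiffAt (𝓡 n) 𝓘(ℝ, ℝ) ∞ f x) :
    ContMDiff (𝓡 n) 𝓘(ℝ, ℝ) ∞ fun x => h x * f x := by
  intro x
  by_cases hx : x ∈ tsupport h
  · exact (hh x).mul (hf x (hs hx))
  · refine (contMDiffAt_const (c := (0 : ℝ))).congr_of_eventuallyEq ?_
    filter_upwards [(isClosed_tsupport h).isOpen_compl.mem_nhds hx] with y hy
    rw [image_eq_zero_of_notMem_tsupport hy, zero_mul]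

theorem isSmoothVectorField_smul_of_tsupport_subset {h : M → ℝ} {s : Set M}
    {X : (x : M) → TangentSpace (𝓡 n) x}
    (hh : ContMDiff (𝓡 n) 𝓘(ℝ, ℝ) ∞ h) (hs : tsupport h ⊆ s)
    (hX : ∀ x ∈ s, SmoothFieldAt X x) : IsSmoothVectorField fun x => h x • X x := by
  refine isSmoothVectorField_of_smoothFieldAt fun x => ?_
  by_cases hx : x ∈ tsupport h
  · exact (hX x (hs hx)).smul (hh x)
  · refine (smoothFieldAt_zero x).congr ?_
    filter_upwards [(isClosed_tsupport h).isOpen_compl.mem_nhds hx] with y hy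
    rw [image_eq_zero_of_notMem_tsupport hy, zero_smul]

omit [IsManifold (𝓡 n) ∞ M] in
theorem fieldSupport_smul_subset (h : M → ℝ) (X : (x : M) → TangentSpace (𝓡 n) x) :
    fieldSupport (fun x => h x • X x) ⊆ tsupport h :=
  closure_mono fun x hx h0 => hx (by simp only [h0, zero_smul])

theorem divergence_eq_zero_of_eventually (g : SmoothMetric n M)
    {X : (x : M) → TangentSpace (𝓡 n) x} {x : M} (h : ∀ᶠ y in 𝓝 x, X y = 0) :
    divergence g X x = 0 := by
  rw [divergence_congr g (smoothFieldAt_zero x) h, divergence_eq_trace_self g (smoothFieldAt_zero x)]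
  have : flux g (fun x : M => (0 : TangentSpace (𝓡 n) x)) x = fun _ => 0 := by
    ext z : 1
    simp [flux, coordField]
  rw [this]
  simp

open Classical in
/-- The extension by zero of a function on the target of the chart at `x₀` to the manifold. -/
def chartExtend (x₀ : M) (F : Coord n → ℝ) (x : M) : ℝ :=
  if x ∈ (chartAt (Coord n) x₀).source then F (chartAt (Coord n) x₀ x) else 0

omit [IsManifold (𝓡 n) ∞ M] in
theorem chartExtend_of_mem {x₀ x : M} (F : Coord n → ℝ)
    (hx : x ∈ (chartAt (Coord n) x₀).source) :
    chartExtend x₀ F x = F (chartAt (Coord n) x₀ x) :=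
  if_pos hx

omit [IsManifold (𝓡 n) ∞ M] in
theorem chartExtend_eq_zero {x₀ x : M} {F : Coord n → ℝ} {K : Set (Coord n)}
    (hF : ∀ z ∉ K, F z = 0) (hx : x ∉ (chartAt (Coord n) x₀).symm '' K) :
    chartExtend x₀ F x = 0 := by
  by_cases hs : x ∈ (chartAt (Coord n) x₀).source
  · rw [chartExtend_of_mem F hs]
    exact hF _ fun h => hx ⟨_, h, (chartAt (Coord n) x₀).left_inv hs⟩
  · exact if_neg hs

variable [T2Space M]

omit [IsManifold (𝓡 n) ∞ M] in
theorem tsupport_chartExtend_subset {x₀ : M} {F : Coord n → ℝ} {K : Set (Coord n)}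
    (hK : IsCompact K) (hKt : K ⊆ (chartAt (Coord n) x₀).target) (hF : ∀ z ∉ K, F z = 0) :
    IsCompact ((chartAt (Coord n) x₀).symm '' K) ∧
      tsupport (chartExtend x₀ F) ⊆ (chartAt (Coord n) x₀).symm '' K := by
  have hc := hK.image_of_continuousOn ((chartAt (Coord n) x₀).continuousOn_symm.mono hKt)
  exact ⟨hc, closure_minimal (fun x hx => by_contra fun h => hx (chartExtend_eq_zero hF h))
    hc.isClosed⟩

theorem contMDiff_chartExtend {x₀ : M} {F : Coord n → ℝ} {K : Set (Coord n)}
    (hK : IsCompact K) (hKt : K ⊆ (chartAt (Coord n) x₀).target) (hF : ∀ z ∉ K, F z = 0)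
    (hFs : ContDiffOn ℝ ∞ F (chartAt (Coord n) x₀).target) :
    ContMDiff (𝓡 n) 𝓘(ℝ, ℝ) ∞ (chartExtend x₀ F) := by
  intro x
  by_cases hx : x ∈ (chartAt (Coord n) x₀).source
  · have h1 : ContMDiffAt (𝓡 n) 𝓘(ℝ, ℝ) ∞ (fun y => F (chartAt (Coord n) x₀ y)) x :=
      contMDiffAt_comp_chart hx (hFs.contDiffAt ((chartAt (Coord n) x₀).open_target.mem_nhds
        ((chartAt (Coord n) x₀).map_source hx)))
    refine h1.congr_of_eventuallyEq ?_
    filter_upwards [(chartAt (Coord n) x₀).open_source.mem_nhds hx] with y hy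
    exact chartExtend_of_mem F hy
  · obtain ⟨hc, hs⟩ := tsupport_chartExtend_subset hK hKt hF
    refine (contMDiffAt_const (c := (0 : ℝ))).congr_of_eventuallyEq ?_
    have hx' : x ∉ (chartAt (Coord n) x₀).symm '' K := by
      rintro ⟨z, hz, rfl⟩
      exact hx ((chartAt (Coord n) x₀).map_target (hKt hz))
    filter_upwards [hc.isClosed.isOpen_compl.mem_nhds hx'] with y hy
    exact chartExtend_eq_zero hF hy

variable [MeasurableSpace M] [BorelSpace M]

/-- A weak gradient in the coordinates of a chart. -/
theorem HasWeakGradientOn.coord {g : SmoothMetric n M} {Ω : Set M} {ρ : M → ℝ}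
    {G : (x : M) → TangentSpace (𝓡 n) x} (hG : HasWeakGradientOn g Ω ρ G) (hρ : Continuous ρ)
    (x₀ : M) (i : Fin n) {η : Coord n → ℝ} (hη : ContDiff ℝ ∞ η) (hηc : HasCompactSupport η)
    (hηs : tsupport η ⊆ (chartAt (Coord n) x₀).target ∩ (chartAt (Coord n) x₀).symm ⁻¹' Ω) :
    Integrable (fun z => g.inner ((chartAt (Coord n) x₀).symm z) (G ((chartAt (Coord n) x₀).symm z))
      (frame x₀ _ (EuclideanSpace.single i (1 : ℝ))) * η z) ∧
    ∫ z, ρ ((chartAt (Coord n) x₀).symm z) * fderiv ℝ η z (EuclideanSpace.single i (1 : ℝ)) =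
      -∫ z, g.inner ((chartAt (Coord n) x₀).symm z) (G ((chartAt (Coord n) x₀).symm z))
        (frame x₀ _ (EuclideanSpace.single i (1 : ℝ))) * η z := by
  set e := chartAt (Coord n) x₀ with he
  set b : Coord n := EuclideanSpace.single i (1 : ℝ) with hb
  -- The test field is `h ∂ᵢ` with `h = η / √(det g)`. Dividing by the density makes the flux equal
  -- to `η ∂ᵢ`, so the weak formulation on `M` becomes the Euclidean one with test function `η`.
  set F : Coord n → ℝ := fun z => η z * (volDensity g x₀ z)⁻¹ with hF
  have hηt : tsupport η ⊆ e.target := fun z hz => (hηs hz).1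
  have hη0 : ∀ z ∉ tsupport η, η z = 0 := fun z hz => image_eq_zero_of_notMem_tsupport hz
  have hF0 : ∀ z ∉ tsupport η, F z = 0 := fun z hz => by simp only [hF, hη0 z hz, zero_mul]
  have hFs : ContDiffOn ℝ ∞ F e.target := hη.contDiffOn.mul
    ((contDiffOn_volDensity g x₀).inv fun z hz => (volDensity_pos g hz).ne')
  obtain ⟨hcK, hsub⟩ := tsupport_chartExtend_subset hηc hηt hF0
  have hhs := contMDiff_chartExtend hηc hηt hF0 hFs
  set h : M → ℝ := chartExtend x₀ F with hh
  have himg : e.symm '' tsupport η ⊆ e.source := by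
    rintro _ ⟨z, hz, rfl⟩
    exact e.map_target (hηt hz)
  have hX : IsSmoothVectorField fun x => h x • frame x₀ x b :=
    isSmoothVectorField_smul_of_tsupport_subset hhs (hsub.trans himg) fun x hx =>
      (contMDiffOn_frame x₀ b).contMDiffAt (e.open_source.mem_nhds hx)
  have hfs : fieldSupport (fun x => h x • frame x₀ x b) ⊆ e.symm '' tsupport η :=
    (fieldSupport_smul_subset _ _).trans hsub
  have hfc : IsCompact (fieldSupport fun x => h x • frame x₀ x b) :=
    hcK.of_isClosed_subset isClosed_closure hfs
  have hfΩ : fieldSupport (fun x => h x • frame x₀ x b) ⊆ Ω := by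
    refine hfs.trans ?_
    rintro _ ⟨z, hz, rfl⟩
    exact (hηs hz).2
  obtain ⟨hint, heq⟩ := hG.2 _ hX hfc hfΩ
  have hh0 : ∀ x, x ∉ e.source → h x = 0 := fun x hx => if_neg hx
  have hdiv0 : ∀ x, x ∉ e.source → divergence g (fun x => h x • frame x₀ x b) x = 0 := by
    intro x hx
    refine divergence_eq_zero_of_eventually g ?_
    filter_upwards [hcK.isClosed.isOpen_compl.mem_nhds fun hx' => hx (himg hx')] with y hy
    simp only [hh, chartExtend_eq_zero hF0 hy, zero_smul]
  have hhz : ∀ z ∈ e.target, volDensity g x₀ z * h (e.symm z) = η z := by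
    intro z hz
    rw [hh, chartExtend_of_mem F (e.map_target hz), ← he, e.right_inv hz]
    have := (volDensity_pos g hz).ne'
    simp only [hF]
    field_simp
  have hdivz : ∀ z ∈ e.target,
      volDensity g x₀ z * divergence g (fun x => h x • frame x₀ x b) (e.symm z) =
        fderiv ℝ η z b := by
    intro z hz
    rw [divergence_eq_trace g (e.map_target hz) (hX _), ← he, e.right_inv hz,
      mul_inv_cancel_left₀ (volDensity_pos g hz).ne']
    have h1 : flux g (fun x => h x • frame x₀ x b) x₀ =ᶠ[𝓝 z] fun z => η z • b := by
      filter_upwards [e.open_target.mem_nhds hz] with y hy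
      rw [flux, coordField, ← he, map_smul, toCoord_frame (e.map_target hy), smul_smul, hhz y hy]
    rw [h1.fderiv_eq, fderiv_smul_const (hη.differentiable (by simp) z), trace_smulRight]
  have hcont : Continuous fun x => ρ x * divergence g (fun x => h x • frame x₀ x b) x := by
    refine hρ.mul ?_
    rw [← continuousOn_univ]
    exact continuousOn_divergence g (fun x _ => hX x) isOpen_univ
  obtain ⟨-, e1⟩ := integrable_chart_iff g (x₀ := x₀)
    (f := fun x => ρ x * divergence g (fun x => h x • frame x₀ x b) x)
    hcont.aestronglyMeasurable (fun x hx => by simp only [hdiv0 x hx, mul_zero])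
  obtain ⟨e2, e3⟩ := integrable_chart_iff g (x₀ := x₀) hint.aestronglyMeasurable
    (fun x hx => by simp only [hh0 x hx, zero_smul, map_zero])
  have e4 : ∀ z ∈ e.target, volDensity g x₀ z * g.inner (e.symm z) (G (e.symm z))
      (h (e.symm z) • frame x₀ (e.symm z) b) =
      g.inner (e.symm z) (G (e.symm z)) (frame x₀ _ b) * η z := by
    intro z hz
    rw [map_smul, smul_eq_mul, ← hhz z hz]
    ring
  have e5 : ∀ z ∈ e.target, volDensity g x₀ z * (ρ (e.symm z) *
      divergence g (fun x => h x • frame x₀ x b) (e.symm z)) =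
      ρ (e.symm z) * fderiv ℝ η z b := by
    intro z hz
    rw [← hdivz z hz]
    ring
  have s1 : ∀ z, z ∉ e.target → g.inner (e.symm z) (G (e.symm z)) (frame x₀ _ b) * η z = 0 :=
    fun z hz => by rw [hη0 z fun h => hz (hηt h), mul_zero]
  have s2 : ∀ z, z ∉ e.target → ρ (e.symm z) * fderiv ℝ η z b = 0 := fun z hz => by
    rw [image_eq_zero_of_notMem_tsupport (f := fun z => fderiv ℝ η z b)
      fun h => hz (hηt (tsupport_fderiv_apply_subset ℝ b h)), mul_zero]
  constructor
  · have := e2.1 hint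
    rw [← integrableOn_iff_integrable_of_support_subset (s := e.target)
      fun z hz => by_contra fun h => hz (s1 z h)]
    exact this.congr_fun (fun z hz => e4 z hz) e.open_target.measurableSet
  · rw [← setIntegral_eq_integral_of_forall_compl_eq_zero s1,
      ← setIntegral_eq_integral_of_forall_compl_eq_zero s2]
    rw [e1, e3] at heq
    rw [← setIntegral_congr_fun e.open_target.measurableSet e4,
      ← setIntegral_congr_fun e.open_target.measurableSet e5]
    exact heq

end LocalApproximation

/-! ### Smooth approximation of `ρ` on compact subsets of a chart domain -/

section ManifoldApproximation

open Filter Topology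

variable {n : ℕ} {M : Type*} [TopologicalSpace M]
  [ChartedSpace (EuclideanSpace ℝ (Fin n)) M] [IsManifold (𝓡 n) ∞ M]

theorem sum_toCoord_smul_frame {x₀ x : M} (hx : x ∈ (chartAt (Coord n) x₀).source)
    (v : TangentSpace (𝓡 n) x) :
    ∑ i, toCoord x₀ x v i • frame x₀ x (EuclideanSpace.single i (1 : ℝ)) = v := by
  conv_rhs => rw [← frame_toCoord hx v, coord_eq_sum_single (toCoord x₀ x v)]
  simp only [map_sum, map_smul]

theorem metricNorm_frame (g : SmoothMetric n M) {x₀ x : M}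
    (hx : x ∈ (chartAt (Coord n) x₀).source) (i : Fin n) :
    metricNorm g x (frame x₀ x (EuclideanSpace.single i (1 : ℝ))) =
      √(gram g x₀ (chartAt (Coord n) x₀ x) i i) := by
  rw [metricNorm, gram_chart_apply g hx]

/-- On a compact set the components of a tangent vector are controlled by its norm. -/
theorem exists_abs_toCoord_le (g : SmoothMetric n M) {x₀ : M} {K : Set M} (hK : IsCompact K)
    (hKs : K ⊆ (chartAt (Coord n) x₀).source) :
    ∃ C, ∀ x ∈ K, ∀ (v : TangentSpace (𝓡 n) x) (i : Fin n),
      |toCoord x₀ x v i| ≤ C * metricNorm g x v := by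
  set e := chartAt (Coord n) x₀
  have hc : ∀ i j, ContinuousOn (fun z => |(gram g x₀ z)⁻¹ i j| * √(gram g x₀ z j j)) e.target :=
    fun i j => ((contDiffOn_matrix_inv (contDiffOn_gram g x₀)
      (fun z hz => (gram_det_pos g hz).ne') i j).continuousOn.abs).mul
      (contDiffOn_gram g x₀ j j).continuousOn.sqrt
  have hc' : ContinuousOn (fun x => ∑ i, ∑ j,
      |(gram g x₀ (e x))⁻¹ i j| * √(gram g x₀ (e x) j j)) K :=
    continuousOn_finsetSum _ fun i _ => continuousOn_finsetSum _ fun j _ =>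
      (hc i j).comp (e.continuousOn.mono hKs) fun x hx => e.map_source (hKs hx)
  obtain ⟨C, hC⟩ := hK.exists_bound_of_continuousOn hc'
  refine ⟨C, fun x hx v i => ?_⟩
  -- The components are obtained from the scalar products with the frame through the inverse metric.
  -- Cauchy–Schwarz bounds these products, and the metric coefficients are bounded on `K`.
  rw [toCoord_eq_inv_gram g (hKs hx)]
  have h0 : ∀ i j, 0 ≤ |(gram g x₀ (e x))⁻¹ i j| * √(gram g x₀ (e x) j j) := fun i j => by
    positivity
  calc |∑ j, (gram g x₀ (e x))⁻¹ i j *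
        g.inner x v (frame x₀ x (EuclideanSpace.single j (1 : ℝ)))|
      ≤ ∑ j, |(gram g x₀ (e x))⁻¹ i j *
        g.inner x v (frame x₀ x (EuclideanSpace.single j (1 : ℝ)))| :=
        Finset.abs_sum_le_sum_abs _ _
    _ ≤ ∑ j, |(gram g x₀ (e x))⁻¹ i j| * √(gram g x₀ (e x) j j) * metricNorm g x v := by
        refine Finset.sum_le_sum fun j _ => ?_
        rw [abs_mul, mul_assoc, mul_comm (√_), ← metricNorm_frame g (hKs hx)]
        exact mul_le_mul_of_nonneg_left (abs_inner_le g x v _) (abs_nonneg _)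
    _ = (∑ j, |(gram g x₀ (e x))⁻¹ i j| * √(gram g x₀ (e x) j j)) * metricNorm g x v := by
        rw [Finset.sum_mul]
    _ ≤ C * metricNorm g x v := by
        refine mul_le_mul_of_nonneg_right ?_ (metricNorm_nonneg g x v)
        refine le_trans ?_ ((le_abs_self _).trans (hC x hx))
        exact Finset.single_le_sum (f := fun i => ∑ j,
          |(gram g x₀ (e x))⁻¹ i j| * √(gram g x₀ (e x) j j))
          (fun i _ => Finset.sum_nonneg fun j _ => h0 i j) (Finset.mem_univ i)

variable [T2Space M] [MeasurableSpace M] [BorelSpace M]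

/-- Local approximation of a function with a locally bounded weak gradient by smooth functions. -/
theorem HasWeakGradientOn.exists_approximation {g : SmoothMetric n M} {Ω : Set M} {ρ : M → ℝ}
    {G : (x : M) → TangentSpace (𝓡 n) x} (hG : HasWeakGradientOn g Ω ρ G) (hρ : Continuous ρ)
    (hΩ : IsOpen Ω) (hpos : ∀ x ∈ Ω, 0 < ρ x) {b : M → ℝ} (hb : Continuous b)
    (hGb : ∀ᵐ x ∂(riemannianVolume g), x ∈ Ω → metricNorm g x (G x) ≤ b x)
    {x₀ : M} {K : Set M} (hK : IsCompact K) (hKs : K ⊆ (chartAt (Coord n) x₀).source)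
    (hKΩ : K ⊆ Ω) :
    ∃ (R : ℕ → M → ℝ) (m B C : ℝ), 0 < m ∧ 0 ≤ C ∧
      (∀ k, ∀ x ∈ (chartAt (Coord n) x₀).source, ContMDiffAt (𝓡 n) 𝓘(ℝ, ℝ) ∞ (R k) x) ∧
      (∀ k x, R k x ∈ Icc m B) ∧ (∀ x ∈ K, Tendsto (fun k => R k x) atTop (𝓝 (ρ x))) ∧
      (∀ k, ∀ x ∈ K, ∀ v : TangentSpace (𝓡 n) x,
        |differential (R k) x v| ≤ C * metricNorm g x v) ∧
      ∀ᵐ x ∂(riemannianVolume g), x ∈ K → ∀ v : TangentSpace (𝓡 n) x,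
        Tendsto (fun k => differential (R k) x v) atTop (𝓝 (g.inner x (G x) v)) := by
  set e := chartAt (Coord n) x₀ with he
  set U : Set (Coord n) := e.target ∩ e.symm ⁻¹' Ω with hU
  have hUo : IsOpen U := e.isOpen_inter_preimage_symm hΩ
  set p : Fin n → Coord n → ℝ := fun i z => g.inner (e.symm z) (G (e.symm z))
      (frame x₀ _ (EuclideanSpace.single i (1 : ℝ))) with hp
  have hr : ContinuousOn (fun z => ρ (e.symm z)) U :=
    hρ.comp_continuousOn (e.continuousOn_symm.mono inter_subset_left)
  have hKim : IsCompact (e '' K) := hK.image_of_continuousOn (e.continuousOn.mono hKs)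
  have hKU : e '' K ⊆ U := by
    rintro _ ⟨x, hx, rfl⟩
    refine ⟨e.map_source (hKs hx), ?_⟩
    rw [mem_preimage, e.left_inv (hKs hx)]
    exact hKΩ hx
  -- By Cauchy–Schwarz, `|pᵢ| ≤ |G| |∂ᵢ| ≤ b √g_{ii}`, which is bounded on compact sets. Summing
  -- over `i` gives one bound for all indices.
  have hbd : ∀ L ⊆ U, IsCompact L → ∃ C, ∀ᵐ z, z ∈ L → ∀ i, |p i z| ≤ C := by
    intro L hL hLc
    have hc : ContinuousOn (fun z => ∑ i, b (e.symm z) * √(gram g x₀ z i i)) L :=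
      continuousOn_finsetSum _ fun i _ =>
        (hb.comp_continuousOn (e.continuousOn_symm.mono fun z hz => (hL hz).1)).mul
        ((contDiffOn_gram g x₀ i i).continuousOn.mono fun z hz => (hL hz).1).sqrt
    obtain ⟨C, hC⟩ := hLc.exists_bound_of_continuousOn hc
    refine ⟨C, ?_⟩
    filter_upwards [ae_coord_of_ae_riemannianVolume g x₀ hGb] with z hz hzL i
    have hzt := (hL hzL).1
    have h1 := hz hzt (hL hzL).2
    have hb0 : 0 ≤ b (e.symm z) := (metricNorm_nonneg g _ _).trans h1
    have h2 := metricNorm_frame g (e.map_target hzt) i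
    rw [← he, e.right_inv hzt] at h2
    refine (abs_inner_le g _ _ _).trans ?_
    rw [h2]
    refine (mul_le_mul_of_nonneg_right h1 (Real.sqrt_nonneg _)).trans ?_
    refine le_trans ?_ ((le_abs_self _).trans (hC z hzL))
    exact Finset.single_le_sum (f := fun i => b (e.symm z) * √(gram g x₀ z i i))
      (fun i _ => mul_nonneg hb0 (Real.sqrt_nonneg _)) (Finset.mem_univ i)
  obtain ⟨r, m, B, C, hm, hrs, hrI, hrt, hrd, hrdt⟩ := exists_smooth_approximation hUo hr
    (fun z hz => hpos _ hz.2) (p := p)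
    (fun i η hη hηc hηs => (hG.coord hρ x₀ i hη hηc hηs).1)
    (fun i η hη hηc hηs => (hG.coord hρ x₀ i hη hηc hηs).2) hbd hKim hKU
  obtain ⟨C', hC'⟩ := exists_abs_toCoord_le g hK hKs
  have hRs : ∀ k, ∀ x ∈ e.source, ContMDiffAt (𝓡 n) 𝓘(ℝ, ℝ) ∞ (fun x => r k (e x)) x :=
    fun k x hx => contMDiffAt_comp_chart hx (hrs k).contDiffAt
  have hdiff : ∀ k, ∀ x ∈ e.source, ∀ v : TangentSpace (𝓡 n) x,
      differential (fun x => r k (e x)) x v =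
        ∑ i, toCoord x₀ x v i * fderiv ℝ (r k) (e x) (EuclideanSpace.single i (1 : ℝ)) := by
    intro k x hx v
    rw [differential_eq_fderiv hx ((hRs k x hx).mdifferentiableAt (by simp))]
    have h1 : (fun x => r k (e x)) ∘ e.symm =ᶠ[𝓝 (e x)] r k := by
      filter_upwards [e.open_target.mem_nhds (e.map_source hx)] with z hz
      simp only [Function.comp_apply, e.right_inv hz]
    rw [h1.fderiv_eq]
    conv_lhs => rw [coord_eq_sum_single (toCoord x₀ x v)]
    simp only [map_sum, map_smul, smul_eq_mul]
  refine ⟨fun k x => r k (e x), m, B, ∑ _i : Fin n, |C'| * |C|, hm, by positivity, hRs,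
    fun k x => hrI k _, fun x hx => ?_, fun k x hx v => ?_, ?_⟩
  · have := hrt _ (mem_image_of_mem e hx)
    simpa only [e.left_inv (hKs hx)] using this
  · rw [hdiff k x (hKs hx) v, Finset.sum_mul]
    refine (Finset.abs_sum_le_sum_abs _ _).trans (Finset.sum_le_sum fun i _ => ?_)
    rw [abs_mul, mul_right_comm]
    refine mul_le_mul ?_ ((hrd k _ i).trans (le_abs_self _)) (abs_nonneg _)
      (mul_nonneg (abs_nonneg _) (metricNorm_nonneg g x v))
    exact (hC' x hx v i).trans (mul_le_mul_of_nonneg_right (le_abs_self _)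
      (metricNorm_nonneg g x v))
  · filter_upwards [ae_riemannianVolume_of_ae_coord g x₀ hrdt] with x hx hxK v
    have h1 := hx (hKs hxK) (mem_image_of_mem e hxK)
    have h3 : ∀ i, p i (e x) =
        g.inner x (G x) (frame x₀ x (EuclideanSpace.single i (1 : ℝ))) := fun i => by
      simp only [hp]
      rw [e.left_inv (hKs hxK)]
    have h2 : g.inner x (G x) v = ∑ i, toCoord x₀ x v i * p i (e x) := by
      conv_lhs => rw [← sum_toCoord_smul_frame (hKs hxK) v]
      simp only [map_sum, map_smul, smul_eq_mul, h3]
    rw [h2]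
    refine (tendsto_finsetSum _ fun i _ => (h1 i).const_mul (toCoord x₀ x v i)).congr fun k => ?_
    exact (hdiff k x (hKs hxK) v).symm

end ManifoldApproximation

/-! ### Smooth multiples of fields, integrability, and the chain rule for weak gradients -/

section WeakCalculus

open Filter Topology

variable {n : ℕ} {M : Type*} [TopologicalSpace M]
  [ChartedSpace (EuclideanSpace ℝ (Fin n)) M] [IsManifold (𝓡 n) ∞ M]

theorem IsSmoothVectorField.continuous_divergence {X : (x : M) → TangentSpace (𝓡 n) x}
    (hX : IsSmoothVectorField X) (g : SmoothMetric n M) : Continuous (divergence g X) := by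
  rw [← continuousOn_univ]
  exact continuousOn_divergence g (fun x _ => hX x) isOpen_univ

theorem IsSmoothVectorField.continuous_metricNorm {X : (x : M) → TangentSpace (𝓡 n) x}
    (hX : IsSmoothVectorField X) (g : SmoothMetric n M) :
    Continuous fun x => metricNorm g x (X x) :=
  Real.continuous_sqrt.comp (continuous_iff_continuousAt.2 fun x =>
    (hX.smoothFieldAt x).continuousAt_inner g (hX.smoothFieldAt x))

omit [IsManifold (𝓡 n) ∞ M] in
theorem eventually_eq_zero_of_notMem_fieldSupport {X : (x : M) → TangentSpace (𝓡 n) x} {x : M}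
    (hx : x ∉ fieldSupport X) : ∀ᶠ y in 𝓝 x, X y = 0 := by
  filter_upwards [isClosed_closure.isOpen_compl.mem_nhds hx] with y hy
  by_contra h
  exact hy (subset_closure h)

theorem isSmoothVectorField_smul_of_fieldSupport_subset {h : M → ℝ} {s : Set M}
    {X : (x : M) → TangentSpace (𝓡 n) x} (hX : IsSmoothVectorField X) (hs : fieldSupport X ⊆ s)
    (hh : ∀ x ∈ s, ContMDiffAt (𝓡 n) 𝓘(ℝ, ℝ) ∞ h x) :
    IsSmoothVectorField fun x => h x • X x := by
  refine isSmoothVectorField_of_smoothFieldAt fun x => ?_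
  by_cases hx : x ∈ fieldSupport X
  · exact (hX.smoothFieldAt x).smul (hh x (hs hx))
  · refine (smoothFieldAt_zero x).congr ?_
    filter_upwards [eventually_eq_zero_of_notMem_fieldSupport hx] with y hy
    rw [hy, smul_zero]

theorem divergence_smul_of_fieldSupport_subset (g : SmoothMetric n M) {h : M → ℝ} {s : Set M}
    {X : (x : M) → TangentSpace (𝓡 n) x} (hX : IsSmoothVectorField X) (hs : fieldSupport X ⊆ s)
    (hh : ∀ x ∈ s, ContMDiffAt (𝓡 n) 𝓘(ℝ, ℝ) ∞ h x) (x : M) :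
    divergence g (fun x => h x • X x) x = h x * divergence g X x + differential h x (X x) := by
  by_cases hx : x ∈ fieldSupport X
  · exact divergence_smul g (hh x (hs hx)) (hX x)
  · have h0 := eventually_eq_zero_of_notMem_fieldSupport hx
    rw [divergence_eq_zero_of_eventually g h0, divergence_eq_zero_of_eventually g
      (h0.mono fun y hy => by rw [hy, smul_zero]), h0.self_of_nhds, map_zero]
    simp

omit [IsManifold (𝓡 n) ∞ M] in
theorem contMDiffAt_rpow {f : M → ℝ} {x : M} (hf : ContMDiffAt (𝓡 n) 𝓘(ℝ, ℝ) ∞ f x)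
    (h0 : 0 < f x) (s : ℝ) : ContMDiffAt (𝓡 n) 𝓘(ℝ, ℝ) ∞ (fun y => f y ^ s) x :=
  ContMDiffAt.comp (I' := 𝓘(ℝ, ℝ)) (g := fun t : ℝ => t ^ s) x
    (Real.contDiffAt_rpow_const_of_ne h0.ne').contMDiffAt hf

theorem differential_rpow {f : M → ℝ} {x : M} (hf : ContMDiffAt (𝓡 n) 𝓘(ℝ, ℝ) ∞ f x)
    (h0 : 0 < f x) (s : ℝ) (v : TangentSpace (𝓡 n) x) :
    differential (fun y => f y ^ s) x v = s * f x ^ (s - 1) * differential f x v := by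
  rw [differential_comp (F := fun t : ℝ => t ^ s) hf (Real.contDiffAt_rpow_const_of_ne h0.ne'),
    (Real.hasDerivAt_rpow_const (Or.inl h0.ne')).deriv]

/-- Supplies the dominating functions below: the approximations of `ρ` take values in a fixed
interval `[m, B]` with `m > 0`, so all their powers, including negative ones, are uniformly bounded.
-/
theorem exists_rpow_bound {m B : ℝ} (hm : 0 < m) (s : ℝ) :
    ∃ A, 0 ≤ A ∧ ∀ t ∈ Icc m B, |t ^ s| ≤ A := by
  have hc : ContinuousOn (fun t : ℝ => t ^ s) (Icc m B) := fun t ht =>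
    (Real.continuousAt_rpow_const t s (Or.inl (hm.trans_le ht.1).ne')).continuousWithinAt
  obtain ⟨A, hA⟩ := isCompact_Icc.exists_bound_of_continuousOn hc
  exact ⟨|A|, abs_nonneg A, fun t ht => (hA t ht).trans (le_abs_self A)⟩

theorem grad_eq_zero_of_notMem_tsupport (g : SmoothMetric n M) {f : M → ℝ} {x : M}
    (hx : x ∉ tsupport f) : grad g f x = 0 := by
  have h : f =ᶠ[𝓝 x] fun _ => 0 := by
    filter_upwards [(isClosed_tsupport f).isOpen_compl.mem_nhds hx] with y hy
    exact image_eq_zero_of_notMem_tsupport hy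
  refine grad_eq_of_inner g fun v => ?_
  rw [differential_congr h, differential_const]
  simp

theorem fieldSupport_smul_grad_subset (g : SmoothMetric n M) (w f : M → ℝ) :
    fieldSupport (fun x => w x • grad g f x) ⊆ tsupport f :=
  closure_minimal (fun x hx => by_contra fun h => hx (by
    simp only [grad_eq_zero_of_notMem_tsupport g h, smul_zero])) (isClosed_tsupport f)

theorem isSmoothVectorField_smul_grad (g : SmoothMetric n M) {w f : M → ℝ}
    (hw : ContMDiff (𝓡 n) 𝓘(ℝ, ℝ) ∞ w) (hf : ContMDiff (𝓡 n) 𝓘(ℝ, ℝ) ∞ f) :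
    IsSmoothVectorField fun x => w x • grad g f x :=
  isSmoothVectorField_of_smoothFieldAt fun x =>
    ((isSmoothVectorField_grad g hf).smoothFieldAt x).smul (hw x)

variable [T2Space M] [MeasurableSpace M] [BorelSpace M]

theorem integrable_of_continuousOn_compact (g : SmoothMetric n M) {f : M → ℝ} {K : Set M}
    (hK : IsCompact K) (hf : ContinuousOn f K) (h0 : ∀ x ∉ K, f x = 0) :
    Integrable f (riemannianVolume g) := by
  rw [← integrableOn_iff_integrable_of_support_subset (s := K)
    fun x hx => by_contra fun h => hx (h0 x h)]
  exact hf.integrableOn_compact hK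

theorem integrable_continuousOn_mul (g : SmoothMetric n M) {f q : M → ℝ} {K : Set M}
    (hK : IsCompact K) (hf : ContinuousOn f K) (hq : Integrable q (riemannianVolume g))
    (h0 : ∀ x ∉ K, q x = 0) : Integrable (fun x => f x * q x) (riemannianVolume g) := by
  rw [← integrableOn_iff_integrable_of_support_subset (s := K)
    fun x hx => by_contra fun h => hx (by simp only [h0 x h, mul_zero])]
  exact hq.integrableOn.continuousOn_mul hf hK

/-- The chain rule `∇ρ^s = s ρ^{s-1} ∇ρ` for weak gradients, tested in the domain of a chart. -/
theorem HasWeakGradientOn.integral_rpow_mul_divergence {g : SmoothMetric n M} {Ω : Set M}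
    {ρ : M → ℝ} {G : (x : M) → TangentSpace (𝓡 n) x} (hG : HasWeakGradientOn g Ω ρ G)
    (hρ : Continuous ρ) (hΩ : IsOpen Ω) (hpos : ∀ x ∈ Ω, 0 < ρ x) {b : M → ℝ} (hb : Continuous b)
    (hGb : ∀ᵐ x ∂(riemannianVolume g), x ∈ Ω → metricNorm g x (G x) ≤ b x)
    {x₀ : M} {X : (x : M) → TangentSpace (𝓡 n) x} (hX : IsSmoothVectorField X)
    (hXc : IsCompact (fieldSupport X)) (hXs : fieldSupport X ⊆ (chartAt (Coord n) x₀).source)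
    (hXΩ : fieldSupport X ⊆ Ω) (s : ℝ) :
    ∫ x, ρ x ^ s * divergence g X x ∂(riemannianVolume g) =
      -(s * ∫ x, ρ x ^ (s - 1) * g.inner x (G x) (X x) ∂(riemannianVolume g)) := by
  set K := fieldSupport X with hKdef
  obtain ⟨R, m, B, C, hm, hC0, hRs, hRI, hRt, hRd, hRdt⟩ :=
    hG.exists_approximation hρ hΩ hpos hb hGb hXc hXs hXΩ
  have hRpos : ∀ k x, 0 < R k x := fun k x => hm.trans_le (hRI k x).1
  have hX0 : ∀ x ∉ K, X x = 0 := fun x hx =>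
    (eventually_eq_zero_of_notMem_fieldSupport hx).self_of_nhds
  have hdiv0 : ∀ x ∉ K, divergence g X x = 0 := fun x hx =>
    divergence_eq_zero_of_eventually g (eventually_eq_zero_of_notMem_fieldSupport hx)
  have hpw : ∀ k, ∀ x ∈ (chartAt (Coord n) x₀).source,
      ContMDiffAt (𝓡 n) 𝓘(ℝ, ℝ) ∞ (fun y => R k y ^ (s - 1)) x := fun k x hx =>
    contMDiffAt_rpow (hRs k x hx) (hRpos k x) _
  -- The weak gradient of `ρ` is tested with `R_k^{s-1} X`. Only the multiplier is smoothed, while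
  -- `ρ` itself stays in the identity and supplies the missing power in the limit.
  have hY : ∀ k, IsSmoothVectorField fun x => R k x ^ (s - 1) • X x := fun k =>
    isSmoothVectorField_smul_of_fieldSupport_subset hX hXs (hpw k)
  have hYsub : ∀ k, fieldSupport (fun x => R k x ^ (s - 1) • X x) ⊆ K := fun k =>
    closure_mono fun x hx h0 => hx (by simp only [h0, smul_zero])
  have hYdiv : ∀ k x, divergence g (fun x => R k x ^ (s - 1) • X x) x =
      R k x ^ (s - 1) * divergence g X x +
        (s - 1) * R k x ^ (s - 1 - 1) * differential (R k) x (X x) := by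
    intro k x
    rw [divergence_smul_of_fieldSupport_subset g hX hXs (hpw k)]
    by_cases hx : x ∈ K
    · rw [differential_rpow (hRs k x (hXs hx)) (hRpos k x)]
    · simp only [hX0 x hx, map_zero, mul_zero]
  have hYw := fun k => hG.2 _ (hY k) (hXc.of_isClosed_subset isClosed_closure (hYsub k))
    ((hYsub k).trans hXΩ)
  have hGX := (hG.2 X hX hXc hXΩ).1
  have hGX0 : ∀ x ∉ K, g.inner x (G x) (X x) = 0 := fun x hx => by rw [hX0 x hx, map_zero]
  have hKpos : ∀ x ∈ K, 0 < ρ x := fun x hx => hpos x (hXΩ hx)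
  have hρc : ∀ t : ℝ, ContinuousOn (fun x => ρ x ^ t) K := fun t =>
    hρ.continuousOn.rpow_const fun x hx => Or.inl (hKpos x hx).ne'
  obtain ⟨A₁, hA₁0, hA₁⟩ := exists_rpow_bound (B := B) hm (s - 1)
  obtain ⟨A₂, hA₂0, hA₂⟩ := exists_rpow_bound (B := B) hm (s - 1 - 1)
  obtain ⟨D, hD⟩ := hXc.exists_bound_of_continuousOn (hX.continuous_divergence g).continuousOn
  obtain ⟨N, hN⟩ := hXc.exists_bound_of_continuousOn (hX.continuous_metricNorm g).continuousOn
  obtain ⟨P, hP⟩ := hXc.exists_bound_of_continuousOn hρ.continuousOn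
  have hRpow : ∀ t : ℝ, ∀ x ∈ K, Tendsto (fun k => R k x ^ t) atTop (𝓝 (ρ x ^ t)) :=
    fun t x hx => (hRt x hx).rpow_const (Or.inl (hKpos x hx).ne')
  have lim1 : Tendsto (fun k => ∫ x, ρ x * divergence g (fun x => R k x ^ (s - 1) • X x) x
      ∂(riemannianVolume g)) atTop (𝓝 (∫ x, ρ x * (ρ x ^ (s - 1) * divergence g X x +
        (s - 1) * ρ x ^ (s - 1 - 1) * g.inner x (G x) (X x)) ∂(riemannianVolume g))) := by
    refine tendsto_integral_of_dominated_convergence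
      (K.indicator fun _ => P * (A₁ * D + |s - 1| * A₂ * (C * N))) (fun k => ?_) ?_ (fun k => ?_) ?_
    · exact (hρ.mul ((hY k).continuous_divergence g)).aestronglyMeasurable
    · exact (integrable_indicator_iff hXc.measurableSet).2 (integrableOn_const hXc.measure_lt_top.ne)
    · refine Eventually.of_forall fun x => ?_
      rw [hYdiv]
      by_cases hx : x ∈ K
      · rw [indicator_of_mem hx, norm_mul]
        have hNx := (le_abs_self _).trans (hN x hx)
        refine mul_le_mul (hP x hx) ?_ (norm_nonneg _) ((norm_nonneg _).trans (hP x hx))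
        refine (norm_add_le _ _).trans (add_le_add ?_ ?_)
        · rw [norm_mul]
          exact mul_le_mul (hA₁ _ (hRI k x)) (hD x hx) (norm_nonneg _) hA₁0
        · rw [norm_mul, norm_mul]
          refine mul_le_mul (mul_le_mul_of_nonneg_left (hA₂ _ (hRI k x)) (abs_nonneg _))
            ((hRd k x hx _).trans (mul_le_mul_of_nonneg_left hNx hC0)) (norm_nonneg _)
            (mul_nonneg (abs_nonneg _) hA₂0)
      · rw [indicator_of_notMem hx, hdiv0 x hx, hX0 x hx, map_zero]
        simp
    · filter_upwards [hRdt] with x hx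
      simp only [hYdiv]
      by_cases hxK : x ∈ K
      · exact (((hRpow _ x hxK).mul_const _).add (((hRpow _ x hxK).const_mul _).mul
          (hx hxK (X x)))).const_mul _
      · simp only [hdiv0 x hxK, hX0 x hxK, map_zero, mul_zero, add_zero]
        exact tendsto_const_nhds
  have lim2 : Tendsto (fun k => -∫ x, g.inner x (G x) (R k x ^ (s - 1) • X x)
      ∂(riemannianVolume g)) atTop
      (𝓝 (-∫ x, ρ x ^ (s - 1) * g.inner x (G x) (X x) ∂(riemannianVolume g))) := by
    refine (tendsto_integral_of_dominated_convergence (fun x => A₁ * |g.inner x (G x) (X x)|)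
      (fun k => (hYw k).1.aestronglyMeasurable) (hGX.abs.const_mul A₁) (fun k => ?_) ?_).neg
    · refine Eventually.of_forall fun x => ?_
      rw [map_smul, smul_eq_mul, norm_mul]
      exact mul_le_mul_of_nonneg_right (hA₁ _ (hRI k x)) (norm_nonneg _)
    · refine Eventually.of_forall fun x => ?_
      simp only [map_smul, smul_eq_mul]
      by_cases hx : x ∈ K
      · exact (hRpow _ x hx).mul_const _
      · simp only [hGX0 x hx, mul_zero]
        exact tendsto_const_nhds
  -- The limit reads `∫ ρ (ρ^{s-1} div X + (s-1) ρ^{s-2} ⟨G, X⟩) = -∫ ρ^{s-1} ⟨G, X⟩`; collecting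
  -- the terms in `⟨G, X⟩` leaves the factor `s`.
  have heq := tendsto_nhds_unique (lim1.congr fun k => (hYw k).2) lim2
  have hi1 : Integrable (fun x => ρ x ^ s * divergence g X x) (riemannianVolume g) :=
    integrable_of_continuousOn_compact g hXc
      ((hρc s).mul (hX.continuous_divergence g).continuousOn)
      fun x hx => by rw [hdiv0 x hx, mul_zero]
  have hi2 : Integrable (fun x => ρ x ^ (s - 1) * g.inner x (G x) (X x)) (riemannianVolume g) :=
    integrable_continuousOn_mul g hXc (hρc _) hGX hGX0
  have hpt : ∀ x, ρ x * (ρ x ^ (s - 1) * divergence g X x +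
      (s - 1) * ρ x ^ (s - 1 - 1) * g.inner x (G x) (X x)) =
      ρ x ^ s * divergence g X x + (s - 1) * (ρ x ^ (s - 1) * g.inner x (G x) (X x)) := by
    intro x
    -- The power laws need `ρ > 0`, which is known on `K`. Outside `K` the factors `div X` and `⟨G,
    -- X⟩` vanish, so the value of a power of zero is irrelevant.
    by_cases hx : x ∈ K
    · have e1 : ρ x ^ s = ρ x * ρ x ^ (s - 1) := by
        rw [Real.rpow_sub_one (hKpos x hx).ne']
        field_simp [(hKpos x hx).ne']
      have e2 : ρ x ^ (s - 1) = ρ x * ρ x ^ (s - 1 - 1) := by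
        rw [Real.rpow_sub_one (hKpos x hx).ne' (s - 1)]
        field_simp [(hKpos x hx).ne']
      rw [e1]
      linear_combination (-(s - 1) * g.inner x (G x) (X x)) * e2
    · simp only [hdiv0 x hx, hGX0 x hx, mul_zero, add_zero]
  simp_rw [hpt] at heq
  rw [integral_add hi1 (hi2.const_mul _), integral_const_mul] at heq
  linarith

end WeakCalculus

/-! ### The comparison inequality for powers of `ρ` inside a chart domain -/

section Comparison

open Filter Topology

variable {n : ℕ} {M : Type*} [TopologicalSpace M]
  [ChartedSpace (EuclideanSpace ℝ (Fin n)) M] [IsManifold (𝓡 n) ∞ M]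
  [T2Space M] [MeasurableSpace M] [BorelSpace M]

-- The definition of the weak gradient, tested with the field `w ∇ψ`.
omit [T2Space M] [BorelSpace M] in
theorem HasWeakGradientOn.smul_grad {g : SmoothMetric n M} {Ω : Set M}
    {ρ : M → ℝ} {G : (x : M) → TangentSpace (𝓡 n) x} (hG : HasWeakGradientOn g Ω ρ G)
    {w : M → ℝ} (hw : ContMDiff (𝓡 n) 𝓘(ℝ, ℝ) ∞ w) {ψ : M → ℝ} (hψ : IsTestFunction n Ω ψ) :
    Integrable (fun x => w x * differential ψ x (G x)) (riemannianVolume g) ∧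
      ∫ x, ρ x * divergence g (fun x => w x • grad g ψ x) x ∂(riemannianVolume g) =
        -∫ x, w x * differential ψ x (G x) ∂(riemannianVolume g) := by
  have h := hG.2 _ (isSmoothVectorField_smul_grad g hw hψ.1)
    (hψ.2.1.isCompact.of_isClosed_subset isClosed_closure (fieldSupport_smul_grad_subset g w ψ))
    ((fieldSupport_smul_grad_subset g w ψ).trans hψ.2.2)
  simpa only [map_smul, smul_eq_mul, inner_grad_right] using h

omit [T2Space M] [MeasurableSpace M] [BorelSpace M] in
theorem differential_eq_zero_of_notMem_tsupport (g : SmoothMetric n M) {f : M → ℝ} {x : M}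
    (hx : x ∉ tsupport f) (v : TangentSpace (𝓡 n) x) : differential f x v = 0 := by
  rw [← inner_grad g, grad_eq_zero_of_notMem_tsupport g hx]
  simp

/-- If `σ div (w ∇ρ) ≤ σ (C / ρ) b² w` in the sense of distributions, where `|∇ρ| = b`, then
`σ div (w ρ^γ ∇ρ) ≤ σ (C + γ) ρ^{γ-1} b² w`, tested in the domain of a chart. -/
theorem HasWeakGradientOn.comparison_chart {g : SmoothMetric n M} {Ω : Set M}
    {ρ : M → ℝ} {G : (x : M) → TangentSpace (𝓡 n) x} (hG : HasWeakGradientOn g Ω ρ G)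
    (hρ : Continuous ρ) (hΩ : IsOpen Ω) (hpos : ∀ x ∈ Ω, 0 < ρ x) {b : M → ℝ} (hb : Continuous b)
    (hGb : ∀ᵐ x ∂(riemannianVolume g), x ∈ Ω → metricNorm g x (G x) = b x)
    {w : M → ℝ} (hw : ContMDiff (𝓡 n) 𝓘(ℝ, ℝ) ∞ w) {σ C : ℝ}
    (hC : ∀ ψ : M → ℝ, IsTestFunction n Ω ψ → (∀ x, 0 ≤ ψ x) →
      σ * ∫ x, ρ x * divergence g (fun x => w x • grad g ψ x) x ∂(riemannianVolume g) ≤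
        σ * ∫ x, C / ρ x * b x ^ 2 * w x * ψ x ∂(riemannianVolume g))
    {x₀ : M} {η : M → ℝ} (hη : IsTestFunction n Ω η) (hη0 : ∀ x, 0 ≤ η x)
    (hηs : tsupport η ⊆ (chartAt (Coord n) x₀).source) (γ : ℝ) :
    σ * -∫ x, ρ x ^ γ * (w x * differential η x (G x)) ∂(riemannianVolume g) ≤
      σ * ((C + γ) * ∫ x, ρ x ^ (γ - 1) * (b x ^ 2 * w x * η x) ∂(riemannianVolume g)) := by
  set K := tsupport η with hKdef
  have hK : IsCompact K := hη.2.1.isCompact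
  have hKΩ : K ⊆ Ω := hη.2.2
  obtain ⟨R, m, B, D, hm, hD0, hRs, hRI, hRt, hRd, hRdt⟩ :=
    hG.exists_approximation hρ hΩ hpos hb (hGb.mono fun x h hx => (h hx).le) hK hηs hKΩ
  have hRpos : ∀ k x, 0 < R k x := fun k x => hm.trans_le (hRI k x).1
  have hKpos : ∀ x ∈ K, 0 < ρ x := fun x hx => hpos x (hKΩ hx)
  have hη00 : ∀ x ∉ K, η x = 0 := fun x hx => image_eq_zero_of_notMem_tsupport hx
  have hdη0 : ∀ x ∉ K, differential η x (G x) = 0 := fun x hx =>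
    differential_eq_zero_of_notMem_tsupport g hx _
  have hsub : ∀ k, tsupport (fun x => R k x ^ γ * η x) ⊆ K := fun k =>
    closure_mono fun x hx h0 => hx (by simp only [h0, mul_zero])
  -- The intended test function `ρ^γ η` is not smooth; `R_k^γ η` is, and it is nonnegative because
  -- `R_k > 0`.
  have hψ : ∀ k, IsTestFunction n Ω fun x => R k x ^ γ * η x := fun k => by
    refine ⟨?_, hK.of_isClosed_subset isClosed_closure (hsub k), (hsub k).trans hKΩ⟩
    have := contMDiff_mul_of_tsupport_subset (f := fun x => R k x ^ γ) hη.1 hηs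
      (fun x hx => contMDiffAt_rpow (hRs k x hx) (hRpos k x) γ)
    simpa only [mul_comm] using this
  have hdψ : ∀ k x, differential (fun x => R k x ^ γ * η x) x (G x) =
      R k x ^ γ * differential η x (G x) +
        η x * (γ * R k x ^ (γ - 1) * differential (R k) x (G x)) := by
    intro k x
    by_cases hx : x ∈ K
    · rw [differential_mul (contMDiffAt_rpow (hRs k x (hηs hx)) (hRpos k x) γ) (hη.1 x),
        differential_rpow (hRs k x (hηs hx)) (hRpos k x)]
    · rw [hη00 x hx, hdη0 x hx, differential_eq_zero_of_notMem_tsupport g]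
      · simp
      · exact fun h => hx (hsub k h)
  have hKc : ∀ t : ℝ, ContinuousOn (fun x => ρ x ^ t) K := fun t =>
    hρ.continuousOn.rpow_const fun x hx => Or.inl (hKpos x hx).ne'
  have hwη := (hG.smul_grad hw hη).1
  obtain ⟨A₁, hA₁0, hA₁⟩ := exists_rpow_bound (B := B) hm γ
  obtain ⟨A₂, hA₂0, hA₂⟩ := exists_rpow_bound (B := B) hm (γ - 1)
  obtain ⟨P, hP⟩ := hK.exists_bound_of_continuousOn
    (f := fun x => w x * (η x * b x))
    (hw.continuous.mul (hη.1.continuous.mul hb)).continuousOn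
  have hRpow : ∀ t : ℝ, ∀ x ∈ K, Tendsto (fun k => R k x ^ t) atTop (𝓝 (ρ x ^ t)) :=
    fun t x hx => (hRt x hx).rpow_const (Or.inl (hKpos x hx).ne')
  -- Differentiating `R_k^γ` contributes `γ R_k^{γ-1} ⟨∇R_k, G⟩`, and `⟨∇R_k, G⟩` tends to `|G|² =
  -- b²` almost everywhere on `K`. This produces the shift from `C` to `C + γ`.
  have lim1 : Tendsto (fun k => ∫ x, w x * differential (fun x => R k x ^ γ * η x) x (G x)
      ∂(riemannianVolume g)) atTop (𝓝 (∫ x, (ρ x ^ γ * (w x * differential η x (G x)) +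
        γ * (ρ x ^ (γ - 1) * (b x ^ 2 * w x * η x))) ∂(riemannianVolume g))) := by
    refine tendsto_integral_of_dominated_convergence
      (fun x => A₁ * |w x * differential η x (G x)| +
        K.indicator (fun _ => |γ| * A₂ * D * P) x)
      (fun k => (hG.smul_grad hw (hψ k)).1.aestronglyMeasurable)
      ((hwη.abs.const_mul A₁).add
        ((integrable_indicator_iff hK.measurableSet).2 (integrableOn_const hK.measure_lt_top.ne)))
      (fun k => ?_) ?_
    · filter_upwards [hGb] with x hx
      rw [hdψ, mul_add]
      refine (norm_add_le _ _).trans (add_le_add ?_ ?_)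
      · rw [mul_left_comm, norm_mul]
        exact mul_le_mul_of_nonneg_right (hA₁ _ (hRI k x)) (norm_nonneg _)
      · by_cases hxK : x ∈ K
        · rw [indicator_of_mem hxK]
          have h1 := hRd k x hxK (G x)
          rw [hx (hKΩ hxK)] at h1
          have hb0 : 0 ≤ b x := hx (hKΩ hxK) ▸ metricNorm_nonneg g x (G x)
          have h2 := hP x hxK
          simp only [Real.norm_eq_abs, abs_mul, abs_of_nonneg hb0] at h2 ⊢
          calc |w x| * (|η x| * (|γ| * |R k x ^ (γ - 1)| * |differential (R k) x (G x)|))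
              ≤ |w x| * (|η x| * (|γ| * A₂ * (D * b x))) := by
                gcongr
                exact hA₂ _ (hRI k x)
            _ = |γ| * A₂ * D * (|w x| * (|η x| * b x)) := by ring
            _ ≤ |γ| * A₂ * D * P := by gcongr
        · rw [indicator_of_notMem hxK, hη00 x hxK]
          simp
    · filter_upwards [hRdt, hGb] with x hx hxb
      simp only [hdψ]
      by_cases hxK : x ∈ K
      · have h1 := hx hxK (G x)
        rw [← metricNorm_sq, hxb (hKΩ hxK)] at h1
        convert (((hRpow γ x hxK).mul_const (differential η x (G x))).add
          ((((hRpow (γ - 1) x hxK).const_mul γ).mul h1).const_mul (η x))).const_mul (w x) using 2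
        ring
      · simp only [hη00 x hxK, hdη0 x hxK, mul_zero, zero_mul, add_zero]
        exact tendsto_const_nhds
  have hN : Integrable (fun x => ρ x ^ (γ - 1) * (b x ^ 2 * w x * η x)) (riemannianVolume g) :=
    integrable_of_continuousOn_compact g hK ((hKc _).mul
      (((hb.pow 2).mul hw.continuous).mul hη.1.continuous).continuousOn)
      fun x hx => by rw [hη00 x hx, mul_zero, mul_zero]
  have hq : Integrable (fun x => C / ρ x * b x ^ 2 * w x * η x) (riemannianVolume g) :=
    integrable_of_continuousOn_compact g hK ((((continuousOn_const.div hρ.continuousOn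
      fun x hx => (hKpos x hx).ne').mul (hb.pow 2).continuousOn).mul hw.continuous.continuousOn).mul
      hη.1.continuous.continuousOn) fun x hx => by rw [hη00 x hx, mul_zero]
  have lim2 : Tendsto (fun k => ∫ x, C / ρ x * b x ^ 2 * w x * (R k x ^ γ * η x)
      ∂(riemannianVolume g)) atTop
      (𝓝 (∫ x, C * (ρ x ^ (γ - 1) * (b x ^ 2 * w x * η x)) ∂(riemannianVolume g))) := by
    have e : ∀ k x, C / ρ x * b x ^ 2 * w x * (R k x ^ γ * η x) =
      R k x ^ γ * (C / ρ x * b x ^ 2 * w x * η x) := fun k x => by ring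
    simp only [e]
    refine tendsto_integral_of_dominated_convergence
      (fun x => A₁ * |C / ρ x * b x ^ 2 * w x * η x|) (fun k => ?_) (hq.abs.const_mul A₁)
      (fun k => Eventually.of_forall fun x => ?_) (Eventually.of_forall fun x => ?_)
    · exact (integrable_continuousOn_mul g hK (fun x hx => (contMDiffAt_rpow (hRs k x (hηs hx))
        (hRpos k x) γ).continuousAt.continuousWithinAt) hq
        fun x hx => by rw [hη00 x hx, mul_zero]).aestronglyMeasurable
    · rw [norm_mul]
      exact mul_le_mul_of_nonneg_right (hA₁ _ (hRI k x)) (norm_nonneg _)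
    · by_cases hx : x ∈ K
      · convert (hRpow γ x hx).mul_const (C / ρ x * b x ^ 2 * w x * η x) using 2
        rw [Real.rpow_sub_one (hKpos x hx).ne']
        ring
      · simp only [hη00 x hx, mul_zero]
        exact tendsto_const_nhds
  -- The hypothesis for `R_k^γ η`, rewritten by means of the weak gradient, passes to the limit. The
  -- `γ` term then moves to the right-hand side.
  have hle := le_of_tendsto_of_tendsto (lim1.neg.const_mul σ) (lim2.const_mul σ)
    (Eventually.of_forall fun k => by
      have := hC _ (hψ k) fun x => mul_nonneg (Real.rpow_nonneg (hRpos k x).le _) (hη0 x)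
      rwa [(hG.smul_grad hw (hψ k)).2] at this)
  rw [integral_add (integrable_continuousOn_mul g hK (hKc γ) hwη
    fun x hx => by rw [hdη0 x hx, mul_zero]) (hN.const_mul γ), integral_const_mul,
    integral_const_mul] at hle
  linarith

end Comparison

/-! ### From chart domains to all test functions by a partition of unity -/

section Globalization

open Filter Topology

variable {n : ℕ} {M : Type*} [TopologicalSpace M]
  [ChartedSpace (EuclideanSpace ℝ (Fin n)) M]

theorem IsTestFunction.add {Ω : Set M} {f h : M → ℝ} (hf : IsTestFunction n Ω f)
    (hh : IsTestFunction n Ω h) : IsTestFunction n Ω (fun x => f x + h x) :=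
  ⟨hf.1.add hh.1, hf.2.1.add hh.2.1,
    (tsupport_add f h).trans (union_subset hf.2.2 hh.2.2)⟩

variable [IsManifold (𝓡 n) ∞ M]

theorem divergence_smul_grad_add (g : SmoothMetric n M) {w f h : M → ℝ}
    (hw : ContMDiff (𝓡 n) 𝓘(ℝ, ℝ) ∞ w) (hf : ContMDiff (𝓡 n) 𝓘(ℝ, ℝ) ∞ f)
    (hh : ContMDiff (𝓡 n) 𝓘(ℝ, ℝ) ∞ h) (x : M) :
    divergence g (fun x => w x • grad g (fun y => f y + h y) x) x =
      divergence g (fun x => w x • grad g f x) x + divergence g (fun x => w x • grad g h x) x := by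
  rw [← divergence_add g (isSmoothVectorField_smul_grad g hw hf x)
    (isSmoothVectorField_smul_grad g hw hh x)]
  congr 1
  funext y
  rw [grad_add g (hf y) (hh y), smul_add]

theorem divergence_smul_grad_eq_zero_of_notMem_tsupport (g : SmoothMetric n M) {w f : M → ℝ} {x : M}
    (hx : x ∉ tsupport f) : divergence g (fun x => w x • grad g f x) x = 0 :=
  divergence_eq_zero_of_eventually g (by
    filter_upwards [(isClosed_tsupport f).isOpen_compl.mem_nhds hx] with y hy
    rw [grad_eq_zero_of_notMem_tsupport g hy, smul_zero])

variable [T2Space M] [SecondCountableTopology M]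

/-- A property of nonnegative test functions that is stable under sums holds as soon as it holds
for those that are supported in the domain of a chart. -/
theorem IsTestFunction.induction_on_charts {Ω : Set M} {P : (M → ℝ) → Prop}
    (zero : P fun _ => 0)
    (add : ∀ f h : M → ℝ, IsTestFunction n Ω f → IsTestFunction n Ω h →
      P f → P h → P fun x => f x + h x)
    (chart : ∀ (f : M → ℝ) (x₀ : M), IsTestFunction n Ω f → (∀ x, 0 ≤ f x) →
      tsupport f ⊆ (chartAt (Coord n) x₀).source → P f)
    {η : M → ℝ} (hη : IsTestFunction n Ω η) (hη0 : ∀ x, 0 ≤ η x) : P η := by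
  classical
  have : LocallyCompactSpace M := ChartedSpace.locallyCompactSpace (EuclideanSpace ℝ (Fin n)) M
  have : SigmaCompactSpace M := inferInstance
  obtain ⟨ζ, hζ⟩ := SmoothPartitionOfUnity.exists_isSubordinate (𝓡 n) (isClosed_tsupport η)
    (fun x₀ : M => (chartAt (Coord n) x₀).source) (fun x₀ => (chartAt (Coord n) x₀).open_source)
    fun x _ => mem_iUnion.2 ⟨x, mem_chart_source _ x⟩
  -- Local finiteness and the compact support of `η` leave only finitely many nonzero products `ζ i
  -- * η`, so finite additivity of `P` suffices.
  have hfin : {i | ((Function.support (ζ i)) ∩ tsupport η).Nonempty}.Finite :=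
    ζ.locallyFinite.finite_nonempty_inter_compact hη.2.1.isCompact
  have hterm : ∀ i, IsTestFunction n Ω (fun x => ζ i x * η x) ∧ (∀ x, 0 ≤ ζ i x * η x) ∧
      tsupport (fun x => ζ i x * η x) ⊆ (chartAt (Coord n) i).source := fun i => by
    have h1 : tsupport (fun x => ζ i x * η x) ⊆ tsupport η :=
      closure_mono fun x hx h0 => hx (by simp only [h0, mul_zero])
    have h2 : tsupport (fun x => ζ i x * η x) ⊆ tsupport (ζ i) :=
      closure_mono fun x hx h0 => hx (by simp only [h0, zero_mul])
    exact ⟨⟨(ζ i).contMDiff.mul hη.1, hη.2.1.isCompact.of_isClosed_subset isClosed_closure h1,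
      h1.trans hη.2.2⟩, fun x => mul_nonneg (ζ.nonneg i x) (hη0 x), h2.trans (hζ i)⟩
  have hsum : ∀ s : Finset M, IsTestFunction n Ω (fun x => ∑ i ∈ s, ζ i x * η x) ∧
      P fun x => ∑ i ∈ s, ζ i x * η x := by
    intro s
    induction s using Finset.induction_on with
    | empty =>
      simp only [Finset.sum_empty]
      refine ⟨⟨contMDiff_const, HasCompactSupport.zero, ?_⟩, zero⟩
      simp [tsupport]
    | insert i s hi ih =>
      simp only [Finset.sum_insert hi]
      exact ⟨(hterm i).1.add ih.1, add _ _ (hterm i).1 ih.1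
        (chart _ i (hterm i).1 (hterm i).2.1 (hterm i).2.2) ih.2⟩
  have key : (fun x => ∑ i ∈ hfin.toFinset, ζ i x * η x) = η := by
    funext x
    by_cases hx : x ∈ tsupport η
    · rw [← Finset.sum_mul, ← finsum_eq_sum_of_support_subset, ζ.sum_eq_one hx, one_mul]
      intro i hi
      simp only [Finite.coe_toFinset]
      exact ⟨x, hi, hx⟩
    · simp only [image_eq_zero_of_notMem_tsupport hx, mul_zero, Finset.sum_const_zero]
  exact key ▸ (hsum hfin.toFinset).2

variable [MeasurableSpace M] [BorelSpace M]

/-- The chain rule for `ρ^s` and the comparison inequality, tested against nonnegative test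
functions. -/
theorem HasWeakGradientOn.comparison {g : SmoothMetric n M} {Ω : Set M}
    {ρ : M → ℝ} {G : (x : M) → TangentSpace (𝓡 n) x} (hG : HasWeakGradientOn g Ω ρ G)
    (hρ : Continuous ρ) (hΩ : IsOpen Ω) (hpos : ∀ x ∈ Ω, 0 < ρ x) {b : M → ℝ} (hb : Continuous b)
    (hGb : ∀ᵐ x ∂(riemannianVolume g), x ∈ Ω → metricNorm g x (G x) = b x)
    {w : M → ℝ} (hw : ContMDiff (𝓡 n) 𝓘(ℝ, ℝ) ∞ w) {σ C : ℝ}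
    (hC : ∀ ψ : M → ℝ, IsTestFunction n Ω ψ → (∀ x, 0 ≤ ψ x) →
      σ * ∫ x, ρ x * divergence g (fun x => w x • grad g ψ x) x ∂(riemannianVolume g) ≤
        σ * ∫ x, C / ρ x * b x ^ 2 * w x * ψ x ∂(riemannianVolume g))
    {η : M → ℝ} (hη : IsTestFunction n Ω η) (hη0 : ∀ x, 0 ≤ η x) (s : ℝ) :
    ∫ x, ρ x ^ s * divergence g (fun x => w x • grad g η x) x ∂(riemannianVolume g) =
        -(s * ∫ x, ρ x ^ (s - 1) * (w x * differential η x (G x)) ∂(riemannianVolume g)) ∧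
      σ * -∫ x, ρ x ^ (s - 1) * (w x * differential η x (G x)) ∂(riemannianVolume g) ≤
        σ * ((C + (s - 1)) *
          ∫ x, ρ x ^ (s - 1 - 1) * (b x ^ 2 * w x * η x) ∂(riemannianVolume g)) := by
  have hpow : ∀ f : M → ℝ, IsTestFunction n Ω f → ∀ t : ℝ,
      ContinuousOn (fun x => ρ x ^ t) (tsupport f) := fun f hf t =>
    hρ.continuousOn.rpow_const fun x hx => Or.inl (hpos x (hf.2.2 hx)).ne'
  have hS : ∀ f : M → ℝ, IsTestFunction n Ω f → Integrable
      (fun x => ρ x ^ s * divergence g (fun x => w x • grad g f x) x) (riemannianVolume g) :=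
    fun f hf => integrable_of_continuousOn_compact g hf.2.1.isCompact ((hpow f hf s).mul
      ((isSmoothVectorField_smul_grad g hw hf.1).continuous_divergence g).continuousOn)
      fun x hx => by rw [divergence_smul_grad_eq_zero_of_notMem_tsupport g hx, mul_zero]
  have hT : ∀ f : M → ℝ, IsTestFunction n Ω f → Integrable
      (fun x => ρ x ^ (s - 1) * (w x * differential f x (G x))) (riemannianVolume g) :=
    fun f hf => integrable_continuousOn_mul g hf.2.1.isCompact (hpow f hf _)
      (hG.smul_grad hw hf).1
      fun x hx => by rw [differential_eq_zero_of_notMem_tsupport g hx, mul_zero]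
  have hN : ∀ f : M → ℝ, IsTestFunction n Ω f → Integrable
      (fun x => ρ x ^ (s - 1 - 1) * (b x ^ 2 * w x * f x)) (riemannianVolume g) :=
    fun f hf => integrable_of_continuousOn_compact g hf.2.1.isCompact ((hpow f hf _).mul
      (((hb.pow 2).mul hw.continuous).mul hf.1.continuous).continuousOn)
      fun x hx => by rw [image_eq_zero_of_notMem_tsupport hx, mul_zero, mul_zero]
  -- Both conclusions are additive in the test function. The integrability facts above are needed to
  -- split the integrals of a sum.
  refine IsTestFunction.induction_on_charts (P := fun η =>
    ∫ x, ρ x ^ s * divergence g (fun x => w x • grad g η x) x ∂(riemannianVolume g) =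
        -(s * ∫ x, ρ x ^ (s - 1) * (w x * differential η x (G x)) ∂(riemannianVolume g)) ∧
      σ * -∫ x, ρ x ^ (s - 1) * (w x * differential η x (G x)) ∂(riemannianVolume g) ≤
        σ * ((C + (s - 1)) *
          ∫ x, ρ x ^ (s - 1 - 1) * (b x ^ 2 * w x * η x) ∂(riemannianVolume g)))
    ?_ ?_ ?_ hη hη0
  · have h0 : ∀ x : M, x ∉ tsupport (fun _ : M => (0 : ℝ)) := fun x => by simp [tsupport]
    simp only [divergence_smul_grad_eq_zero_of_notMem_tsupport g (h0 _),
      differential_eq_zero_of_notMem_tsupport g (h0 _), mul_zero, integral_zero, neg_zero, le_refl,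
      and_self]
  · rintro f h hf hh ⟨hf1, hf2⟩ ⟨hh1, hh2⟩
    have e1 : ∀ x, ρ x ^ s * divergence g (fun x => w x • grad g (fun y => f y + h y) x) x =
        ρ x ^ s * divergence g (fun x => w x • grad g f x) x +
          ρ x ^ s * divergence g (fun x => w x • grad g h x) x := fun x => by
      rw [divergence_smul_grad_add g hw hf.1 hh.1, mul_add]
    have e2 : ∀ x, ρ x ^ (s - 1) * (w x * differential (fun y => f y + h y) x (G x)) =
        ρ x ^ (s - 1) * (w x * differential f x (G x)) +
          ρ x ^ (s - 1) * (w x * differential h x (G x)) := fun x => by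
      rw [differential_add (hf.1 x) (hh.1 x)]
      ring
    have e3 : ∀ x, ρ x ^ (s - 1 - 1) * (b x ^ 2 * w x * (f x + h x)) =
        ρ x ^ (s - 1 - 1) * (b x ^ 2 * w x * f x) +
          ρ x ^ (s - 1 - 1) * (b x ^ 2 * w x * h x) := fun x => by ring
    simp only [e1, e2, e3]
    rw [integral_add (hS f hf) (hS h hh), integral_add (hT f hf) (hT h hh),
      integral_add (hN f hf) (hN h hh)]
    constructor <;> linarith
  · intro f x₀ hf hf0 hfs
    have hsub := fieldSupport_smul_grad_subset g w f
    refine ⟨?_, hG.comparison_chart hρ hΩ hpos hb hGb hw hC hf hf0 hfs (s - 1)⟩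
    have := hG.integral_rpow_mul_divergence hρ hΩ hpos hb (hGb.mono fun x h hx => (h hx).le)
      (isSmoothVectorField_smul_grad g hw hf.1)
      (hf.2.1.isCompact.of_isClosed_subset isClosed_closure hsub) (hsub.trans hfs)
      (hsub.trans hf.2.2) s
    simpa only [map_smul, smul_eq_mul, inner_grad_right] using this

end Globalization

/-! ### Young and Hardy inequalities and the weighted Rellich inequalities -/

section Rellich

open Filter Topology

variable {n : ℕ} {M : Type*} [TopologicalSpace M]
  [ChartedSpace (EuclideanSpace ℝ (Fin n)) M] [IsManifold (𝓡 n) ∞ M]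

theorem differential_sq {f : M → ℝ} {x : M} (hf : ContMDiffAt (𝓡 n) 𝓘(ℝ, ℝ) ∞ f x)
    (v : TangentSpace (𝓡 n) x) :
    differential (fun y => f y * f y) x v = 2 * f x * differential f x v := by
  rw [differential_mul hf hf]
  ring

theorem divergence_smul_grad_sq (g : SmoothMetric n M) {w f : M → ℝ}
    (hw : ContMDiff (𝓡 n) 𝓘(ℝ, ℝ) ∞ w) (hf : ContMDiff (𝓡 n) 𝓘(ℝ, ℝ) ∞ f) (x : M) :
    divergence g (fun x => w x • grad g (fun y => f y * f y) x) x =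
      2 * (f x * divergence g (fun x => w x • grad g f x) x) +
        2 * (w x * differential f x (grad g f x)) := by
  have h2 : ContMDiff (𝓡 n) 𝓘(ℝ, ℝ) ∞ fun y => f y + f y := hf.add hf
  have h : (fun x => w x • grad g (fun y => f y * f y) x) =
      fun x => (f x + f x) • (w x • grad g f x) := by
    funext y
    rw [grad_mul g (hf y) (hf y), smul_add, add_smul, smul_comm (w y)]
  rw [h, divergence_smul g (f := fun y => f y + f y) (h2 x)
    (isSmoothVectorField_smul_grad g hw hf x), differential_add (hf x) (hf x), map_smul,
    smul_eq_mul]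
  ring

theorem differential_grad_self (g : SmoothMetric n M) (f : M → ℝ) (x : M) :
    differential f x (grad g f x) = metricNorm g x (grad g f x) ^ 2 := by
  rw [metricNorm_sq, inner_grad]

/-- Weighted Young inequality: the right side minus the left is a perfect square with a nonnegative
coefficient. The factors `b² w` are arranged so that the two terms are the integrands of `R` and
`B`. -/
theorem young_rpow {r b w s : ℝ} (hr : 0 < r) (hb : 0 < b) (hw : 0 < w) (hs : 0 < s)
    (β p d : ℝ) :
    -(r ^ β * (p * d)) ≤ (4 * s)⁻¹ * (r ^ (β + 2) * (d ^ 2 / (b ^ 2 * w))) +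
      s * (r ^ (β - 1 - 1) * (b ^ 2 * w * (p * p))) := by
  have e1 : r ^ (β + 2) = r ^ β * r ^ 2 := by rw [Real.rpow_add hr, Real.rpow_two]
  have e2 : r ^ (β - 1 - 1) = r ^ β / r ^ 2 := by
    rw [Real.rpow_sub_one hr.ne', Real.rpow_sub_one hr.ne', div_div, sq]
  have h : (4 * s)⁻¹ * (r ^ (β + 2) * (d ^ 2 / (b ^ 2 * w))) +
      s * (r ^ (β - 1 - 1) * (b ^ 2 * w * (p * p))) - -(r ^ β * (p * d)) =
      r ^ β * (r ^ 2 * d + 2 * s * (b ^ 2 * w * p)) ^ 2 / (4 * s * (b ^ 2 * w) * r ^ 2) := by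
    rw [e1, e2]
    field_simp
    ring
  have h0 : 0 ≤ r ^ β * (r ^ 2 * d + 2 * s * (b ^ 2 * w * p)) ^ 2 /
    (4 * s * (b ^ 2 * w) * r ^ 2) := by positivity
  linarith

/-- The pointwise form of Hardy's inequality, for `p = φ`, `q = |∇φ|` and `d = ⟨∇φ, ∇ρ⟩`: bound `d`
by Cauchy–Schwarz and complete the square in `r q - h b |p|`. -/
theorem hardy_rpow {r b w h q d : ℝ} (hr : 0 < r) (hw : 0 < w) (hh : 0 < h)
    (hd : |d| ≤ q * b) (β p : ℝ) :
    -(r ^ (β - 1) * (w * (2 * p * d))) ≤ h⁻¹ * (r ^ β * (w * q ^ 2)) +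
      h * (r ^ (β - 1 - 1) * (b ^ 2 * w * (p * p))) := by
  have e1 : r ^ (β - 1) = r ^ β / r := Real.rpow_sub_one hr.ne' β
  have e2 : r ^ (β - 1 - 1) = r ^ β / r ^ 2 := by
    rw [Real.rpow_sub_one hr.ne', e1, div_div, sq]
  have h1 : -(p * d) ≤ |p| * (q * b) := by
    refine (neg_le_abs _).trans ?_
    rw [abs_mul]
    exact mul_le_mul_of_nonneg_left hd (abs_nonneg _)
  have hpp : p * p = |p| ^ 2 := by rw [sq_abs, sq]
  have h2 : h⁻¹ * (r ^ β * (w * q ^ 2)) + h * (r ^ (β - 1 - 1) * (b ^ 2 * w * (p * p))) -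
      r ^ (β - 1) * w * 2 * (|p| * (q * b)) =
      r ^ β * w * (r * q - h * (b * |p|)) ^ 2 / (h * r ^ 2) := by
    rw [e1, e2, hpp]
    field_simp
    ring
  have h3 : 0 ≤ r ^ β * w * (r * q - h * (b * |p|)) ^ 2 / (h * r ^ 2) := by positivity
  have h4 : r ^ (β - 1) * w * 2 * -(p * d) ≤ r ^ (β - 1) * w * 2 * (|p| * (q * b)) :=
    mul_le_mul_of_nonneg_left h1 (by positivity)
  linarith

omit [IsManifold (𝓡 n) ∞ M] in
theorem IsTestFunction.mul_self {Ω : Set M} {φ : M → ℝ} (hφ : IsTestFunction n Ω φ) :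
    IsTestFunction n Ω fun x => φ x * φ x := by
  have h : tsupport (fun x => φ x * φ x) ⊆ tsupport φ :=
    closure_mono fun x hx h0 => hx (by simp only [h0, mul_zero])
  exact ⟨hφ.1.mul hφ.1, hφ.2.1.isCompact.of_isClosed_subset isClosed_closure h, h.trans hφ.2.2⟩

omit [IsManifold (𝓡 n) ∞ M] in
theorem continuousOn_rpow_tsupport {Ω : Set M} {ρ φ : M → ℝ} (hρ : Continuous ρ)
    (hpos : ∀ x ∈ Ω, 0 < ρ x)
    (hφ : IsTestFunction n Ω φ) (t : ℝ) : ContinuousOn (fun x => ρ x ^ t) (tsupport φ) :=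
  hρ.continuousOn.rpow_const fun x hx => Or.inl (hpos x (hφ.2.2 hx)).ne'

variable [T2Space M] [MeasurableSpace M] [BorelSpace M]

section Integrability

variable {g : SmoothMetric n M} {Ω : Set M} {ρ b w φ : M → ℝ}

theorem integrable_rpow_mul_sq (hρ : Continuous ρ) (hpos : ∀ x ∈ Ω, 0 < ρ x)
    (hφ : IsTestFunction n Ω φ) (hb : Continuous b) (hw : Continuous w) (t : ℝ) :
    Integrable (fun x => ρ x ^ t * (b x ^ 2 * w x * (φ x * φ x))) (riemannianVolume g) :=
  integrable_of_continuousOn_compact g hφ.2.1.isCompact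
    ((continuousOn_rpow_tsupport hρ hpos hφ t).mul (((hb.pow 2).mul hw).mul
      (hφ.1.continuous.mul hφ.1.continuous)).continuousOn)
    fun x hx => by simp only [image_eq_zero_of_notMem_tsupport hx, mul_zero]

theorem integrable_rpow_mul_normSq_grad (hρ : Continuous ρ) (hpos : ∀ x ∈ Ω, 0 < ρ x)
    (hφ : IsTestFunction n Ω φ) (hw : Continuous w) (t : ℝ) :
    Integrable (fun x => ρ x ^ t * (w x * metricNorm g x (grad g φ x) ^ 2))
      (riemannianVolume g) :=
  integrable_of_continuousOn_compact g hφ.2.1.isCompact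
    ((continuousOn_rpow_tsupport hρ hpos hφ t).mul
      (hw.mul (((isSmoothVectorField_grad g hφ.1).continuous_metricNorm g).pow 2)).continuousOn)
    fun x hx => by
      rw [← differential_grad_self, differential_eq_zero_of_notMem_tsupport g hx, mul_zero,
        mul_zero]

theorem integrable_rpow_mul_divergence (hρ : Continuous ρ) (hpos : ∀ x ∈ Ω, 0 < ρ x)
    (hφ : IsTestFunction n Ω φ) (hw : ContMDiff (𝓡 n) 𝓘(ℝ, ℝ) ∞ w) (t : ℝ) :
    Integrable (fun x => ρ x ^ t * (φ x * divergence g (fun x => w x • grad g φ x) x))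
      (riemannianVolume g) :=
  integrable_of_continuousOn_compact g hφ.2.1.isCompact
    ((continuousOn_rpow_tsupport hρ hpos hφ t).mul (hφ.1.continuous.mul
      ((isSmoothVectorField_smul_grad g hw hφ.1).continuous_divergence g)).continuousOn)
    fun x hx => by rw [image_eq_zero_of_notMem_tsupport hx, zero_mul, mul_zero]

theorem integrable_rpow_mul_divergence_sq (hρ : Continuous ρ) (hpos : ∀ x ∈ Ω, 0 < ρ x)
    (hφ : IsTestFunction n Ω φ) (hb : Continuous b) (hb0 : ∀ x, 0 < b x)
    (hw : ContMDiff (𝓡 n) 𝓘(ℝ, ℝ) ∞ w) (hw0 : ∀ x, 0 < w x) (t : ℝ) :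
    Integrable (fun x => ρ x ^ t *
      (divergence g (fun x => w x • grad g φ x) x ^ 2 / (b x ^ 2 * w x)))
      (riemannianVolume g) :=
  integrable_of_continuousOn_compact g hφ.2.1.isCompact
    ((continuousOn_rpow_tsupport hρ hpos hφ t).mul
      ((((isSmoothVectorField_smul_grad g hw hφ.1).continuous_divergence g).pow 2).div
        ((hb.pow 2).mul hw.continuous)
        fun x => (mul_pos (pow_pos (hb0 x) 2) (hw0 x)).ne').continuousOn)
    fun x hx => by
      rw [divergence_smul_grad_eq_zero_of_notMem_tsupport g hx]
      simp

end Integrability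

/-- Integrated form of Young's inequality, combined with
`div (w ∇φ²) = 2 φ div (w ∇φ) + 2 w |∇φ|²`. -/
theorem integral_normSq_grad_le (g : SmoothMetric n M) {Ω : Set M} {ρ b w φ : M → ℝ}
    (hρ : Continuous ρ) (hpos : ∀ x ∈ Ω, 0 < ρ x)
    (hφ : IsTestFunction n Ω φ) (hb : Continuous b) (hb0 : ∀ x, 0 < b x)
    (hw : ContMDiff (𝓡 n) 𝓘(ℝ, ℝ) ∞ w) (hw0 : ∀ x, 0 < w x) (β : ℝ) {s : ℝ} (hs : 0 < s) :
    ∫ x, ρ x ^ β * (w x * metricNorm g x (grad g φ x) ^ 2) ∂(riemannianVolume g) ≤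
      2⁻¹ * ∫ x, ρ x ^ β * divergence g (fun x => w x • grad g (fun y => φ y * φ y) x) x
          ∂(riemannianVolume g) +
      (4 * s)⁻¹ * ∫ x, ρ x ^ (β + 2) *
        (divergence g (fun x => w x • grad g φ x) x ^ 2 / (b x ^ 2 * w x))
          ∂(riemannianVolume g) +
      s * ∫ x, ρ x ^ (β - 1 - 1) * (b x ^ 2 * w x * (φ x * φ x)) ∂(riemannianVolume g) := by
  have hE := integrable_rpow_mul_divergence (g := g) hρ hpos hφ hw β
  have hA := integrable_rpow_mul_normSq_grad (g := g) hρ hpos hφ hw.continuous β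
  have hR := integrable_rpow_mul_divergence_sq (g := g) hρ hpos hφ hb hb0 hw hw0 (β + 2)
  have hB := integrable_rpow_mul_sq (g := g) hρ hpos hφ hb hw.continuous (β - 1 - 1)
  have e : ∀ x, ρ x ^ β * divergence g (fun x => w x • grad g (fun y => φ y * φ y) x) x =
      2 * (ρ x ^ β * (φ x * divergence g (fun x => w x • grad g φ x) x)) +
        2 * (ρ x ^ β * (w x * metricNorm g x (grad g φ x) ^ 2)) := fun x => by
    rw [divergence_smul_grad_sq g hw hφ.1, differential_grad_self]
    ring
  simp only [e]
  rw [integral_add (hE.const_mul 2) (hA.const_mul 2), integral_const_mul, integral_const_mul]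
  have hY : -∫ x, ρ x ^ β * (φ x * divergence g (fun x => w x • grad g φ x) x)
      ∂(riemannianVolume g) ≤
      (4 * s)⁻¹ * ∫ x, ρ x ^ (β + 2) *
        (divergence g (fun x => w x • grad g φ x) x ^ 2 / (b x ^ 2 * w x))
          ∂(riemannianVolume g) +
      s * ∫ x, ρ x ^ (β - 1 - 1) * (b x ^ 2 * w x * (φ x * φ x)) ∂(riemannianVolume g) := by
    rw [← integral_neg, ← integral_const_mul, ← integral_const_mul,
      ← integral_add (hR.const_mul _) (hB.const_mul _)]
    refine integral_mono hE.neg ((hR.const_mul _).add (hB.const_mul _)) fun x => ?_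
    -- The pointwise inequality requires `ρ > 0`, known only on `Ω`; outside the support of `φ` both
    -- sides are zero.
    by_cases hx : x ∈ tsupport φ
    · exact young_rpow (hpos x (hφ.2.2 hx)) (hb0 x) (hw0 x) hs β _ _
    · simp only [image_eq_zero_of_notMem_tsupport hx,
        divergence_smul_grad_eq_zero_of_notMem_tsupport g hx]
      simp
  linarith

variable [SecondCountableTopology M]

/-- The weighted Rellich inequality when `div (w ∇ρ) ≤ (C / ρ) b² w`, where `|∇ρ| = b`. -/
theorem HasWeakGradientOn.rellich_of_le {g : SmoothMetric n M} {Ω : Set M}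
    {ρ : M → ℝ} {G : (x : M) → TangentSpace (𝓡 n) x} (hG : HasWeakGradientOn g Ω ρ G)
    (hρ : Continuous ρ) (hΩ : IsOpen Ω) (hpos : ∀ x ∈ Ω, 0 < ρ x) {b : M → ℝ} (hb : Continuous b)
    (hb0 : ∀ x, 0 < b x) (hGb : ∀ᵐ x ∂(riemannianVolume g), x ∈ Ω → metricNorm g x (G x) = b x)
    {w : M → ℝ} (hw : ContMDiff (𝓡 n) 𝓘(ℝ, ℝ) ∞ w) (hw0 : ∀ x, 0 < w x) {C : ℝ}
    (hC : ∀ ψ : M → ℝ, IsTestFunction n Ω ψ → (∀ x, 0 ≤ ψ x) →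
      ∫ x, ρ x * divergence g (fun x => w x • grad g ψ x) x ∂(riemannianVolume g) ≤
        ∫ x, C / ρ x * b x ^ 2 * w x * ψ x ∂(riemannianVolume g))
    {φ : M → ℝ} (hφ : IsTestFunction n Ω φ) {β : ℝ} (hβ : 0 < β) (hβC : β < 1 - C) :
    2 * β * (1 - β - C) *
        ∫ x, ρ x ^ β * (w x * metricNorm g x (grad g φ x) ^ 2) ∂(riemannianVolume g) ≤
      ∫ x, ρ x ^ (β + 2) * (divergence g (fun x => w x • grad g φ x) x ^ 2 / (b x ^ 2 * w x))
        ∂(riemannianVolume g) := by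
  -- For `η = φ²` and `s = β`, these are `∫ ρ^β div (w ∇φ²) = -β T` and `-T ≤ (C + β - 1) B`.
  obtain ⟨h1, h2⟩ := hG.comparison hρ hΩ hpos hb hGb hw (σ := 1) (C := C)
    (fun ψ hψ hψ0 => by simpa only [one_mul] using hC ψ hψ hψ0) hφ.mul_self
    (fun x => mul_self_nonneg (φ x)) β
  -- Since `β > 0`, the term `-β T / 2` is at most `-K B` with this constant `K`. Taking it as
  -- Young's parameter makes the multiples of `B` cancel, and `4 K` is the constant of the
  -- inequality.
  have hK : 0 < β * (1 - β - C) / 2 := by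
    have : 0 < 1 - β - C := by linarith
    positivity
  have h3 := integral_normSq_grad_le g hρ hpos hφ hb hb0 hw hw0 β hK
  rw [h1] at h3
  have h4 := mul_le_mul_of_nonneg_left h2 hβ.le
  set K := β * (1 - β - C) / 2 with hKdef
  set A := ∫ x, ρ x ^ β * (w x * metricNorm g x (grad g φ x) ^ 2) ∂(riemannianVolume g)
  set R := ∫ x, ρ x ^ (β + 2) * (divergence g (fun x => w x • grad g φ x) x ^ 2 / (b x ^ 2 * w x))
        ∂(riemannianVolume g)
  have h5 : A ≤ (4 * K)⁻¹ * R := by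
    rw [hKdef] at h3 ⊢
    linarith
  rw [inv_mul_eq_div, le_div_iff₀ (by positivity)] at h5
  rw [hKdef] at h5
  linarith

/-- The weighted Rellich inequality when `div (w ∇ρ) ≥ (C / ρ) b² w`, where `|∇ρ| = b`. -/
theorem HasWeakGradientOn.rellich_of_ge {g : SmoothMetric n M} {Ω : Set M}
    {ρ : M → ℝ} {G : (x : M) → TangentSpace (𝓡 n) x} (hG : HasWeakGradientOn g Ω ρ G)
    (hρ : Continuous ρ) (hΩ : IsOpen Ω) (hpos : ∀ x ∈ Ω, 0 < ρ x) {b : M → ℝ} (hb : Continuous b)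
    (hb0 : ∀ x, 0 < b x) (hGb : ∀ᵐ x ∂(riemannianVolume g), x ∈ Ω → metricNorm g x (G x) = b x)
    {w : M → ℝ} (hw : ContMDiff (𝓡 n) 𝓘(ℝ, ℝ) ∞ w) (hw0 : ∀ x, 0 < w x) {C : ℝ}
    (hC : ∀ ψ : M → ℝ, IsTestFunction n Ω ψ → (∀ x, 0 ≤ ψ x) →
      ∫ x, C / ρ x * b x ^ 2 * w x * ψ x ∂(riemannianVolume g) ≤
        ∫ x, ρ x * divergence g (fun x => w x • grad g ψ x) x ∂(riemannianVolume g))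
    {φ : M → ℝ} (hφ : IsTestFunction n Ω φ) {β : ℝ} (hβ : β < 0)
    (hβC : (1 - C) / 3 < β) :
    (C - β - 1) ^ 2 / 4 *
        ∫ x, ρ x ^ β * (w x * metricNorm g x (grad g φ x) ^ 2) ∂(riemannianVolume g) ≤
      ∫ x, ρ x ^ (β + 2) * (divergence g (fun x => w x • grad g φ x) x ^ 2 / (b x ^ 2 * w x))
        ∂(riemannianVolume g) := by
  -- The sign `σ = -1` turns the lower bound into the form required by the comparison lemma; the
  -- result is `T ≤ -(C + β - 1) B`.
  obtain ⟨h1, h2⟩ := hG.comparison hρ hΩ hpos hb hGb hw (σ := -1) (C := C)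
    (fun ψ hψ hψ0 => by linarith [hC ψ hψ hψ0]) hφ.mul_self (fun x => mul_self_nonneg (φ x)) β
  -- Half the comparison constant, so that `T ≤ -2 h B`. Positivity of `h` and `-β ≤ h` both come
  -- from `(1 - C) / 3 < β < 0`, since `3 β > 1 - C` is the same as `h > -β`.
  obtain ⟨h, hh⟩ : ∃ h, h = (C + β - 1) / 2 := ⟨_, rfl⟩
  have hh0 : 0 < h := by linarith
  have hβh : -β ≤ h := by linarith
  -- Young's inequality, the comparison and Hardy's inequality give `4 s (1 - (s + β h) / h²) A ≤ R`
  -- when `s + β h ≥ 0`. The coefficient is largest at `s = (h - β) h / 2`, where it equals `(h -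
  -- β)²`.
  have hs : 0 < (h - β) * h / 2 := by
    have : 0 < h - β := by linarith
    positivity
  have h3 := integral_normSq_grad_le g hρ hpos hφ hb hb0 hw hw0 β hs
  rw [h1] at h3
  have hA := integrable_rpow_mul_normSq_grad (g := g) hρ hpos hφ hw.continuous β
  have hB := integrable_rpow_mul_sq (g := g) hρ hpos hφ hb hw.continuous (β - 1 - 1)
  have hT : Integrable (fun x => ρ x ^ (β - 1) * (w x * differential (fun y => φ y * φ y) x (G x)))
      (riemannianVolume g) :=
    integrable_continuousOn_mul g hφ.mul_self.2.1.isCompact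
      (continuousOn_rpow_tsupport hρ hpos hφ.mul_self _) (hG.smul_grad hw hφ.mul_self).1
      fun x hx => by rw [differential_eq_zero_of_notMem_tsupport g hx, mul_zero]
  -- An upper bound for `-T`; together with the lower bound `2 h B ≤ -T` from the comparison it
  -- gives Hardy's inequality.
  have h4 : -∫ x, ρ x ^ (β - 1) * (w x * differential (fun y => φ y * φ y) x (G x))
      ∂(riemannianVolume g) ≤
      h⁻¹ * ∫ x, ρ x ^ β * (w x * metricNorm g x (grad g φ x) ^ 2) ∂(riemannianVolume g) +
      h * ∫ x, ρ x ^ (β - 1 - 1) * (b x ^ 2 * w x * (φ x * φ x)) ∂(riemannianVolume g) := by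
    rw [← integral_neg, ← integral_const_mul, ← integral_const_mul,
      ← integral_add (hA.const_mul _) (hB.const_mul _)]
    refine integral_mono_ae hT.neg ((hA.const_mul _).add (hB.const_mul _)) ?_
    filter_upwards [hGb] with x hx
    by_cases hxφ : x ∈ tsupport φ
    · have hd : |differential φ x (G x)| ≤ metricNorm g x (grad g φ x) * b x := by
        rw [← inner_grad g, ← hx (hφ.2.2 hxφ)]
        exact abs_inner_le g x _ _
      rw [differential_sq (hφ.1 x)]
      exact hardy_rpow (hpos x (hφ.2.2 hxφ)) (hw0 x) hh0 hd β _
    · simp only [differential_sq (hφ.1 x), image_eq_zero_of_notMem_tsupport hxφ,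
        grad_eq_zero_of_notMem_tsupport g hxφ]
      simp [metricNorm]
  set A := ∫ x, ρ x ^ β * (w x * metricNorm g x (grad g φ x) ^ 2) ∂(riemannianVolume g)
  set B := ∫ x, ρ x ^ (β - 1 - 1) * (b x ^ 2 * w x * (φ x * φ x)) ∂(riemannianVolume g)
  set T := ∫ x, ρ x ^ (β - 1) * (w x * differential (fun y => φ y * φ y) x (G x))
      ∂(riemannianVolume g)
  set R := ∫ x, ρ x ^ (β + 2) * (divergence g (fun x => w x • grad g φ x) x ^ 2 / (b x ^ 2 * w x))
        ∂(riemannianVolume g)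
  have hTB : T ≤ -(2 * h * B) := by
    rw [hh]
    linarith
  have hardy : h ^ 2 * B ≤ A := by
    have h5 : h * B ≤ h⁻¹ * A := by linarith
    rw [inv_mul_eq_div, le_div_iff₀ hh0] at h5
    linarith
  have h6 : -β * T ≤ -β * -(2 * h * B) := mul_le_mul_of_nonneg_left hTB (by linarith)
  -- The multiple of `B` left over is `s + β h = (h + β) h / 2`. It is nonnegative by `-β ≤ h`, so
  -- Hardy's inequality may be used to replace `B` by `A / h²`.
  have h7 : A ≤ (4 * ((h - β) * h / 2))⁻¹ * R + (h + β) * h / 2 * B := by linarith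
  have h8 : (h + β) / (2 * h) * (h ^ 2 * B) ≤ (h + β) / (2 * h) * A :=
    mul_le_mul_of_nonneg_left hardy (div_nonneg (by linarith) (by linarith))
  have h9 : (h + β) / (2 * h) * (h ^ 2 * B) = (h + β) * h / 2 * B := by
    field_simp
  have h10 : A - (h + β) / (2 * h) * A = (h - β) / (2 * h) * A := by
    field_simp
    ring
  have h11 : (h - β) / (2 * h) * A ≤ (4 * ((h - β) * h / 2))⁻¹ * R := by linarith
  rw [inv_mul_eq_div, le_div_iff₀ (by linarith)] at h11
  have h12 : (h - β) / (2 * h) * A * (4 * ((h - β) * h / 2)) = (h - β) ^ 2 * A := by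
    field_simp
    ring
  have h13 : h - β = (C - β - 1) / 2 := by
    rw [hh]
    ring
  rw [h12, h13] at h11
  linarith

end Rellich

/-! ### The affine Laplacian as a weighted Riemannian Laplacian -/

section Affine

variable {n : ℕ} {M : Type*} [TopologicalSpace M]
  [ChartedSpace (EuclideanSpace ℝ (Fin n)) M] [IsManifold (𝓡 n) ∞ M]

omit [TopologicalSpace M] [ChartedSpace (EuclideanSpace ℝ (Fin n)) M] in
theorem expWeight_rpow (u : M → ℝ) (x : M) (t : ℝ) : expWeight u x ^ t = Real.exp (t * u x) := by
  rw [expWeight, ← Real.exp_mul, mul_comm]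

omit [IsManifold (𝓡 n) ∞ M] in
theorem contMDiff_exp_mul {u : M → ℝ} (hu : ContMDiff (𝓡 n) 𝓘(ℝ, ℝ) ∞ u) (t : ℝ) :
    ContMDiff (𝓡 n) 𝓘(ℝ, ℝ) ∞ fun x => Real.exp (t * u x) :=
  ContMDiff.comp (I' := 𝓘(ℝ, ℝ)) (g := fun s : ℝ => Real.exp (t * s))
    (contDiff_const.mul contDiff_id).exp.contMDiff hu

theorem differential_exp_mul {u : M → ℝ} (hu : ContMDiff (𝓡 n) 𝓘(ℝ, ℝ) ∞ u) (t : ℝ) (x : M)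
    (v : TangentSpace (𝓡 n) x) :
    differential (fun x => Real.exp (t * u x)) x v =
      Real.exp (t * u x) * t * differential u x v := by
  have h : HasDerivAt (fun s : ℝ => Real.exp (t * s)) (Real.exp (t * u x) * t) (u x) := by
    simpa using ((hasDerivAt_id (u x)).const_mul t).exp
  rw [differential_comp (F := fun s : ℝ => Real.exp (t * s)) (hu x)
    (contDiff_const.mul contDiff_id).exp.contDiffAt, h.deriv]

/-- The affine Laplacian in divergence form. -/
theorem affineLaplacian_eq (g : SmoothMetric n M) {u : M → ℝ}
    (hu : ContMDiff (𝓡 n) 𝓘(ℝ, ℝ) ∞ u) (lam mu : ℝ) {φ : M → ℝ}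
    (hφ : ContMDiff (𝓡 n) 𝓘(ℝ, ℝ) ∞ φ) (x : M) :
    affineLaplacian g u lam mu φ x = Real.exp ((mu - lam - (2 * mu + n * lam)) * u x) *
      divergence g (fun x => Real.exp ((2 * mu + n * lam) * u x) • grad g φ x) x := by
  -- Differentiating the weight `e^{(2μ+nλ)u}` produces precisely the first-order term of the affine
  -- Laplacian.
  rw [divergence_smul g (contMDiff_exp_mul hu _ x) (isSmoothVectorField_grad g hφ x),
    differential_exp_mul hu, ← inner_grad g, affineLaplacian, expWeight_rpow, laplacian]
  have h : Real.exp ((mu - lam - (2 * mu + n * lam)) * u x) *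
      Real.exp ((2 * mu + n * lam) * u x) = Real.exp ((mu - lam) * u x) := by
    rw [← Real.exp_add, ← add_mul, sub_add_cancel]
  linear_combination -(divergence g (grad g φ) x +
    (2 * mu + n * lam) * g.inner x (grad g u x) (grad g φ x)) * h

end Affine

end

/-! ### Translation of the affine inequalities into the weighted ones -/

theorem mainTheorem5 {n : ℕ} {M : Type*} [TopologicalSpace M] [T2Space M]
    [SecondCountableTopology M] [ChartedSpace (EuclideanSpace ℝ (Fin n)) M]
    [IsManifold (𝓡 n) ∞ M] [MeasurableSpace M] [BorelSpace M]
    (g : SmoothMetric n M) (u : M → ℝ) (hu : ContMDiff (𝓡 n) 𝓘(ℝ, ℝ) ∞ u)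
    (lam mu : ℝ) (ρ : M → ℝ) (hρ_cont : Continuous ρ) (hρ_nonneg : ∀ x, 0 ≤ ρ x)
    (hρ_grad : WeakAffineGradNormEqOne g u lam mu {x | ρ x ≠ 0} ρ) :
    (∀ C α : ℝ, C < 1 → 2 < α → α < 3 - C →
      WeakAffineLaplacianLE g u lam mu {x | ρ x ≠ 0} ρ
        (fun x => C / ρ x * expWeight u x ^ (lam - mu)) →
      ∀ φ : M → ℝ, IsTestFunction n {x | ρ x ≠ 0} φ →
        ∫ x, ρ x ^ α * affineLaplacian g u lam mu φ x ^ 2 *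
            expWeight u x ^ (tauExp n lam mu + mu - lam) ∂(riemannianVolume g) ≥
          2 * (α - 2) * (3 - α - C) *
            ∫ x, ρ x ^ (α - 2) * metricNorm g x (affineGrad g u lam mu φ x) ^ 2 *
              expWeight u x ^ (tauExp n lam mu + lam - mu) ∂(riemannianVolume g)) ∧
    (∀ C α : ℝ, 1 < C → (7 - C) / 3 < α → α < 2 →
      WeakAffineLaplacianGE g u lam mu {x | ρ x ≠ 0} ρ
        (fun x => C / ρ x * expWeight u x ^ (lam - mu)) →
      ∀ φ : M → ℝ, IsTestFunction n {x | ρ x ≠ 0} φ →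
        ∫ x, ρ x ^ α * affineLaplacian g u lam mu φ x ^ 2 *
            expWeight u x ^ (tauExp n lam mu + mu - lam) ∂(riemannianVolume g) ≥
          (C - α + 1) ^ 2 / 4 *
            ∫ x, ρ x ^ (α - 2) * metricNorm g x (affineGrad g u lam mu φ x) ^ 2 *
              expWeight u x ^ (tauExp n lam mu + lam - mu) ∂(riemannianVolume g)) := by
  obtain ⟨G, hG, hG1⟩ := hρ_grad
  set Ω : Set M := {x | ρ x ≠ 0} with hΩdef
  have hΩ : IsOpen Ω := isOpen_ne_fun hρ_cont continuous_const
  have hpos : ∀ x ∈ Ω, 0 < ρ x := fun x hx => lt_of_le_of_ne (hρ_nonneg x) (Ne.symm hx)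
  -- These are the weights `w = V^{2μ+nλ}` and `b = V^{λ-μ}`: `w` puts the affine Laplacian in
  -- divergence form, and `b` is the length of the weak gradient of `ρ`.
  set w : M → ℝ := fun x => Real.exp ((2 * mu + n * lam) * u x) with hwdef
  set b : M → ℝ := fun x => Real.exp ((lam - mu) * u x) with hbdef
  have hw : ContMDiff (𝓡 n) 𝓘(ℝ, ℝ) ∞ w := contMDiff_exp_mul hu _
  have hb : Continuous b := (contMDiff_exp_mul hu _).continuous
  have hw0 : ∀ x, 0 < w x := fun x => Real.exp_pos _
  have hb0 : ∀ x, 0 < b x := fun x => Real.exp_pos _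
  have hGb : ∀ᵐ x ∂(riemannianVolume g), x ∈ Ω → metricNorm g x (G x) = b x := by
    filter_upwards [hG1] with x hx hxΩ
    have h1 := congrArg (· ^ 2) (hx hxΩ)
    simp only [metricNorm_sq, map_smul, _root_.smul_apply, smul_eq_mul] at h1
    rw [← metricNorm_sq, expWeight_rpow] at h1
    have h2 : (Real.exp ((mu - lam) * u x) * metricNorm g x (G x)) ^ 2 = 1 ^ 2 := by
      rw [← h1]
      ring
    rw [sq_eq_sq₀ (mul_nonneg (Real.exp_pos _).le (metricNorm_nonneg g x _)) zero_le_one] at h2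
    have h3 : Real.exp ((mu - lam) * u x) * b x = 1 := by
      rw [hbdef, ← Real.exp_add, Real.exp_eq_one_iff]
      ring
    exact mul_left_cancel₀ (Real.exp_pos _).ne' (h2.trans h3.symm)
  -- The prefactor of the divergence form is `V^{-τ}`, because `μ - λ - (2μ + nλ) = -τ`; it cancels
  -- against the measure weight.
  have eS : ∀ ψ : M → ℝ, IsTestFunction n Ω ψ → ∀ x,
      ρ x * affineLaplacian g u lam mu ψ x * expWeight u x ^ tauExp n lam mu =
        ρ x * divergence g (fun x => w x • grad g ψ x) x := fun ψ hψ x => by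
    rw [affineLaplacian_eq g hu lam mu hψ.1, expWeight_rpow, tauExp]
    have : Real.exp ((mu - lam - (2 * mu + n * lam)) * u x) *
        Real.exp ((((n : ℝ) + 1) * lam + mu) * u x) = 1 := by
      rw [← Real.exp_add, Real.exp_eq_one_iff]
      ring
    linear_combination ρ x * divergence g (fun x => w x • grad g ψ x) x * this
  -- Here `V^{λ-μ} V^τ = b² w`, as `τ = (λ - μ) + (2μ + nλ)`.
  have eN : ∀ (C : ℝ) (ψ : M → ℝ) x,
      C / ρ x * expWeight u x ^ (lam - mu) * ψ x * expWeight u x ^ tauExp n lam mu =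
        C / ρ x * b x ^ 2 * w x * ψ x := fun C ψ x => by
    rw [expWeight_rpow, expWeight_rpow, tauExp]
    have : Real.exp ((lam - mu) * u x) * Real.exp ((((n : ℝ) + 1) * lam + mu) * u x) =
        b x ^ 2 * w x := by
      rw [hbdef, hwdef, sq, ← Real.exp_add, ← Real.exp_add, ← Real.exp_add]
      congr 1
      ring
    linear_combination C / ρ x * ψ x * this
  -- The square contributes `V^{-2τ}`, and `V^{-2τ} V^{τ+μ-λ} = V^{-(τ+λ-μ)} = 1 / (b² w)`. The
  -- exponent `α` is written as `α - 2 + 2` to match `β + 2` with `β = α - 2`.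
  have eR : ∀ φ : M → ℝ, IsTestFunction n Ω φ → ∀ (α : ℝ) x,
      ρ x ^ α * affineLaplacian g u lam mu φ x ^ 2 *
          expWeight u x ^ (tauExp n lam mu + mu - lam) =
        ρ x ^ (α - 2 + 2) *
          (divergence g (fun x => w x • grad g φ x) x ^ 2 / (b x ^ 2 * w x)) :=
    fun φ hφ α x => by
    rw [affineLaplacian_eq g hu lam mu hφ.1, expWeight_rpow, tauExp, sub_add_cancel]
    have : Real.exp ((mu - lam - (2 * mu + n * lam)) * u x) ^ 2 *
        Real.exp ((((n : ℝ) + 1) * lam + mu + mu - lam) * u x) * (b x ^ 2 * w x) = 1 := by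
      rw [hbdef, hwdef, sq, sq, ← Real.exp_add, ← Real.exp_add, ← Real.exp_add, ← Real.exp_add,
        ← Real.exp_add, Real.exp_eq_one_iff]
      ring
    rw [← eq_div_iff (mul_pos (pow_pos (hb0 x) 2) (hw0 x)).ne'] at this
    linear_combination
      ρ x ^ α * divergence g (fun x => w x • grad g φ x) x ^ 2 * this
  have eA : ∀ (φ : M → ℝ) (α : ℝ) x,
      ρ x ^ (α - 2) * metricNorm g x (affineGrad g u lam mu φ x) ^ 2 *
          expWeight u x ^ (tauExp n lam mu + lam - mu) =
        ρ x ^ (α - 2) * (w x * metricNorm g x (grad g φ x) ^ 2) := fun φ α x => by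
    simp only [affineGrad, metricNorm_sq, map_smul, _root_.smul_apply, smul_eq_mul,
      expWeight_rpow, tauExp]
    have : Real.exp ((mu - lam) * u x) ^ 2 *
        Real.exp ((((n : ℝ) + 1) * lam + mu + lam - mu) * u x) = w x := by
      rw [hwdef, sq, ← Real.exp_add, ← Real.exp_add]
      congr 1
      ring
    linear_combination ρ x ^ (α - 2) * g.inner x (grad g φ x) (grad g φ x) * this
  refine ⟨fun C α hC hα hαC hLE φ hφ => ?_, fun C α hC hαC hα hGE φ hφ => ?_⟩
  · simp only [eR φ hφ, eA]
    have h := hG.rellich_of_le hρ_cont hΩ hpos hb hb0 hGb hw hw0 (C := C)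
      (fun ψ hψ hψ0 => by simpa only [eS ψ hψ, eN] using hLE ψ hψ hψ0) hφ
      (β := α - 2) (by linarith) (by linarith)
    rwa [show 1 - (α - 2) - C = 3 - α - C by ring] at h
  · simp only [eR φ hφ, eA]
    have h := hG.rellich_of_ge hρ_cont hΩ hpos hb hb0 hGb hw hw0 (C := C)
      (fun ψ hψ hψ0 => by simpa only [eS ψ hψ, eN] using hGE ψ hψ hψ0) hφ
      (β := α - 2) (by linarith) (by linarith)
    rwa [show C - (α - 2) - 1 = C - α + 1 by ring] at h
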